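/- Let $(g,J)$ be a K\"ahler structure on a connected open subset $U$ of a real vector space of dimension $2m\ge 4$ (a coordinate domain of a K\"ahler manifold), with K\"ahler form $\omega=g(J\cdot,\cdot)$ and Levi-Civita connection $\nabla$. All tensor fields are smooth. Write $JX^\flat=(JX)^\flat$ and $J\alpha=-\alpha\circ J$ for 1-forms. Let $\mathrm{Sol}(g,J)$ be the space of $g$-symmetric endomorphism fields $A$ commuting with $J$ for which there is a vector field $\Lambda$ with $$\nabla_XA=X^\flat\otimes\Lambda+\Lambda^\flat\otimes X+JX^\flat\otimes J\Lambda+J\Lambda^\flat\otimes JX\quad\text{for all }X.\qquad(1)$$ The extended system for $(A,\Lambda,\mu)$, $\mu$ a function, consists of (1) for a $(g,J)$-hermitian $A$ together with $$\nabla\Lambda=\mu\,\mathrm{Id}-A,\qquad \nabla\mu=-2\Lambda^\flat .\qquad(2)$$ Assume that $g$ is $\mathrm C_{\mathbb C}(-1)$, i.e. that the extended system has some solution whose vector field is not identically zero. Let $A\in\mathrm{Sol}(g,J)$ with vector field $\Lambda$, and suppose that $g$ is given on $U$ by the following normal form relative to $A$. There are smooth functions $\xi_1,\dots,\xi_\ell$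 on $U$, pairwise distinct at every point, smooth 1-forms $\theta_1,\dots,\theta_\ell$, functions $\Theta_1,\dots,\Theta_\ell$ of one variable with $\Theta_j(\xi_j)\ne0$ on $U$, and finitely many distinct real constants $\eta$ with multiplicities $m_\eta\ge1$, $m=\ell+\sum_\eta m_\eta$, each with a base $(S_\eta,g_\eta,J_\eta)$, an open subset of $\mathbb R^{2m_\eta}$ with $g_\eta$ or $-g_\eta$ K\"ahler, $\omega_\eta=g_\eta(J_\eta\cdot,\cdot)$, and a smooth map $U\to S_\eta$ along which $g_\eta,\omega_\eta$ are pulled back, such that $$g=\sum_\eta p_{\rm nc}(\eta)g_\eta+\sum_{j}\frac{\Delta_j}{\Theta_j(\xi_j)}d\xi_j^2+\sum_{j}\frac{\Theta_j(\xi_j)}{\Delta_j}\,\vartheta_j^2,\qquad \vartheta_j=\sum_{r=1}^\ell\sigma_{r-1}(\hat\xi_j)\theta_r,$$ $$\omega=\sum_\eta p_{\rm nc}(\eta)\omega_\eta+\sum_{r=1}^\ell d\sigma_r\wedge\theta_r,\qquad d\theta_r=\sum_\eta(-1)^r\eta^{\ell-r}\omega_\eta,\qquad J\,d\xi_j=\frac{\Theta_j(\xi_j)}{\Delta_j}\vartheta_j,$$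 $$g(AX,Y)=\phi(X,JY),\qquad \phi=\sum_\eta\eta\,p_{\rm nc}(\eta)\omega_\eta+\sum_j\xi_j\,d\xi_j\wedge\vartheta_j .$$ Here $p_{\rm nc}(t)=\prod_i(t-\xi_i)$, $\Delta_j=\prod_{k\ne j}(\xi_j-\xi_k)$, and $\sigma_r$, $\sigma_{r-1}(\hat\xi_j)$ are the elementary symmetric functions of $\{\xi_1,\dots,\xi_\ell\}$ and of $\{\xi_k:k\neq j\}$ of the indicated degrees. Let $\tau$ be a smooth 1-form on $U$ with $d\tau=-2\omega$, and let $\hat M=\mathbb R_{>0}\times\mathbb R\times U$ (coordinates $r,t$ on the first two factors) be the complex cone $$\hat g=dr^2+r^2(\varphi^2+g),\qquad \hat J=\tfrac1r\partial_t\otimes dr-r\,\partial_r\otimes\varphi+J,\qquad \varphi=dt-\tau ,$$ where $J$ acts on $\ker dr\cap\ker\varphi\cong TU$. Then there are a function $\mu$ such that $(A,\Lambda,\mu)$ solves the extended system (1)--(2) and an endomorphism field $\hat A$ of $T\hat M$ corresponding to it, i.e. with $$\hat g(\hat A\cdot,\cdot)=\mu\,dr^2-r\,dr\odot\Lambda^\flat+r^2\bigl(\mu\varphi^2+\varphi\odot\Lambda^\flat(J\cdot)+g(A\cdot,\cdot)\bigr),\qquad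 \alpha\odot\beta=\alpha\otimes\beta+\beta\otimes\alpha .$$ The endomorphism $\hat A$ is $\hat g$-symmetric, commutes with $\hat J$ and is parallel for the Levi-Civita connection of $\hat g$. At every point of $\hat M$ its set of eigenvalues is one and the same set of $\ell+1$ real numbers $C_0<\dots<C_\ell$, and for $j=1,\dots,\ell$ $$\Theta_j(t)=-4\prod_{I=0}^{\ell}(t-C_I)\qquad\text{for all }t\in\xi_j(U).$$ -/

import Mathlib

open scoped ContDiff

noncomputable section

namespace CProj

/-! ### Riemannian and Kähler geometry on an open subset of a real vector space -/

section Geometry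

variable {V : Type*} [NormedAddCommGroup V] [NormedSpace ℝ V]

/-- A field of bilinear forms; `g x X Y` is the value of the form at `x` on `X`, `Y`. -/
abbrev BilinField (V : Type*) [NormedAddCommGroup V] [NormedSpace ℝ V] := V → V →L[ℝ] V →L[ℝ] ℝ

/-- A field of endomorphisms of the tangent spaces. -/
abbrev EndField (V : Type*) [NormedAddCommGroup V] [NormedSpace ℝ V] := V → V →L[ℝ] V

/-- `g` restricts to a smooth Riemannian metric on `U`. -/
structure IsRiemannianOn (U : Set V) (g : BilinField V) : Prop where
  smooth : ContDiffOn ℝ ∞ g U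
  symm : ∀ x ∈ U, ∀ X Y, g x X Y = g x Y X
  pos : ∀ x ∈ U, ∀ X, X ≠ 0 → 0 < g x X X

/-- The Christoffel symbols of the first kind, as the covector
`Z ↦ (∂_X g(Y, Z) + ∂_Y g(X, Z) - ∂_Z g(X, Y)) / 2`. -/
def christoffelFlat (g : BilinField V) (x X Y : V) : V →L[ℝ] ℝ :=
  (1 / 2 : ℝ) • (fderiv ℝ g x X Y + fderiv ℝ g x Y X - ((fderiv ℝ g x).flip X).flip Y)

/-- The Christoffel symbols `Γ_x(X, Y)` of the Levi-Civita connection of `g`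
(the index is raised with the inverse of `g x : V → V*`). -/
def christoffel (g : BilinField V) (x X Y : V) : V :=
  (g x).inverse (christoffelFlat g x X Y)

/-- The Levi-Civita covariant derivative `∇_X Z` of a vector field `Z` at `x`. -/
def covDerivVec (g : BilinField V) (Z : V → V) (x X : V) : V :=
  fderiv ℝ Z x X + christoffel g x X (Z x)

/-- The Levi-Civita covariant derivative `(∇_X A) Y` of an endomorphism field `A` at `x`. -/
def covDerivEnd (g : BilinField V) (A : EndField V) (x X Y : V) : V :=
  fderiv ℝ A x X Y + christoffel g x X (A x Y) - A x (christoffel g x X Y)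

/-- The exterior derivative of a `1`-form:
`dα(X, Y) = ∂_X α(Y) - ∂_Y α(X)` for constant vector fields `X`, `Y`. -/
def extDerivOne (α : V → V →L[ℝ] ℝ) (x X Y : V) : ℝ :=
  fderiv ℝ α x X Y - fderiv ℝ α x Y X

/-- The wedge product of two covectors, `α ∧ β = α ⊗ β - β ⊗ α`. -/
def wedge (α β : V →L[ℝ] ℝ) (X Y : V) : ℝ := α X * β Y - α Y * β X

/-- The tensor product of two covectors, `(α ⊗ β)(X, Y) = α(X) β(Y)`. -/
def tens (α β : V →L[ℝ] ℝ) : V →L[ℝ] V →L[ℝ] ℝ := α.smulRight β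

/-- `(g, J)` is a Kähler structure on `U`: a Riemannian metric and a `g`-orthogonal almost complex
structure which is parallel for the Levi-Civita connection. -/
structure IsKahlerOn (U : Set V) (g : BilinField V) (J : EndField V) : Prop where
  riemannian : IsRiemannianOn U g
  smooth_J : ContDiffOn ℝ ∞ J U
  J_sq : ∀ x ∈ U, ∀ X, J x (J x X) = -X
  hermitian : ∀ x ∈ U, ∀ X Y, g x (J x X) (J x Y) = g x X Y
  parallel_J : ∀ x ∈ U, ∀ X Y, covDerivEnd g J x X Y = 0

/-- The Kähler form `ω = g(J·, ·)`. -/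
def kahlerForm (g : BilinField V) (J : EndField V) (x X Y : V) : ℝ := g x (J x X) Y

/-- `A` is a smooth `(g, J)`-hermitian endomorphism field on `U`:
`g`-symmetric and commuting with `J`. -/
structure IsHermitianEndOn (U : Set V) (g : BilinField V) (J A : EndField V) : Prop where
  smooth : ContDiffOn ℝ ∞ A U
  symm : ∀ x ∈ U, ∀ X Y, g x (A x X) Y = g x X (A x Y)
  comm : ∀ x ∈ U, ∀ X, A x (J x X) = J x (A x X)

/-- `A` is parallel on `U` for the Levi-Civita connection of `g`. -/
def IsParallelOn (U : Set V) (g : BilinField V) (A : EndField V) : Prop :=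
  ∀ x ∈ U, ∀ X Y, covDerivEnd g A x X Y = 0

/-- `A ∈ Sol(g, J)` with associated vector field `Λ`: the hermitian endomorphism `A` satisfies
`∇_X A = X♭ ⊗ Λ + Λ♭ ⊗ X + JX♭ ⊗ JΛ + JΛ♭ ⊗ JX`. -/
structure IsSolOn (U : Set V) (g : BilinField V) (J A : EndField V) (L : V → V) : Prop where
  hermitian : IsHermitianEndOn U g J A
  smooth_L : ContDiffOn ℝ ∞ L U
  main : ∀ x ∈ U, ∀ X Y, covDerivEnd g A x X Y =
    g x X Y • L x + g x (L x) Y • X + g x (J x X) Y • J x (L x) + g x (J x (L x)) Y • J x X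

/-- `(A, Λ, μ)` solves the extended system with constant `B`: `A ∈ Sol(g, J)` with vector field
`Λ`, `∇Λ = μ Id + B A` and `∇μ = 2 B Λ♭`. -/
structure IsExtSolOn (U : Set V) (g : BilinField V) (J : EndField V) (B : ℝ)
    (A : EndField V) (L : V → V) (μ : V → ℝ) : Prop where
  sol : IsSolOn U g J A L
  smooth_μ : ContDiffOn ℝ ∞ μ U
  cov_L : ∀ x ∈ U, ∀ X, covDerivVec g L x X = μ x • X + B • A x X
  d_μ : ∀ x ∈ U, ∀ X, fderiv ℝ μ x X = 2 * B * g x (L x) X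

/-- The metric is `C_ℂ(B)`: the extended system with constant `B` has a solution whose vector
field does not vanish identically. -/
def IsCC (U : Set V) (g : BilinField V) (J : EndField V) (B : ℝ) : Prop :=
  ∃ (A : EndField V) (L : V → V) (μ : V → ℝ), IsExtSolOn U g J B A L μ ∧ ∃ x ∈ U, L x ≠ 0

end Geometry

/-! ### The local normal form relative to a solution -/

/-- `σ_r(ξ_1, …, ξ_ℓ)`. -/
def sigma {ℓ : ℕ} (ξ : Fin ℓ → ℝ) (r : ℕ) : ℝ := ((Finset.univ : Finset (Fin ℓ)).val.map ξ).esymm r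

/-- `σ_r(ξ̂_j)`, the `r`th elementary symmetric function of `{ξ_k : k ≠ j}`. -/
def sigmaHat {ℓ : ℕ} (ξ : Fin ℓ → ℝ) (j : Fin ℓ) (r : ℕ) : ℝ :=
  ((Finset.univ.erase j).val.map ξ).esymm r

/-- `Δ_j = ∏_{k ≠ j} (ξ_j - ξ_k)`. -/
def Delta {ℓ : ℕ} (ξ : Fin ℓ → ℝ) (j : Fin ℓ) : ℝ := ∏ k ∈ Finset.univ.erase j, (ξ j - ξ k)

/-- `p_nc(t) = ∏_i (t - ξ_i)`. -/
def pnc {ℓ : ℕ} (ξ : Fin ℓ → ℝ) (t : ℝ) : ℝ := ∏ i, (t - ξ i)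

/-- The ingredients of the normal form: `k` constants `η_i` with multiplicities `m_i`, bases
`(S_i, g_i, J_i)` of real dimension `2 m_i` with projections `pr_i` onto them, functions
`ξ_1, …, ξ_ℓ`, `1`-forms `θ_1, …, θ_ℓ` (`θ r` is `θ_{r+1}`, as `Fin ℓ` starts at `0`)
and functions `Θ_1, …, Θ_ℓ` of one variable. -/
structure NormalFormData (E : Type*) [NormedAddCommGroup E] [NormedSpace ℝ E] (ℓ k : ℕ) where
  η : Fin k → ℝ
  mult : Fin k → ℕ
  S : ∀ i, Set (EuclideanSpace ℝ (Fin (2 * mult i)))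
  gB : ∀ i, BilinField (EuclideanSpace ℝ (Fin (2 * mult i)))
  JB : ∀ i, EndField (EuclideanSpace ℝ (Fin (2 * mult i)))
  pr : ∀ i, E → EuclideanSpace ℝ (Fin (2 * mult i))
  ξ : Fin ℓ → E → ℝ
  θ : Fin ℓ → E → E →L[ℝ] ℝ
  Θ : Fin ℓ → ℝ → ℝ

namespace NormalFormData

variable {E : Type*} [NormedAddCommGroup E] [NormedSpace ℝ E] {ℓ k : ℕ}
  (N : NormalFormData E ℓ k)

/-- The values `ξ_1(x), …, ξ_ℓ(x)`. -/
def xi (x : E) : Fin ℓ → ℝ := fun j => N.ξ j x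

/-- The pullback to `E` of the base metric `g_i`. -/
def baseMetric (i : Fin k) (x X Y : E) : ℝ :=
  N.gB i (N.pr i x) (fderiv ℝ (N.pr i) x X) (fderiv ℝ (N.pr i) x Y)

/-- The pullback to `E` of the base Kähler form `ω_i`. -/
def baseForm (i : Fin k) (x X Y : E) : ℝ :=
  kahlerForm (N.gB i) (N.JB i) (N.pr i x) (fderiv ℝ (N.pr i) x X) (fderiv ℝ (N.pr i) x Y)

/-- The `1`-form `∑_{r=1}^ℓ σ_{r-1}(ξ̂_j) θ_r`. -/
def fibreForm (j : Fin ℓ) (x : E) : E →L[ℝ] ℝ :=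
  ∑ r : Fin ℓ, sigmaHat (N.xi x) j (r : ℕ) • N.θ r x

/-- The Kähler structure `(g, J)` is given on `U` by the normal form with ingredients `N`, relative
to the endomorphism `A`. The base metrics are Kähler up to sign, since `p_nc(η_i)` may be
negative. On covectors, `Jα = -α ∘ J`. -/
structure IsNormalFormOn (U : Set E) (g : BilinField E) (J A : EndField E) : Prop where
  η_injective : Function.Injective N.η
  mult_pos : ∀ i, 0 < N.mult i
  finrank_eq : Module.finrank ℝ E = 2 * (ℓ + ∑ i, N.mult i)
  isOpen_base : ∀ i, IsOpen (N.S i)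
  kahler_base : ∀ i, IsKahlerOn (N.S i) (N.gB i) (N.JB i) ∨ IsKahlerOn (N.S i) (-N.gB i) (N.JB i)
  smooth_pr : ∀ i, ContDiffOn ℝ ∞ (N.pr i) U
  pr_mem : ∀ i, ∀ x ∈ U, N.pr i x ∈ N.S i
  smooth_ξ : ∀ j, ContDiffOn ℝ ∞ (N.ξ j) U
  smooth_θ : ∀ r, ContDiffOn ℝ ∞ (N.θ r) U
  ξ_injective : ∀ x ∈ U, Function.Injective (N.xi x)
  Θ_ne_zero : ∀ j, ∀ x ∈ U, N.Θ j (N.ξ j x) ≠ 0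
  /-- `g = ∑_η p_nc(η) g_η + ∑_j (Δ_j / Θ_j(ξ_j)) dξ_j²
    + ∑_j (Θ_j(ξ_j) / Δ_j) (∑_r σ_{r-1}(ξ̂_j) θ_r)²` -/
  metric_eq : ∀ x ∈ U, ∀ X Y, g x X Y =
    ∑ i, pnc (N.xi x) (N.η i) * N.baseMetric i x X Y
      + ∑ j, Delta (N.xi x) j / N.Θ j (N.ξ j x) *
          (fderiv ℝ (N.ξ j) x X * fderiv ℝ (N.ξ j) x Y)
      + ∑ j, N.Θ j (N.ξ j x) / Delta (N.xi x) j * (N.fibreForm j x X * N.fibreForm j x Y)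
  /-- `ω = ∑_η p_nc(η) ω_η + ∑_r dσ_r ∧ θ_r` -/
  kahlerForm_eq : ∀ x ∈ U, ∀ X Y, kahlerForm g J x X Y =
    ∑ i, pnc (N.xi x) (N.η i) * N.baseForm i x X Y
      + ∑ r : Fin ℓ, wedge (fderiv ℝ (fun y => sigma (N.xi y) (r + 1)) x) (N.θ r x) X Y
  /-- `dθ_r = ∑_η (-1)^r η^{ℓ-r} ω_η` -/
  dθ_eq : ∀ x ∈ U, ∀ (r : Fin ℓ) X Y, extDerivOne (N.θ r) x X Y =
    ∑ i, (-1) ^ ((r : ℕ) + 1) * N.η i ^ (ℓ - ((r : ℕ) + 1)) * N.baseForm i x X Y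
  /-- `J dξ_j = (Θ_j(ξ_j) / Δ_j) ∑_r σ_{r-1}(ξ̂_j) θ_r` -/
  J_dξ : ∀ x ∈ U, ∀ j X, -fderiv ℝ (N.ξ j) x (J x X) =
    N.Θ j (N.ξ j x) / Delta (N.xi x) j * N.fibreForm j x X
  /-- `g(AX, Y) = φ(X, JY)` for the hamiltonian `2`-form
    `φ = ∑_η η p_nc(η) ω_η + ∑_j ξ_j dξ_j ∧ (∑_r σ_{r-1}(ξ̂_j) θ_r)` -/
  hamiltonian_eq : ∀ x ∈ U, ∀ X Y, g x (A x X) Y =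
    ∑ i, N.η i * pnc (N.xi x) (N.η i) * N.baseForm i x X (J x Y)
      + ∑ j, N.ξ j x * wedge (fderiv ℝ (N.ξ j) x) (N.fibreForm j x) X (J x Y)

end NormalFormData

/-! ### The complex cone -/

section Cone

variable {E : Type*} [NormedAddCommGroup E] [NormedSpace ℝ E]

/-- The cone `ℝ_{>0} × ℝ × U`, with points `(r, t, x)`. -/
def coneSet (U : Set E) : Set (ℝ × ℝ × E) := {p | 0 < p.1 ∧ p.2.2 ∈ U}

/-- The projection `(r, t, x) ↦ x`. -/
def projE : (ℝ × ℝ × E) →L[ℝ] E :=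
  (ContinuousLinearMap.snd ℝ ℝ E).comp (ContinuousLinearMap.snd ℝ ℝ (ℝ × E))

/-- The `1`-form `dr`. -/
def dr : (ℝ × ℝ × E) →L[ℝ] ℝ := ContinuousLinearMap.fst ℝ ℝ (ℝ × E)

/-- The `1`-form `dt`. -/
def dt : (ℝ × ℝ × E) →L[ℝ] ℝ :=
  (ContinuousLinearMap.fst ℝ ℝ E).comp (ContinuousLinearMap.snd ℝ ℝ (ℝ × E))

/-- The `1`-form `φ = dt - τ` on the cone. -/
def conePhi (τ : E → E →L[ℝ] ℝ) (p : ℝ × ℝ × E) : (ℝ × ℝ × E) →L[ℝ] ℝ :=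
  dt - (τ p.2.2).comp projE

/-- The cone metric `ĝ = dr² + r² (φ² + g)`. -/
def coneMetric (g : BilinField E) (τ : E → E →L[ℝ] ℝ) : BilinField (ℝ × ℝ × E) := fun p =>
  tens dr dr + p.1 ^ 2 • (tens (conePhi τ p) (conePhi τ p) + (g p.2.2).bilinearComp projE projE)

/-- The horizontal lift `X ↦ X + τ(X) ∂_t`, with values in `ker dr ∩ ker φ`. -/
def horLift (τ : E → E →L[ℝ] ℝ) (x : E) : E →L[ℝ] (ℝ × ℝ × E) :=
  (0 : E →L[ℝ] ℝ).prod ((τ x).prod (ContinuousLinearMap.id ℝ E))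

/-- The complex structure `Ĵ = r⁻¹ ∂_t ⊗ dr - r ∂_r ⊗ φ + J` of the cone, where `J` acts on
`ker dr ∩ ker φ` through the horizontal lift. -/
def coneJ (J : EndField E) (τ : E → E →L[ℝ] ℝ) : EndField (ℝ × ℝ × E) := fun p =>
  dr.smulRight ((0, p.1⁻¹, 0) : ℝ × ℝ × E) - (conePhi τ p).smulRight ((p.1, 0, 0) : ℝ × ℝ × E)
    + (horLift τ p.2.2).comp ((J p.2.2).comp projE)

/-- The symmetric product `α ⊙ β = α ⊗ β + β ⊗ α`. -/
def symProd {V : Type*} [NormedAddCommGroup V] [NormedSpace ℝ V] (α β : V →L[ℝ] ℝ) :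
    V →L[ℝ] V →L[ℝ] ℝ := tens α β + tens β α

/-- The bilinear form
`μ dr² - r dr ⊙ Λ♭ + r² (μ φ² + φ ⊙ Λ♭(J·) + g(A·, ·))` on the cone. -/
def coneForm (g : BilinField E) (J : EndField E) (τ : E → E →L[ℝ] ℝ)
    (A : EndField E) (L : E → E) (μ : E → ℝ) : BilinField (ℝ × ℝ × E) := fun p =>
  μ p.2.2 • tens dr dr - p.1 • symProd dr ((g p.2.2 (L p.2.2)).comp projE)
    + p.1 ^ 2 • (μ p.2.2 • tens (conePhi τ p) (conePhi τ p)
      + symProd (conePhi τ p) ((g p.2.2 (L p.2.2)).comp ((J p.2.2).comp projE))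
      + (g p.2.2).bilinearComp ((A p.2.2).comp projE) projE)

/-- The endomorphism field `Ahat` of the cone over `U` corresponds to the triple `(A, Λ, μ)`:
`ĝ(Â·, ·) = μ dr² - r dr ⊙ Λ♭ + r² (μ φ² + φ ⊙ Λ♭(J·) + g(A·, ·))`. -/
def ConeCorresponds (U : Set E) (g : BilinField E) (J : EndField E) (τ : E → E →L[ℝ] ℝ)
    (A : EndField E) (L : E → E) (μ : E → ℝ) (Ahat : EndField (ℝ × ℝ × E)) : Prop :=
  ∀ p ∈ coneSet U, ∀ v w, coneMetric g τ p (Ahat p v) w = coneForm g J τ A L μ p v w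

end Cone

end CProj

end

noncomputable section

set_option maxSynthPendingDepth 3
set_option linter.unusedSectionVars false

/-! There are three ingredients.

Every solution extends. The given solution of the extended system has a vector field `L₀` that is
nonzero on a dense subset of `U`, by unique continuation (`IsExtSolOn.mem_closure`). Where `L₀ ≠ 0`,
the vectors `L₀` and `J L₀` lie in the nullity of `R + K`, with `K` the model tensor `holCurv`.
Inserting them into the integrability condition of (1) for an arbitrary `A` shows that `∇Λ + A` is a
multiple of the identity, the multiple being `μ`; density extends this to `U`
(`IsSolOn.exists_isExtSolOn`). The argument needs `∇Λ` to be symmetric, which the normal form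
supplies: `Λ = ½ ∑ grad ξ_j` is a gradient.

The cone turns a solution into a parallel endomorphism. `coneEnd` is written explicitly, and its
parallelism is a computation with the Christoffel symbols of the cone (`christoffel_cone`,
`coneEnd_parallel`).

The spectrum is governed by a bordered diagonal matrix. The fields `grad ξ_j` are eigenvectors of
`A` for `ξ_j`, and `Λ` has no component along the bases. On the span of `∂_r` and the `grad ξ_j`,
the cone endomorphism is therefore, in an orthonormal frame, diagonal with entries `μ, ξ_1, …, ξ_ℓ`
up to a border whose entries have squares `a_j = |grad ξ_j|²/4 = Θ_j(ξ_j)/(4Δ_j) > 0`. Its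
characteristic polynomial is `P(c) = (c - μ) ∏ (c - ξ_i) - ∑_j a_j ∏_{i ≠ j} (c - ξ_i)`. Setting `c
= ξ_j` leaves `P(ξ_j) = -a_j Δ_j = -Θ_j(ξ_j)/4`, which is the asserted formula once `P` is known to
be constant on `U` with `ℓ + 1` distinct real roots. The extended system gives `dP = 0`
(`fderiv_conePoly_of_ne`, `conePoly_eq`); positivity of the `a_j` makes the roots real and simple
(`exists_strictMono_roots_arrowPoly`). Each root is an eigenvalue, and the only other candidates,
the constants `η_i`, are themselves roots of `P` (`eval_conePoly_η`). -/

namespace CProj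

/-! ### Levi-Civita connection and curvature in coordinates -/

section Calculus

variable {V : Type*} [NormedAddCommGroup V] [NormedSpace ℝ V] [FiniteDimensional ℝ V]
  {U : Set V} {g : BilinField V} {x : V}

lemma two_le_smooth : minSmoothness ℝ 2 ≤ (∞ : WithTop ℕ∞) := by
  rw [minSmoothness_of_isRCLikeNormedField]
  exact WithTop.coe_le_coe.2 le_top

lemma IsRiemannianOn.injective (hg : IsRiemannianOn U g) (hx : x ∈ U) :
    Function.Injective (g x) := by
  rw [injective_iff_map_eq_zero]
  intro X h
  by_contra hX
  have := hg.pos x hx X hX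
  rw [h] at this
  simp at this

lemma IsRiemannianOn.ext (hg : IsRiemannianOn U g) (hx : x ∈ U) {X Y : V}
    (h : ∀ Z, g x X Z = g x Y Z) : X = Y :=
  hg.injective hx (ContinuousLinearMap.ext h)

/-- Positive definiteness in finite dimension makes `(g x).inverse` a genuine inverse rather than
its default value, and makes inversion smooth at `g x`. -/
lemma IsRiemannianOn.exists_equiv (hg : IsRiemannianOn U g) (hx : x ∈ U) :
    ∃ e : V ≃L[ℝ] (V →L[ℝ] ℝ), (e : V →L[ℝ] V →L[ℝ] ℝ) = g x := by
  have hd : Module.finrank ℝ V = Module.finrank ℝ (V →L[ℝ] ℝ) := by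
    rw [← (LinearMap.toContinuousLinearMap (𝕜 := ℝ) (E := V) (F' := ℝ)).finrank_eq]
    exact Subspace.dual_finrank_eq.symm
  refine ⟨(LinearEquiv.ofInjectiveOfFinrankEq (g x : V →ₗ[ℝ] V →L[ℝ] ℝ)
    (hg.injective hx) hd).toContinuousLinearEquiv, ?_⟩
  ext X Y
  rfl

lemma IsRiemannianOn.apply_inverse (hg : IsRiemannianOn U g) (hx : x ∈ U) (α : V →L[ℝ] ℝ) :
    g x ((g x).inverse α) = α := by
  obtain ⟨e, he⟩ := hg.exists_equiv hx
  rw [← he, ContinuousLinearMap.inverse_equiv]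
  simp

lemma IsRiemannianOn.contDiffAt (hg : IsRiemannianOn U g) (hU : IsOpen U) (hx : x ∈ U) :
    ContDiffAt ℝ ∞ g x := hg.smooth.contDiffAt (hU.mem_nhds hx)

lemma IsRiemannianOn.contDiffAt_inverse (hg : IsRiemannianOn U g) (hU : IsOpen U) (hx : x ∈ U) :
    ContDiffAt ℝ ∞ (fun y => (g y).inverse) x := by
  obtain ⟨e, he⟩ := hg.exists_equiv hx
  have h := contDiffAt_map_inverse (n := ∞) (𝕜 := ℝ) e
  rw [he] at h
  exact h.comp x (hg.contDiffAt hU hx)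

/-- The Christoffel symbols of the first kind as a bilinear map. -/
def christoffelFlatCLM (g : BilinField V) (x : V) : V →L[ℝ] V →L[ℝ] V →L[ℝ] ℝ :=
  (1 / 2 : ℝ) • (fderiv ℝ g x + (fderiv ℝ g x).flip -
    ((ContinuousLinearMap.flipₗᵢ ℝ V V ℝ).toContinuousLinearEquiv :
      (V →L[ℝ] V →L[ℝ] ℝ) →L[ℝ] _).comp (fderiv ℝ g x).flip)

/-- The Christoffel symbols as a bilinear map. -/
def christoffelCLM (g : BilinField V) (x : V) : V →L[ℝ] V →L[ℝ] V :=
  (ContinuousLinearMap.compL ℝ V (V →L[ℝ] ℝ) V (g x).inverse).comp (christoffelFlatCLM g x)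

lemma christoffelFlatCLM_apply (g : BilinField V) (x X Y : V) :
    christoffelFlatCLM g x X Y = christoffelFlat g x X Y := by
  ext Z
  simp [christoffelFlatCLM, christoffelFlat]

lemma christoffelCLM_apply (g : BilinField V) (x X Y : V) :
    christoffelCLM g x X Y = christoffel g x X Y := by
  simp [christoffelCLM, christoffel, christoffelFlatCLM_apply]

lemma IsRiemannianOn.contDiffAt_christoffelCLM (hg : IsRiemannianOn U g) (hU : IsOpen U)
    (hx : x ∈ U) : ContDiffAt ℝ ∞ (christoffelCLM g) x := by
  have hd : ContDiffAt ℝ ∞ (fderiv ℝ g) x :=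
    (hg.contDiffAt hU hx).fderiv_right (m := ∞) (by simp)
  have hflip : ContDiffAt ℝ ∞ (fun y => (fderiv ℝ g y).flip) x :=
    (ContinuousLinearMap.flipₗᵢ ℝ V V (V →L[ℝ] ℝ)).contDiff.contDiffAt.comp x hd
  have h1 : ContDiffAt ℝ ∞ (christoffelFlatCLM g) x := by
    unfold christoffelFlatCLM
    exact ((hd.add hflip).sub (contDiffAt_const.clm_comp hflip)).const_smul _
  unfold christoffelCLM
  exact ((ContinuousLinearMap.compL ℝ V (V →L[ℝ] ℝ) V).contDiff.contDiffAt.comp x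
    (hg.contDiffAt_inverse hU hx)).clm_comp h1

lemma fderiv_symm (hg : IsRiemannianOn U g) (hU : IsOpen U) (hx : x ∈ U) (X Y Z : V) :
    fderiv ℝ g x X Y Z = fderiv ℝ g x X Z Y := by
  have hd : DifferentiableAt ℝ g x := (hg.contDiffAt hU hx).differentiableAt (by simp)
  have key : ∀ Y Z, fderiv ℝ (fun y => g y Y Z) x X = fderiv ℝ g x X Y Z := by
    intro Y Z
    rw [fderiv_clm_apply (hd.clm_apply (differentiableAt_const _)) (differentiableAt_const _),
      fderiv_clm_apply hd (differentiableAt_const _)]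
    simp
  rw [← key, ← key]
  congr 1
  apply Filter.EventuallyEq.fderiv_eq
  filter_upwards [hU.mem_nhds hx] with y hy using hg.symm y hy Y Z

lemma IsRiemannianOn.apply_christoffel (hg : IsRiemannianOn U g) (hx : x ∈ U) (X Y Z : V) :
    g x (christoffel g x X Y) Z =
      (fderiv ℝ g x X Y Z + fderiv ℝ g x Y X Z - fderiv ℝ g x Z X Y) / 2 := by
  rw [christoffel, hg.apply_inverse hx]
  simp [christoffelFlat]
  ring

lemma christoffel_comm (hg : IsRiemannianOn U g) (hU : IsOpen U) (hx : x ∈ U) (X Y : V) :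
    christoffel g x X Y = christoffel g x Y X := by
  refine hg.ext hx fun Z => ?_
  rw [hg.apply_christoffel hx, hg.apply_christoffel hx, fderiv_symm hg hU hx Z X Y]
  ring

/-- `∂_X (g(Z, W)) = g(∇_X Z, W) + g(Z, ∇_X W)`. -/
lemma fderiv_metric (hg : IsRiemannianOn U g) (hU : IsOpen U) (hx : x ∈ U) {Z W : V → V}
    (hZ : DifferentiableAt ℝ Z x) (hW : DifferentiableAt ℝ W x) (X : V) :
    fderiv ℝ (fun y => g y (Z y) (W y)) x X =
      g x (covDerivVec g Z x X) (W x) + g x (Z x) (covDerivVec g W x X) := by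
  have hd : DifferentiableAt ℝ g x := (hg.contDiffAt hU hx).differentiableAt (by simp)
  rw [fderiv_clm_apply (hd.clm_apply hZ) hW, fderiv_clm_apply hd hZ]
  simp only [covDerivVec, map_add, add_apply, ContinuousLinearMap.comp_apply,
    ContinuousLinearMap.flip_apply]
  rw [hg.symm x hx (Z x) (christoffel g x X (W x)), hg.apply_christoffel hx,
    hg.apply_christoffel hx, fderiv_symm hg hU hx X (W x) (Z x),
    fderiv_symm hg hU hx (W x) X (Z x), fderiv_symm hg hU hx (Z x) X (W x)]
  have h1 := fderiv_symm hg hU hx (W x) X (Z x)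
  have h2 := fderiv_symm hg hU hx (Z x) X (W x)
  linarith

lemma covDerivVec_const (X Y : V) : covDerivVec g (fun _ => Y) x X = christoffel g x X Y := by
  simp [covDerivVec]

lemma christoffel_add (X Y Z : V) :
    christoffel g x X (Y + Z) = christoffel g x X Y + christoffel g x X Z := by
  simp only [← christoffelCLM_apply, map_add]

lemma christoffel_sub (X Y Z : V) :
    christoffel g x X (Y - Z) = christoffel g x X Y - christoffel g x X Z := by
  simp only [← christoffelCLM_apply, map_sub]

lemma christoffel_smul (X Y : V) (c : ℝ) :
    christoffel g x X (c • Y) = c • christoffel g x X Y := by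
  simp only [← christoffelCLM_apply, map_smul]

lemma covDerivVec_add {Z W : V → V} (hZ : DifferentiableAt ℝ Z x) (hW : DifferentiableAt ℝ W x)
    (X : V) : covDerivVec g (fun y => Z y + W y) x X
      = covDerivVec g Z x X + covDerivVec g W x X := by
  simp only [covDerivVec, christoffel_add, fderiv_fun_add hZ hW, add_apply]
  abel

lemma covDerivVec_sub {Z W : V → V} (hZ : DifferentiableAt ℝ Z x) (hW : DifferentiableAt ℝ W x)
    (X : V) : covDerivVec g (fun y => Z y - W y) x X
      = covDerivVec g Z x X - covDerivVec g W x X := by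
  simp only [covDerivVec, christoffel_sub, fderiv_fun_sub hZ hW, sub_apply]
  abel

lemma covDerivVec_smul {f : V → ℝ} {Z : V → V} (hf : DifferentiableAt ℝ f x)
    (hZ : DifferentiableAt ℝ Z x) (X : V) :
    covDerivVec g (fun y => f y • Z y) x X = fderiv ℝ f x X • Z x + f x • covDerivVec g Z x X := by
  simp only [covDerivVec, christoffel_smul, fderiv_fun_smul hf hZ, add_apply,
    smul_apply, ContinuousLinearMap.smulRight_apply, smul_add]
  abel

lemma covDerivVec_end {A : EndField V} {Z : V → V} (hA : DifferentiableAt ℝ A x)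
    (hZ : DifferentiableAt ℝ Z x) (X : V) :
    covDerivVec g (fun y => A y (Z y)) x X =
      covDerivEnd g A x X (Z x) + A x (covDerivVec g Z x X) := by
  simp only [covDerivVec, covDerivEnd, fderiv_clm_apply hA hZ, add_apply,
    ContinuousLinearMap.comp_apply, ContinuousLinearMap.flip_apply, map_add]
  abel

lemma covDerivVec_congr {Z W : V → V} (h : Z =ᶠ[nhds x] W) (X : V) :
    covDerivVec g Z x X = covDerivVec g W x X := by
  simp only [covDerivVec, h.fderiv_eq, h.eq_of_nhds]

lemma IsRiemannianOn.contDiffAt_covDerivVec (hg : IsRiemannianOn U g) (hU : IsOpen U)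
    (hx : x ∈ U) {Z : V → V} (hZ : ContDiffAt ℝ ∞ Z x) (X : V) :
    ContDiffAt ℝ ∞ (fun y => covDerivVec g Z y X) x := by
  simp only [covDerivVec, ← christoffelCLM_apply]
  exact ((hZ.fderiv_right (m := ∞) (by simp)).clm_apply contDiffAt_const).add
    (((hg.contDiffAt_christoffelCLM hU hx).clm_apply contDiffAt_const).clm_apply hZ)

/-- The curvature tensor `R(X, Y) Z`. -/
def curvature (g : BilinField V) (x X Y Z : V) : V :=
  covDerivVec g (fun y => christoffel g y Y Z) x X - covDerivVec g (fun y => christoffel g y X Z) x Y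

/-- In the second covariant derivative of `Z`, the terms containing `D²Z` or `DZ` are symmetric in
`X` and `Y`. What survives antisymmetrisation depends only on `Z x`, and equals the expression with
`Z` replaced by a constant field. -/
lemma ricci_identity (hg : IsRiemannianOn U g) (hU : IsOpen U) (hx : x ∈ U) {Z : V → V}
    (hZ : ContDiffAt ℝ ∞ Z x) (X Y : V) :
    covDerivVec g (fun y => covDerivVec g Z y Y) x X - covDerivVec g (fun y => covDerivVec g Z y X) x Y
      = curvature g x X Y (Z x) := by
  have hZd : DifferentiableAt ℝ Z x := hZ.differentiableAt (by simp)
  have hΓ : DifferentiableAt ℝ (christoffelCLM g) x :=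
    (hg.contDiffAt_christoffelCLM hU hx).differentiableAt (by simp)
  have hZ' : DifferentiableAt ℝ (fderiv ℝ Z) x :=
    (hZ.fderiv_right (m := ∞) (by simp)).differentiableAt (by simp)
  have hsymm : fderiv ℝ (fderiv ℝ Z) x X Y = fderiv ℝ (fderiv ℝ Z) x Y X :=
    (hZ.isSymmSndFDerivAt two_le_smooth).eq X Y
  have key : ∀ X Y, covDerivVec g (fun y => covDerivVec g Z y Y) x X =
      covDerivVec g (fun y => christoffel g y Y (Z x)) x X + fderiv ℝ (fderiv ℝ Z) x X Y
      + (christoffel g x Y (fderiv ℝ Z x X) + christoffel g x X (fderiv ℝ Z x Y)) := by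
    intro X Y
    simp only [covDerivVec, ← christoffelCLM_apply]
    have hc : ∀ Y : V, DifferentiableAt ℝ (fun _ : V => Y) x := fun Y => differentiableAt_const _
    rw [fderiv_fun_add (hZ'.clm_apply (hc Y)) ((hΓ.clm_apply (hc Y)).clm_apply hZd),
      fderiv_clm_apply hZ' (hc Y), fderiv_clm_apply (hΓ.clm_apply (hc Y)) hZd,
      fderiv_clm_apply (hΓ.clm_apply (hc Y)) (hc (Z x)), fderiv_clm_apply hΓ (hc Y)]
    simp
    abel
  rw [key, key, hsymm, curvature]
  abel

lemma curvature_antisymm (x X Y Z : V) : curvature g x X Y Z = -curvature g x Y X Z := by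
  simp [curvature]

lemma curvature_bianchi (hg : IsRiemannianOn U g) (hU : IsOpen U) (hx : x ∈ U) (X Y Z : V) :
    curvature g x X Y Z + curvature g x Y Z X + curvature g x Z X Y = 0 := by
  have key : ∀ X Y Z, covDerivVec g (fun y => christoffel g y Y Z) x X =
      covDerivVec g (fun y => christoffel g y Z Y) x X := by
    intro X Y Z
    apply covDerivVec_congr
    filter_upwards [hU.mem_nhds hx] with y hy using christoffel_comm hg hU hy Y Z
  simp only [curvature, key X Z Y, key Y X Z, key Z Y X]
  abel

lemma IsRiemannianOn.contDiffAt_christoffel (hg : IsRiemannianOn U g) (hU : IsOpen U)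
    (hx : x ∈ U) (X Y : V) : ContDiffAt ℝ ∞ (fun y => christoffel g y X Y) x := by
  simp only [← christoffelCLM_apply]
  exact ((hg.contDiffAt_christoffelCLM hU hx).clm_apply contDiffAt_const).clm_apply contDiffAt_const

lemma curvature_add (hg : IsRiemannianOn U g) (hU : IsOpen U) (hx : x ∈ U) (X Y Z W : V) :
    curvature g x X Y (Z + W) = curvature g x X Y Z + curvature g x X Y W := by
  have hd : ∀ X Y, DifferentiableAt ℝ (fun y => christoffel g y X Y) x := fun X Y =>
    (hg.contDiffAt_christoffel hU hx X Y).differentiableAt (by simp)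
  simp only [curvature, christoffel_add, covDerivVec_add (hd _ _) (hd _ _)]
  abel

/-- Metric compatibility applied twice: the antisymmetrised second derivative of the function `g(Z,
Z)`, which vanishes, is twice this expression. -/
lemma metric_curvature_self (hg : IsRiemannianOn U g) (hU : IsOpen U) (hx : x ∈ U) (X Y Z : V) :
    g x (curvature g x X Y Z) Z = 0 := by
  have hd : ∀ X Y, DifferentiableAt ℝ (fun y => christoffel g y X Y) x := fun X Y =>
    (hg.contDiffAt_christoffel hU hx X Y).differentiableAt (by simp)
  have hs : ContDiffAt ℝ ∞ (fun y => g y Z Z) x :=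
    ((hg.contDiffAt hU hx).clm_apply contDiffAt_const).clm_apply contDiffAt_const
  have hs' : DifferentiableAt ℝ (fderiv ℝ (fun y => g y Z Z)) x :=
    (hs.fderiv_right (m := ∞) (by simp)).differentiableAt (by simp)
  have hsymm := (hs.isSymmSndFDerivAt two_le_smooth).eq X Y
  have key : ∀ X Y, fderiv ℝ (fderiv ℝ (fun y => g y Z Z)) x X Y =
      2 * (g x (covDerivVec g (fun y => christoffel g y Y Z) x X) Z +
        g x (christoffel g x Y Z) (christoffel g x X Z)) := by
    intro X Y
    have h1 : fderiv ℝ (fderiv ℝ (fun y => g y Z Z)) x X Y =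
        fderiv ℝ (fun y => fderiv ℝ (fun y => g y Z Z) y Y) x X := by
      rw [fderiv_clm_apply hs' (differentiableAt_const _)]
      simp
    have h2 : (fun y => fderiv ℝ (fun y => g y Z Z) y Y) =ᶠ[nhds x]
        fun y => 2 * g y (christoffel g y Y Z) Z := by
      filter_upwards [hU.mem_nhds hx] with y hy
      rw [fderiv_metric hg hU hy (differentiableAt_const Z) (differentiableAt_const Z),
        covDerivVec_const, hg.symm y hy Z]
      ring
    have hgd : DifferentiableAt ℝ g x := (hg.contDiffAt hU hx).differentiableAt (by simp)
    rw [h1, h2.fderiv_eq, fderiv_const_mul ((hgd.clm_apply (hd Y Z)).clm_apply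
      (differentiableAt_const Z))]
    simp only [smul_apply, smul_eq_mul]
    rw [fderiv_metric hg hU hx (hd Y Z) (differentiableAt_const Z), covDerivVec_const]
  rw [key, key, hg.symm x hx (christoffel g x X Z)] at hsymm
  simp only [curvature, map_sub, sub_apply]
  linarith

end Calculus

/-! ### Integrability conditions and the nullity of the curvature -/

section Extension

variable {V : Type*} [NormedAddCommGroup V] [NormedSpace ℝ V] [FiniteDimensional ℝ V]
  {U : Set V} {g : BilinField V} {J A : EndField V} {L : V → V} {x : V}

lemma IsKahlerOn.inner_J_left (hK : IsKahlerOn U g J) (hx : x ∈ U) (X Y : V) :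
    g x (J x X) Y = -g x X (J x Y) := by
  have h := hK.hermitian x hx X (J x Y)
  rw [hK.J_sq x hx, map_neg] at h
  linarith

lemma IsKahlerOn.inner_J_comm (hK : IsKahlerOn U g J) (hx : x ∈ U) (X Y : V) :
    g x (J x X) Y = -g x (J x Y) X := by
  rw [hK.inner_J_left hx, hK.riemannian.symm x hx X]

lemma IsKahlerOn.inner_J_self (hK : IsKahlerOn U g J) (hx : x ∈ U) (X : V) :
    g x (J x X) X = 0 := by
  have := hK.inner_J_comm hx X X
  linarith

lemma IsKahlerOn.inner_self_J (hK : IsKahlerOn U g J) (hx : x ∈ U) (X : V) :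
    g x X (J x X) = 0 := by
  rw [hK.riemannian.symm x hx, hK.inner_J_self hx]

lemma IsKahlerOn.contDiffAt_J (hK : IsKahlerOn U g J) (hU : IsOpen U) (hx : x ∈ U) :
    ContDiffAt ℝ ∞ J x := hK.smooth_J.contDiffAt (hU.mem_nhds hx)

lemma IsSolOn.contDiffAt_A (hA : IsSolOn U g J A L) (hU : IsOpen U) (hx : x ∈ U) :
    ContDiffAt ℝ ∞ A x := hA.hermitian.smooth.contDiffAt (hU.mem_nhds hx)

lemma IsSolOn.contDiffAt_L (hA : IsSolOn U g J A L) (hU : IsOpen U) (hx : x ∈ U) :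
    ContDiffAt ℝ ∞ L x := hA.smooth_L.contDiffAt (hU.mem_nhds hx)

lemma IsKahlerOn.covDerivVec_J (hK : IsKahlerOn U g J) (hU : IsOpen U) (hx : x ∈ U) {Z : V → V}
    (hZ : DifferentiableAt ℝ Z x) (X : V) :
    covDerivVec g (fun y => J y (Z y)) x X = J x (covDerivVec g Z x X) := by
  rw [covDerivVec_end ((hK.contDiffAt_J hU hx).differentiableAt (by simp)) hZ,
    hK.parallel_J x hx, zero_add]

lemma IsKahlerOn.curvature_J (hK : IsKahlerOn U g J) (hU : IsOpen U) (hx : x ∈ U) (X Y Z : V) :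
    curvature g x X Y (J x Z) = J x (curvature g x X Y Z) := by
  have hg := hK.riemannian
  have hW : ContDiffAt ℝ ∞ (fun y => J y Z) x := (hK.contDiffAt_J hU hx).clm_apply contDiffAt_const
  have key : ∀ X Y, covDerivVec g (fun y => covDerivVec g (fun y => J y Z) y Y) x X =
      J x (covDerivVec g (fun y => christoffel g y Y Z) x X) := by
    intro X Y
    rw [← hK.covDerivVec_J hU hx ((hg.contDiffAt_christoffel hU hx Y Z).differentiableAt (by simp))]
    apply covDerivVec_congr
    filter_upwards [hU.mem_nhds hx] with y hy
    rw [hK.covDerivVec_J hU hy (differentiableAt_const Z), covDerivVec_const]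
  rw [← ricci_identity hg hU hx hW, key, key, curvature, map_sub]

/-- The hermitian symmetric product `a♭ ⊗ b + b♭ ⊗ a + Ja♭ ⊗ Jb + Jb♭ ⊗ Ja`, applied to `Z`. -/
def hermProd (g : BilinField V) (J : EndField V) (x a b Z : V) : V :=
  g x a Z • b + g x b Z • a + g x (J x a) Z • J x b + g x (J x b) Z • J x a

lemma hermProd_add_right (x a b b' Z : V) :
    hermProd g J x a (b + b') Z = hermProd g J x a b Z + hermProd g J x a b' Z := by
  simp only [hermProd, map_add, add_apply]
  module

lemma covDerivVec_hermProd (hK : IsKahlerOn U g J) (hU : IsOpen U) (hx : x ∈ U) {a b Z : V → V}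
    (ha : DifferentiableAt ℝ a x) (hb : DifferentiableAt ℝ b x) (hZ : DifferentiableAt ℝ Z x)
    (X : V) :
    covDerivVec g (fun y => hermProd g J y (a y) (b y) (Z y)) x X =
      hermProd g J x (covDerivVec g a x X) (b x) (Z x)
      + hermProd g J x (a x) (covDerivVec g b x X) (Z x)
      + hermProd g J x (a x) (b x) (covDerivVec g Z x X) := by
  have hg := hK.riemannian
  have hgd : DifferentiableAt ℝ g x := (hg.contDiffAt hU hx).differentiableAt (by simp)
  have hJ : DifferentiableAt ℝ J x := (hK.contDiffAt_J hU hx).differentiableAt (by simp)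
  have hi : ∀ {a b : V → V}, DifferentiableAt ℝ a x → DifferentiableAt ℝ b x →
      DifferentiableAt ℝ (fun y => g y (a y) (b y)) x :=
    fun ha hb => (hgd.clm_apply ha).clm_apply hb
  have ha' := hJ.clm_apply ha
  have hb' := hJ.clm_apply hb
  simp only [hermProd]
  rw [covDerivVec_add ((((hi ha hZ).fun_smul hb).fun_add ((hi hb hZ).fun_smul ha)).fun_add
      ((hi ha' hZ).fun_smul hb')) ((hi hb' hZ).fun_smul ha'),
    covDerivVec_add (((hi ha hZ).fun_smul hb).fun_add ((hi hb hZ).fun_smul ha))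
      ((hi ha' hZ).fun_smul hb'),
    covDerivVec_add ((hi ha hZ).fun_smul hb) ((hi hb hZ).fun_smul ha),
    covDerivVec_smul (hi ha hZ) hb, covDerivVec_smul (hi hb hZ) ha,
    covDerivVec_smul (hi ha' hZ) hb', covDerivVec_smul (hi hb' hZ) ha',
    fderiv_metric hg hU hx ha hZ, fderiv_metric hg hU hx hb hZ,
    fderiv_metric hg hU hx ha' hZ, fderiv_metric hg hU hx hb' hZ,
    hK.covDerivVec_J hU hx ha, hK.covDerivVec_J hU hx hb]
  module

/-- The integrability condition of the equation for `A`. -/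
lemma IsSolOn.curvature_comm (hK : IsKahlerOn U g J) (hU : IsOpen U) (hA : IsSolOn U g J A L)
    (hx : x ∈ U) (X Y z : V) :
    curvature g x X Y (A x z) - A x (curvature g x X Y z) =
      hermProd g J x Y (covDerivVec g L x X) z - hermProd g J x X (covDerivVec g L x Y) z := by
  have hg := hK.riemannian
  -- A field with value `z` and vanishing covariant derivative at `x`, so that all terms in `∇Z`
  -- drop out at that point.
  set Z : V → V := fun y => z - christoffelCLM g x (y - x) z with hZdef
  have hZ : ContDiff ℝ ∞ Z :=
    contDiff_const.sub
      (((christoffelCLM g x).contDiff.comp (contDiff_id.sub contDiff_const)).clm_apply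
        contDiff_const)
  have hZd : ∀ y, DifferentiableAt ℝ Z y := fun y => hZ.contDiffAt.differentiableAt (by simp)
  have hZx : Z x = z := by simp [hZdef]
  have hZ0 : ∀ X, covDerivVec g Z x X = 0 := by
    intro X
    have h1 : HasFDerivAt Z (-((christoffelCLM g x).flip z)) x := by
      have h0 : HasFDerivAt (fun y => y - x) (ContinuousLinearMap.id ℝ V) x :=
        (hasFDerivAt_id x).sub_const x
      exact (((christoffelCLM g x).flip z).hasFDerivAt.comp x h0).const_sub z
    rw [covDerivVec, h1.fderiv, hZx]
    simp [christoffelCLM_apply]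
  have hAd : ∀ y ∈ U, DifferentiableAt ℝ A y :=
    fun y hy => (hA.contDiffAt_A hU hy).differentiableAt (by simp)
  have hLd : DifferentiableAt ℝ L x := (hA.contDiffAt_L hU hx).differentiableAt (by simp)
  have hAZ : ContDiffAt ℝ ∞ (fun y => A y (Z y)) x := (hA.contDiffAt_A hU hx).clm_apply hZ.contDiffAt
  have key : ∀ X Y, covDerivVec g (fun y => covDerivVec g (fun y => A y (Z y)) y Y) x X =
      hermProd g J x (christoffel g x X Y) (L x) z + hermProd g J x Y (covDerivVec g L x X) z
        + A x (covDerivVec g (fun y => covDerivVec g Z y Y) x X) := by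
    intro X Y
    have hW : DifferentiableAt ℝ (fun y => covDerivVec g Z y Y) x :=
      (hg.contDiffAt_covDerivVec hU hx hZ.contDiffAt Y).differentiableAt (by simp)
    have h1 : (fun y => covDerivVec g (fun y => A y (Z y)) y Y) =ᶠ[nhds x]
        fun y => hermProd g J y Y (L y) (Z y) + A y (covDerivVec g Z y Y) := by
      filter_upwards [hU.mem_nhds hx] with y hy
      rw [covDerivVec_end (hAd y hy) (hZd y), hA.main y hy]
      rfl
    have hgd : DifferentiableAt ℝ g x := (hg.contDiffAt hU hx).differentiableAt (by simp)
    have hJ : DifferentiableAt ℝ J x := (hK.contDiffAt_J hU hx).differentiableAt (by simp)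
    have hYc : DifferentiableAt ℝ (fun _ : V => Y) x := differentiableAt_const _
    have h2 : DifferentiableAt ℝ (fun y => hermProd g J y Y (L y) (Z y)) x := by
      unfold hermProd
      exact (((((hgd.clm_apply hYc).clm_apply (hZd x)).fun_smul hLd).fun_add
        (((hgd.clm_apply hLd).clm_apply (hZd x)).fun_smul hYc)).fun_add
        (((hgd.clm_apply (hJ.clm_apply hYc)).clm_apply (hZd x)).fun_smul (hJ.clm_apply hLd))).fun_add
        (((hgd.clm_apply (hJ.clm_apply hLd)).clm_apply (hZd x)).fun_smul (hJ.clm_apply hYc))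
    rw [covDerivVec_congr h1, covDerivVec_add h2 ((hAd x hx).clm_apply hW),
      covDerivVec_hermProd hK hU hx hYc hLd (hZd x), covDerivVec_end (hAd x hx) hW,
      covDerivVec_const, hA.main x hx, hZ0, hZ0, hZx]
    simp [hermProd]
  have hR := ricci_identity hg hU hx hAZ X Y
  rw [key, key, christoffel_comm hg hU hx Y X, hZx] at hR
  have hR' := ricci_identity hg hU hx hZ.contDiffAt X Y
  rw [hZx] at hR'
  rw [← hR', ← hR, map_sub]
  abel

/-- The curvature tensor of constant holomorphic sectional curvature. -/
def holCurv (g : BilinField V) (J : EndField V) (x X Y Z : V) : V :=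
  g x X Z • Y - g x Y Z • X + (2 * g x (J x X) Y) • J x Z + g x (J x Z) Y • J x X
    - g x (J x Z) X • J x Y

/-- The Ricci identity for `Λ`. The defect of `dμ = 2BΛ♭` is kept as a 1-form: where it vanishes,
this puts `Λ` in the nullity, and conversely nullity of another vector will force it to vanish. -/
lemma curvature_eq_of_covDerivVec (hK : IsKahlerOn U g J) (hU : IsOpen U)
    (hA : IsSolOn U g J A L) {μ : V → ℝ} {B : ℝ} (hμ : ContDiffOn ℝ ∞ μ U)
    (hL : ∀ x ∈ U, ∀ X, covDerivVec g L x X = μ x • X + B • A x X) (hx : x ∈ U) (X Y : V) :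
    curvature g x X Y (L x) = (fderiv ℝ μ x X - 2 * B * g x (L x) X) • Y
      - (fderiv ℝ μ x Y - 2 * B * g x (L x) Y) • X + B • holCurv g J x X Y (L x) := by
  have hg := hK.riemannian
  have hAd : DifferentiableAt ℝ A x := (hA.contDiffAt_A hU hx).differentiableAt (by simp)
  have hμd : DifferentiableAt ℝ μ x :=
    (hμ.contDiffAt (hU.mem_nhds hx)).differentiableAt (by simp)
  have key : ∀ X Y, covDerivVec g (fun y => covDerivVec g L y Y) x X =
      fderiv ℝ μ x X • Y + μ x • christoffel g x X Y +
        B • (hermProd g J x X (L x) Y + A x (christoffel g x X Y)) := by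
    intro X Y
    have h1 : (fun y => covDerivVec g L y Y) =ᶠ[nhds x] fun y => μ y • Y + B • A y Y := by
      filter_upwards [hU.mem_nhds hx] with y hy using hL y hy Y
    have hY : DifferentiableAt ℝ (fun _ : V => Y) x := differentiableAt_const _
    have hB : DifferentiableAt ℝ (fun _ : V => B) x := differentiableAt_const _
    rw [covDerivVec_congr h1, covDerivVec_add (hμd.fun_smul hY) (hB.fun_smul (hAd.clm_apply hY)),
      covDerivVec_smul hμd hY, covDerivVec_smul hB (hAd.clm_apply hY), covDerivVec_end hAd hY,
      covDerivVec_const, hA.main x hx]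
    simp [hermProd]
  rw [← ricci_identity hg hU hx (hA.contDiffAt_L hU hx), key, key, christoffel_comm hg hU hx Y X]
  simp only [hermProd, holCurv, hK.inner_J_comm hx Y X, hg.symm x hx Y X, hg.symm x hx X (L x),
    hg.symm x hx Y (L x)]
  module

/-- The trilinear form `b (G X v Z) W` is symmetric in `X, Z` (Bianchi identity and `G X Z v = 0`)
and skew in `Z, W`; alternating the two symmetries gives zero. -/
lemma nullity_of_annihilates {b : V →L[ℝ] V →L[ℝ] ℝ} (hb : ∀ X, X ≠ 0 → 0 < b X X)
    {G : V → V → V → V} (hanti : ∀ X Y Z, G X Y Z = -G Y X Z)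
    (hbianchi : ∀ X Y Z, G X Y Z + G Y Z X + G Z X Y = 0)
    (hadd : ∀ X Y Z W, G X Y (Z + W) = G X Y Z + G X Y W)
    (hskew : ∀ X Y Z, b (G X Y Z) Z = 0) {v : V} (hv : ∀ X Y, G X Y v = 0) (X Z : V) :
    G X v Z = 0 := by
  have hs : ∀ X Y Z W, b (G X Y Z) W = -b (G X Y W) Z := by
    intro X Y Z W
    have := hskew X Y (Z + W)
    rw [hadd] at this
    simp only [map_add, add_apply, hskew] at this
    linarith
  have hsym : ∀ X Z, G X v Z = G Z v X := by
    intro X Z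
    have := hbianchi X v Z
    rw [hv, hanti v Z X, add_zero, ← sub_eq_add_neg, sub_eq_zero] at this
    exact this
  have hT : ∀ W, b (G X v Z) W = 0 := by
    intro W
    have h1 := hs X v Z W
    have h2 := hs W v X Z
    have h3 := hs Z v W X
    rw [hsym W X, hsym W Z] at h2
    rw [hsym Z X] at h3
    linarith
  by_contra h
  exact (hb _ h).ne' (hT _)

/-- If `R(X, Y) v = B K(X, Y) v` then `v` is in the nullity of `R - B K`. -/
lemma IsKahlerOn.nullity (hK : IsKahlerOn U g J) (hU : IsOpen U) (hx : x ∈ U) {B : ℝ} {v : V}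
    (hv : ∀ X Y, curvature g x X Y v = B • holCurv g J x X Y v) (X Z : V) :
    curvature g x X v Z = B • holCurv g J x X v Z := by
  have hg := hK.riemannian
  have := nullity_of_annihilates (hg.pos x hx)
    (G := fun X Y Z => curvature g x X Y Z - B • holCurv g J x X Y Z) ?_ ?_ ?_ ?_
    (v := v) (fun X Y => by rw [hv, sub_self]) X Z
  · exact sub_eq_zero.1 this
  · intro X Y Z
    simp only [curvature_antisymm x X Y Z, holCurv, hK.inner_J_comm hx X Y]
    module
  · intro X Y Z
    have h := curvature_bianchi hg hU hx X Y Z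
    have h' : holCurv g J x X Y Z + holCurv g J x Y Z X + holCurv g J x Z X Y = 0 := by
      simp only [holCurv, hK.inner_J_comm hx Z X, hK.inner_J_comm hx Z Y, hK.inner_J_comm hx Y X,
        hg.symm x hx Z X, hg.symm x hx Z Y, hg.symm x hx Y X]
      module
    rw [← sub_eq_zero] at h
    calc _ = (curvature g x X Y Z + curvature g x Y Z X + curvature g x Z X Y - 0) -
          B • (holCurv g J x X Y Z + holCurv g J x Y Z X + holCurv g J x Z X Y) := by module
      _ = 0 := by rw [h, h', smul_zero, sub_zero]
  · intro X Y Z W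
    simp only [curvature_add hg hU hx, holCurv, map_add, add_apply]
    module
  · intro X Y Z
    simp only [map_sub, sub_apply, metric_curvature_self hg hU hx, holCurv, map_add, add_apply,
      map_smul, smul_apply, smul_eq_mul, hK.inner_J_self hx,
      hK.inner_J_comm hx Z X, hK.inner_J_comm hx Z Y]
    ring

lemma IsKahlerOn.nullity_J (hK : IsKahlerOn U g J) (hU : IsOpen U) (hx : x ∈ U) {B : ℝ} {v : V}
    (hv : ∀ X Y, curvature g x X Y v = B • holCurv g J x X Y v) (X Z : V) :
    curvature g x X (J x v) Z = B • holCurv g J x X (J x v) Z := by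
  refine hK.nullity hU hx (fun X Y => ?_) X Z
  rw [hK.curvature_J hU hx, hv]
  simp only [holCurv, map_sub, map_add, map_smul, hK.J_sq x hx, map_neg, neg_apply,
    hK.inner_J_left hx v, hK.riemannian.symm x hx v]
  simp only [hK.inner_J_left hx]
  module

/-- The model tensor satisfies the integrability condition of `IsSolOn.curvature_comm` with `A` in
place of `∇Λ`. Where `R = -K`, subtraction leaves a condition on `∇Λ + A` alone. -/
lemma holCurv_comm (hK : IsKahlerOn U g J) (hA : IsSolOn U g J A L) (hx : x ∈ U) (X Y Z : V) :
    holCurv g J x X Y (A x Z) - A x (holCurv g J x X Y Z) =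
      hermProd g J x Y (A x X) Z - hermProd g J x X (A x Y) Z := by
  have hs := hA.hermitian.symm x hx
  have hc := hA.hermitian.comm x hx
  simp only [holCurv, hermProd, map_sub, map_add, map_smul, hc, ← hs]
  have h1 : ∀ W, g x (J x (A x Z)) W = -g x (J x (A x W)) Z := by
    intro W
    rw [hK.inner_J_left hx, hs, hc, ← hK.riemannian.symm x hx (J x (A x W)) Z]
  rw [h1, h1, hK.inner_J_comm hx Z X, hK.inner_J_comm hx Z Y]
  module

end Extension

/-! ### Unique continuation for first-order differential inequalities -/

section Unique

/-- Grönwall's inequality along the segments from `x` in a small ball. -/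
lemma eventually_eq_zero_of_norm_fderiv_le {E F : Type*} [NormedAddCommGroup E] [NormedSpace ℝ E]
    [NormedAddCommGroup F] [NormedSpace ℝ F] {U : Set E} (hU : IsOpen U) {f : E → F}
    (hf : ∀ x ∈ U, DifferentiableAt ℝ f x) {x : E} (hx : x ∈ U)
    (hK : ∃ K : ℝ, ∀ᶠ y in nhds x, ‖fderiv ℝ f y‖ ≤ K * ‖f y‖) (h0 : f x = 0) :
    ∀ᶠ y in nhds x, f y = 0 := by
  obtain ⟨K, hK⟩ := hK
  obtain ⟨ε, hε, hball⟩ := Metric.eventually_nhds_iff_ball.1 (hK.and (hU.mem_nhds hx))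
  filter_upwards [Metric.ball_mem_nhds x hε] with y hy
  have hmem : ∀ t ∈ Set.Icc (0 : ℝ) 1, x + t • (y - x) ∈ Metric.ball x ε := by
    intro t ht
    rw [mem_ball_iff_norm] at hy ⊢
    rw [add_sub_cancel_left, norm_smul, Real.norm_of_nonneg ht.1]
    nlinarith [norm_nonneg (y - x), ht.2]
  have hγ : ∀ t : ℝ, HasDerivAt (fun t : ℝ => x + t • (y - x)) (y - x) t := fun t => by
    simpa using ((hasDerivAt_id t).smul_const (y - x)).const_add x
  have hd : ∀ t ∈ Set.Icc (0 : ℝ) 1, HasDerivAt (fun t : ℝ => f (x + t • (y - x)))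
      (fderiv ℝ f (x + t • (y - x)) (y - x)) t := fun t ht =>
    (hf _ (hball _ (hmem t ht)).2).hasFDerivAt.comp_hasDerivAt t (hγ t)
  have := norm_le_gronwallBound_of_norm_deriv_right_le (δ := 0) (K := K * ‖y - x‖) (ε := 0)
    (fun t ht => (hd t ht).continuousAt.continuousWithinAt)
    (fun t ht => (hd t (Set.Ico_subset_Icc_self ht)).hasDerivWithinAt) (by simp [h0])
    (fun t ht => by
      have h1 := (hball _ (hmem t (Set.Ico_subset_Icc_self ht))).1
      calc _ ≤ ‖fderiv ℝ f (x + t • (y - x))‖ * ‖y - x‖ := ContinuousLinearMap.le_opNorm _ _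
        _ ≤ K * ‖f (x + t • (y - x))‖ * ‖y - x‖ := by gcongr
        _ = _ := by ring) 1 (by simp)
  rw [gronwallBound_ε0_δ0] at this
  simpa using this

/-- The interior of the zero set is relatively closed in `U`: a limit point in `U` is a zero by
continuity, hence an interior zero by the local statement. -/
lemma eq_zero_of_norm_fderiv_le {E F : Type*} [NormedAddCommGroup E] [NormedSpace ℝ E]
    [NormedAddCommGroup F] [NormedSpace ℝ F] {U : Set E} (hU : IsOpen U) (hUc : IsPreconnected U)
    {f : E → F} (hf : ∀ x ∈ U, DifferentiableAt ℝ f x)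
    (hK : ∀ x ∈ U, ∃ K : ℝ, ∀ᶠ y in nhds x, ‖fderiv ℝ f y‖ ≤ K * ‖f y‖) {x₀ : E} (hx₀ : x₀ ∈ U)
    (h0 : f x₀ = 0) : ∀ x ∈ U, f x = 0 := by
  have key : ∀ x ∈ U, f x = 0 → x ∈ interior {y | f y = 0} := fun x hx h =>
    mem_interior_iff_mem_nhds.2 (eventually_eq_zero_of_norm_fderiv_le hU hf hx (hK x hx) h)
  intro x hx
  refine interior_subset (s := {y | f y = 0}) (hUc.subset_of_closure_inter_subset isOpen_interior
    ⟨x₀, hx₀, key x₀ hx₀ h0⟩ ?_ hx)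
  rintro y ⟨hy, hyU⟩
  refine key y hyU ?_
  by_contra h
  have h1 := (hf y hyU).continuousAt.eventually_ne h
  obtain ⟨z, hz1, hz2⟩ := ((mem_closure_iff_frequently.1 hy).and_eventually h1).exists
  exact hz2 (interior_subset (s := {y | f y = 0}) hz1)

end Unique

/-! ### Extending an arbitrary solution to the extended system -/

section Extension

variable {V : Type*} [NormedAddCommGroup V] [NormedSpace ℝ V] [FiniteDimensional ℝ V]
  {U : Set V} {g : BilinField V} {J A : EndField V} {L : V → V} {x : V}

/-- The covariant derivative `∇Z` as an endomorphism. -/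
def covDerivCLM (g : BilinField V) (Z : V → V) (x : V) : V →L[ℝ] V :=
  fderiv ℝ Z x + (christoffelCLM g x).flip (Z x)

lemma covDerivCLM_apply (Z : V → V) (X : V) : covDerivCLM g Z x X = covDerivVec g Z x X := by
  simp [covDerivCLM, covDerivVec, christoffelCLM_apply]

/-- Evaluating the two conditions at `Z = v` and `Z = J v` determines `S` on the orthogonal
complement of `v, J v`, where it is a scalar; comparing the two evaluations gives the same scalar on
`v` and `J v`. Commutation of `S` with `J` is not assumed. -/
lemma eq_smul_of_hermProd (hK : IsKahlerOn U g J) (hx : x ∈ U) (hdim : 2 < Module.finrank ℝ V)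
    {S : V →L[ℝ] V} (hS : ∀ X Y, g x (S X) Y = g x X (S Y)) {v : V} (hv : v ≠ 0)
    (h1 : ∀ X Z, hermProd g J x v (S X) Z = hermProd g J x X (S v) Z)
    (h2 : ∀ X Z, hermProd g J x (J x v) (S X) Z = hermProd g J x X (S (J x v)) Z) :
    ∃ s : ℝ, ∀ X, S X = s • X := by
  have hg := hK.riemannian
  have hsy := hg.symm x hx
  set n := g x v v with hn
  have hn0 : 0 < n := hg.pos x hx v hv
  have hJv : g x (J x v) v = 0 := hK.inner_J_self hx v
  have hvJ : g x v (J x v) = 0 := hK.inner_self_J hx v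
  have hJJ : g x (J x v) (J x v) = n := hK.hermitian x hx v v
  have e1 : ∀ X, g x X v = 0 → g x X (J x v) = 0 →
      n • S X + g x (S X) v • v - g x (S X) (J x v) • J x v =
        g x (S v) v • X - g x (S v) (J x v) • J x X := by
    intro X hX hX'
    have := h1 X v
    simp only [hermProd, hJv, hX, hK.inner_J_left hx, hX', neg_zero, zero_smul, add_zero, zero_add,
      ← hn, neg_smul] at this
    rw [sub_eq_add_neg, sub_eq_add_neg, this]
  have e2 : ∀ X, g x X v = 0 → g x X (J x v) = 0 →
      n • S X + g x (S X) (J x v) • J x v - g x (S X) v • v =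
        g x (S (J x v)) (J x v) • X + g x (S (J x v)) v • J x X := by
    intro X hX hX'
    have := h2 X (J x v)
    simp only [hermProd, hJJ, hX', hK.J_sq x hx, map_neg, neg_apply, hvJ,
      hK.hermitian x hx, hX, neg_zero, zero_smul, add_zero, zero_add,
      smul_neg] at this
    rw [sub_eq_add_neg, this]
  have f1 : ∀ X, g x X v = 0 → g x X (J x v) = 0 → g x (S X) v = 0 ∧ g x (S X) (J x v) = 0 ∧
      (g x (S v) v - g x (S (J x v)) (J x v)) * g x X X = 0 ∧
      (g x (S v) (J x v) + g x (S (J x v)) v) * g x X X = 0 := by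
    intro X hX hX'
    -- The difference of `e1` and `e2`: `S X` cancels, and a vector in the span of `v, J v` equals
    -- one in the orthogonal span of `X, J X`, so all four coefficients can be read off as zero by
    -- pairing.
    have hd : (2 * g x (S X) v) • v - (2 * g x (S X) (J x v)) • J x v =
        (g x (S v) v - g x (S (J x v)) (J x v)) • X
          - (g x (S v) (J x v) + g x (S (J x v)) v) • J x X := by
      have a := e1 X hX hX'
      have b := e2 X hX hX'
      calc _ = (n • S X + g x (S X) v • v - g x (S X) (J x v) • J x v)
          - (n • S X + g x (S X) (J x v) • J x v - g x (S X) v • v) := by module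
        _ = _ := by rw [a, b]; module
    have hd' : ∀ Z, _ := fun Z => congrArg (fun W => g x W Z) hd
    simp only [map_sub, sub_apply, map_smul, smul_apply, smul_eq_mul] at hd'
    have p1 := hd' v
    have p2 := hd' (J x v)
    have p3 := hd' X
    have p4 := hd' (J x X)
    rw [hJv, hX, hK.inner_J_left hx, hX', ← hn] at p1
    rw [hJJ, hX', hvJ, hK.hermitian x hx, hX] at p2
    rw [hsy v X, hsy (J x v) X, hX, hX', hK.inner_J_self hx] at p3
    rw [hK.hermitian x hx, hsy v X, hX, hsy v (J x X), hK.inner_J_left hx, hX', hK.inner_self_J hx,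
      hK.hermitian x hx] at p4
    refine ⟨?_, ?_, by linarith, by linarith⟩
    · have : n * g x (S X) v = 0 := by linarith
      exact (mul_eq_zero.1 this).resolve_left hn0.ne'
    · have : n * g x (S X) (J x v) = 0 := by linarith
      exact (mul_eq_zero.1 this).resolve_left hn0.ne'
  -- Dimension greater than two enters here: some nonzero `X₀` is orthogonal to both `v` and `J v`,
  -- so the factor `g X₀ X₀` can be cancelled.
  obtain ⟨X₀, hX₀, hne⟩ := Submodule.exists_mem_ne_zero_of_ne_bot
    (LinearMap.ker_ne_bot_of_finrank_lt (f := ((g x v).prod (g x (J x v)) : V →ₗ[ℝ] ℝ × ℝ))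
      (by simpa using hdim))
  have hX₀' : g x v X₀ = 0 ∧ g x (J x v) X₀ = 0 := by simpa using hX₀
  have hpos := (hg.pos x hx X₀ hne).ne'
  obtain ⟨-, -, q1, q2⟩ := f1 X₀ (by rw [hsy]; exact hX₀'.1) (by rw [hsy]; exact hX₀'.2)
  have q1 := sub_eq_zero.1 ((mul_eq_zero.1 q1).resolve_right hpos)
  have q2 := (mul_eq_zero.1 q2).resolve_right hpos
  have q3 : g x (S v) (J x v) = 0 := by
    rw [hS (J x v), hsy (J x v)] at q2
    linarith
  have f2 : ∀ X, g x X v = 0 → g x X (J x v) = 0 → S X = (g x (S v) v / n) • X := by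
    intro X hX hX'
    have a := e1 X hX hX'
    obtain ⟨b, c, -, -⟩ := f1 X hX hX'
    rw [b, c, q3] at a
    simp only [zero_smul, add_zero, sub_zero] at a
    rw [div_eq_inv_mul, mul_smul, ← a, smul_smul, inv_mul_cancel₀ hn0.ne', one_smul]
  refine ⟨g x (S v) v / n, fun Y => ?_⟩
  have hdec : ∀ Y, ∃ (Y' : V) (α β : ℝ), Y = Y' + α • v + β • J x v ∧ g x Y' v = 0 ∧
      g x Y' (J x v) = 0 := by
    intro Y
    refine ⟨Y - (g x Y v / n) • v - (g x Y (J x v) / n) • J x v, g x Y v / n, g x Y (J x v) / n,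
      by module, ?_, ?_⟩
    · simp only [map_sub, sub_apply, map_smul, smul_apply, smul_eq_mul, hJv, ← hn]
      field_simp
      ring
    · simp only [map_sub, sub_apply, map_smul, smul_apply, smul_eq_mul, hJJ, hvJ]
      field_simp
      ring
  refine hg.ext hx fun Z => ?_
  obtain ⟨Y', α, β, rfl, hY1, hY2⟩ := hdec Y
  obtain ⟨Z', α', β', rfl, hZ1, hZ2⟩ := hdec Z
  have hvZ : g x (S v) Z' = 0 := by rw [hS, f2 Z' hZ1 hZ2, map_smul, hsy v Z', hZ1, smul_zero]
  have hvZ' : g x (S (J x v)) Z' = 0 := by rw [hS, f2 Z' hZ1 hZ2, map_smul, hsy (J x v) Z', hZ2, smul_zero]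
  have q4 : g x (S (J x v)) v = 0 := by linarith
  simp only [map_add, add_apply, map_smul, smul_apply, smul_eq_mul, f2 Y' hY1 hY2, hvZ, hvZ', hY1,
    hY2, q3, q4, ← q1, hsy v Z', hsy (J x v) Z', hZ1, hZ2, ← hn, hJJ, hJv, hvJ]
  field_simp
  ring

/-- The triple `(c Id, 0, c)` solves the same linear system for `B = -1`, so the difference
satisfies a homogeneous first-order system whose coefficients, built from `g`, `J` and the
Christoffel symbols, are locally bounded. -/
lemma IsExtSolOn.norm_fderiv_le (hK : IsKahlerOn U g J) (hU : IsOpen U) {μ : V → ℝ}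
    (hE : IsExtSolOn U g J (-1) A L μ) (c : ℝ) (hx : x ∈ U) :
    ∃ K : ℝ, ∀ᶠ y in nhds x,
      ‖fderiv ℝ (fun y => (A y - c • ContinuousLinearMap.id ℝ V, L y, μ y - c)) y‖ ≤
        K * ‖(A y - c • ContinuousLinearMap.id ℝ V, L y, μ y - c)‖ := by
  have hg := hK.riemannian
  obtain ⟨k, hk⟩ : ∃ k : ℝ, ∀ᶠ y in nhds x, ‖g y‖ ≤ k ∧ ‖J y‖ ≤ k ∧ ‖christoffelCLM g y‖ ≤ k := by
    have c1 := (hg.contDiffAt hU hx).continuousAt.norm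
    have c2 := (hK.contDiffAt_J hU hx).continuousAt.norm
    have c3 := (hg.contDiffAt_christoffelCLM hU hx).continuousAt.norm
    refine ⟨‖g x‖ + ‖J x‖ + ‖christoffelCLM g x‖ + 1, ?_⟩
    have h1 := norm_nonneg (g x)
    have h2 := norm_nonneg (J x)
    have h3 := norm_nonneg (christoffelCLM g x)
    filter_upwards [c1.eventually_lt_const (lt_add_one _), c2.eventually_lt_const (lt_add_one _),
      c3.eventually_lt_const (lt_add_one _)] with y h4 h5 h6
    exact ⟨by linarith, by linarith, by linarith⟩
  -- A common bound for the three components, which contribute `4k + 2k³` (for `A`), `2 + k` (for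
  -- `Λ`) and `2k` (for `μ`).
  refine ⟨2 + 4 * k + 2 * k ^ 3, ?_⟩
  filter_upwards [hk, hU.mem_nhds hx] with y ⟨k1, k2, k3⟩ hy
  have hk0 : 0 ≤ k := (norm_nonneg _).trans k1
  set a := A y - c • ContinuousLinearMap.id ℝ V with ha
  set N := ‖(a, L y, μ y - c)‖ with hN
  have hN0 : 0 ≤ N := norm_nonneg _
  have na : ‖a‖ ≤ N := norm_fst_le (a, L y, μ y - c)
  have nr : ‖(L y, μ y - c)‖ ≤ N := norm_snd_le (a, L y, μ y - c)
  have nL : ‖L y‖ ≤ N := (norm_fst_le (L y, μ y - c)).trans nr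
  have nμ : ‖μ y - c‖ ≤ N := (norm_snd_le (L y, μ y - c)).trans nr
  have hAd : DifferentiableAt ℝ A y := (hE.sol.contDiffAt_A hU hy).differentiableAt (by simp)
  have hLd : DifferentiableAt ℝ L y := (hE.sol.contDiffAt_L hU hy).differentiableAt (by simp)
  have hμd : DifferentiableAt ℝ μ y :=
    (hE.smooth_μ.contDiffAt (hU.mem_nhds hy)).differentiableAt (by simp)
  have hfd := ((hAd.hasFDerivAt.sub_const (c • ContinuousLinearMap.id ℝ V)).prodMk
    (hLd.hasFDerivAt.prodMk (hμd.hasFDerivAt.sub_const c))).fderiv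
  rw [hfd, ContinuousLinearMap.opNorm_prod]
  have hgb : ∀ X Y, ‖g y X Y‖ ≤ k * ‖X‖ * ‖Y‖ := fun X Y =>
    (ContinuousLinearMap.le_opNorm₂ _ _ _).trans (by gcongr)
  have hΓb : ∀ X Y, ‖christoffel g y X Y‖ ≤ k * ‖X‖ * ‖Y‖ := fun X Y => by
    rw [← christoffelCLM_apply]
    exact (ContinuousLinearMap.le_opNorm₂ _ _ _).trans (by gcongr)
  have hJb : ∀ X, ‖J y X‖ ≤ k * ‖X‖ := fun X =>
    (ContinuousLinearMap.le_opNorm _ _).trans (by gcongr)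
  have hab : ∀ X, ‖a X‖ ≤ N * ‖X‖ := fun X =>
    (ContinuousLinearMap.le_opNorm _ _).trans (by gcongr)
  refine max_le ?_ ?_
  · refine ContinuousLinearMap.opNorm_le_bound₂ _ (by positivity) fun X Y => ?_
    have h1 := hE.sol.main y hy X Y
    have h2 : fderiv ℝ A y X Y = g y X Y • L y + g y (L y) Y • X + g y (J y X) Y • J y (L y)
        + g y (J y (L y)) Y • J y X - christoffel g y X (a Y) + a (christoffel g y X Y) := by
      rw [← h1, covDerivEnd]
      simp only [ha, sub_apply, smul_apply, ContinuousLinearMap.id_apply, christoffel_sub,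
        christoffel_smul]
      abel
    rw [h2]
    have t1 : ‖g y X Y • L y‖ ≤ k * ‖X‖ * ‖Y‖ * N := by
      rw [norm_smul]; gcongr; exact hgb X Y
    have t2 : ‖g y (L y) Y • X‖ ≤ k * ‖X‖ * ‖Y‖ * N := by
      rw [norm_smul]
      calc _ ≤ (k * ‖L y‖ * ‖Y‖) * ‖X‖ := by gcongr; exact hgb _ _
        _ ≤ (k * N * ‖Y‖) * ‖X‖ := by gcongr
        _ = _ := by ring
    have t3 : ‖g y (J y X) Y • J y (L y)‖ ≤ k ^ 3 * ‖X‖ * ‖Y‖ * N := by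
      rw [norm_smul]
      calc _ ≤ (k * ‖J y X‖ * ‖Y‖) * (k * ‖L y‖) := by gcongr; exacts [hgb _ _, hJb _]
        _ ≤ (k * (k * ‖X‖) * ‖Y‖) * (k * N) := by gcongr; exact hJb _
        _ = _ := by ring
    have t4 : ‖g y (J y (L y)) Y • J y X‖ ≤ k ^ 3 * ‖X‖ * ‖Y‖ * N := by
      rw [norm_smul]
      calc _ ≤ (k * ‖J y (L y)‖ * ‖Y‖) * (k * ‖X‖) := by gcongr; exacts [hgb _ _, hJb _]
        _ ≤ (k * (k * ‖L y‖) * ‖Y‖) * (k * ‖X‖) := by gcongr; exact hJb _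
        _ ≤ (k * (k * N) * ‖Y‖) * (k * ‖X‖) := by gcongr
        _ = _ := by ring
    have t5 : ‖christoffel g y X (a Y)‖ ≤ k * ‖X‖ * ‖Y‖ * N := by
      calc _ ≤ k * ‖X‖ * ‖a Y‖ := hΓb _ _
        _ ≤ k * ‖X‖ * (N * ‖Y‖) := by gcongr; exact hab _
        _ = _ := by ring
    have t6 : ‖a (christoffel g y X Y)‖ ≤ k * ‖X‖ * ‖Y‖ * N := by
      calc _ ≤ N * ‖christoffel g y X Y‖ := hab _
        _ ≤ N * (k * ‖X‖ * ‖Y‖) := by gcongr; exact hΓb _ _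
        _ = _ := by ring
    have hp : 0 ≤ ‖X‖ * ‖Y‖ * N := by positivity
    calc _ ≤ _ := (norm_add_le _ _).trans (add_le_add ((norm_sub_le _ _).trans (add_le_add
          (norm_add₄_le.trans (add_le_add (add_le_add (add_le_add t1 t2) t3) t4)) t5)) t6)
      _ ≤ _ := by linarith
  rw [ContinuousLinearMap.opNorm_prod]
  refine max_le ?_ ?_
  · refine ContinuousLinearMap.opNorm_le_bound _ (by positivity) fun X => ?_
    have h2 : fderiv ℝ L y X = (μ y - c) • X - a X - christoffel g y X (L y) := by
      have := hE.cov_L y hy X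
      rw [covDerivVec, ← eq_sub_iff_add_eq] at this
      rw [this]
      simp only [ha, sub_apply, smul_apply, ContinuousLinearMap.id_apply]
      module
    rw [h2]
    have t1 : ‖(μ y - c) • X‖ ≤ N * ‖X‖ := by rw [norm_smul]; gcongr
    have t2 : ‖christoffel g y X (L y)‖ ≤ k * ‖X‖ * N := (hΓb _ _).trans (by gcongr)
    have hp : 0 ≤ k ^ 3 * N * ‖X‖ := by positivity
    have hp' : 0 ≤ k * N * ‖X‖ := by positivity
    calc _ ≤ _ := (norm_sub_le _ _).trans (add_le_add ((norm_sub_le _ _).trans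
          (add_le_add t1 (hab X))) t2)
      _ ≤ _ := by linarith
  · refine ContinuousLinearMap.opNorm_le_bound _ (by positivity) fun X => ?_
    rw [hE.d_μ y hy X]
    have t1 : ‖g y (L y) X‖ ≤ k * N * ‖X‖ := (hgb _ _).trans (by gcongr)
    have hp : 0 ≤ k ^ 3 * N * ‖X‖ := by positivity
    have hp' : 0 ≤ k * N * ‖X‖ := by positivity
    have hp'' : 0 ≤ N * ‖X‖ := by positivity
    rw [norm_mul]
    norm_num at t1 ⊢
    linarith

/-- If `Λ` vanished near `x`, then `∇Λ = 0` would give `A = μ Id` at `x`. The triple would agree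
there with the trivial solution `(c Id, 0, c)`, `c = μ x`, hence on all of `U`, and `Λ` would be
zero. -/
lemma IsExtSolOn.mem_closure (hK : IsKahlerOn U g J) (hU : IsOpen U) (hUc : IsPreconnected U)
    {μ : V → ℝ} (hE : IsExtSolOn U g J (-1) A L μ) (hne : ∃ x ∈ U, L x ≠ 0) (hx : x ∈ U) :
    x ∈ closure {y | y ∈ U ∧ L y ≠ 0} := by
  by_contra h
  have h0 : ∀ᶠ y in nhds x, L y = 0 := by
    rw [mem_closure_iff_frequently, Filter.not_frequently] at h
    filter_upwards [h, hU.mem_nhds hx] with y h1 h2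
    by_contra h3
    exact h1 ⟨h2, h3⟩
  have hA : ∀ X, A x X = μ x • X := by
    intro X
    have h1 := hE.cov_L x hx X
    have h2 : L =ᶠ[nhds x] fun _ => (0 : V) := h0
    rw [covDerivVec_congr h2, covDerivVec_const, ← christoffelCLM_apply, map_zero] at h1
    rw [neg_one_smul, ← sub_eq_add_neg, eq_comm, sub_eq_zero] at h1
    exact h1.symm
  have hz := eq_zero_of_norm_fderiv_le hU hUc
    (f := fun y => (A y - μ x • ContinuousLinearMap.id ℝ V, L y, μ y - μ x)) (fun y hy => ?_)
    (fun y hy => hE.norm_fderiv_le hK hU (μ x) hy) hx ?_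
  · obtain ⟨y, hy, hLy⟩ := hne
    have := hz y hy
    simp only [Prod.mk_eq_zero] at this
    exact hLy this.2.1
  · exact (((hE.sol.contDiffAt_A hU hy).differentiableAt (by simp)).sub_const _).prodMk
      (((hE.sol.contDiffAt_L hU hy).differentiableAt (by simp)).prodMk
      (((hE.smooth_μ.contDiffAt (hU.mem_nhds hy)).differentiableAt (by simp)).sub_const _))
  · simp only [Prod.mk_eq_zero]
    refine ⟨?_, h0.self_of_nhds, sub_self _⟩
    ext X
    simp [hA]

/-- On a `C_ℂ(-1)` metric every element of `Sol(g, J)` solves the extended system. -/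
theorem IsSolOn.exists_isExtSolOn (hK : IsKahlerOn U g J) (hU : IsOpen U) (hUc : IsPreconnected U)
    (hdim : 2 < Module.finrank ℝ V) (hCC : IsCC U g J (-1)) (hA : IsSolOn U g J A L)
    (hsymm : ∀ x ∈ U, ∀ X Y, g x (covDerivVec g L x X) Y = g x X (covDerivVec g L x Y)) :
    ∃ μ : V → ℝ, IsExtSolOn U g J (-1) A L μ := by
  have hg := hK.riemannian
  obtain ⟨A₀, L₀, μ₀, hE, hne⟩ := hCC
  have hdense : ∀ x ∈ U, x ∈ closure {y | y ∈ U ∧ L₀ y ≠ 0} :=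
    fun x hx => hE.mem_closure hK hU hUc hne hx
  have hnull : ∀ y ∈ U, ∀ X Y, curvature g y X Y (L₀ y) = (-1 : ℝ) • holCurv g J y X Y (L₀ y) := by
    intro y hy X Y
    rw [curvature_eq_of_covDerivVec hK hU hE.sol hE.smooth_μ hE.cov_L hy, hE.d_μ y hy, hE.d_μ y hy]
    simp
  have hS : ∀ y ∈ U, L₀ y ≠ 0 → ∃ s : ℝ, ∀ X, covDerivVec g L y X + A y X = s • X := by
    intro y hy hLy
    have hv : ∀ v, (∀ X Z, curvature g y X v Z = (-1 : ℝ) • holCurv g J y X v Z) → ∀ X Z,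
        hermProd g J y v ((covDerivCLM g L y + A y) X) Z =
          hermProd g J y X ((covDerivCLM g L y + A y) v) Z := by
      intro v hv X Z
      have h1 := hA.curvature_comm hK hU hy X v Z
      have h2 := holCurv_comm hK hA hy X v Z
      rw [hv, hv, map_smul, ← smul_sub, h2] at h1
      rw [add_apply, add_apply, hermProd_add_right, hermProd_add_right, covDerivCLM_apply,
        covDerivCLM_apply, ← sub_eq_zero]
      rw [eq_comm, ← sub_eq_zero] at h1
      rw [← h1]
      module
    obtain ⟨s, hs⟩ := eq_smul_of_hermProd hK hy hdim (S := covDerivCLM g L y + A y) (v := L₀ y)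
      (fun X Y => by
        simp only [add_apply, map_add, covDerivCLM_apply, hsymm y hy, hA.hermitian.symm y hy]) hLy
      (hv _ (hK.nullity hU hy (hnull y hy))) (hv _ (hK.nullity_J hU hy (hnull y hy)))
    exact ⟨s, fun X => by simpa [covDerivCLM_apply] using hs X⟩
  have : Nontrivial V := Module.nontrivial_of_finrank_pos (R := ℝ) (by omega)
  obtain ⟨e, he⟩ := exists_ne (0 : V)
  have hAs : ∀ y ∈ U, ∀ X, ContDiffAt ℝ ∞ (fun y => covDerivVec g L y X + A y X) y :=
    fun y hy X => (hg.contDiffAt_covDerivVec hU hy (hA.contDiffAt_L hU hy) X).add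
      ((hA.contDiffAt_A hU hy).clm_apply contDiffAt_const)
  -- The scalar is read off from one fixed nonzero vector `e`; this makes `μ` smooth on all of `U`,
  -- also where `L₀` vanishes.
  set μ : V → ℝ := fun y => g y (covDerivVec g L y e + A y e) e / g y e e with hμ
  have hμs : ∀ y ∈ U, ContDiffAt ℝ ∞ μ y := by
    intro y hy
    exact (((hg.contDiffAt hU hy).clm_apply (hAs y hy e)).clm_apply contDiffAt_const).div
      (((hg.contDiffAt hU hy).clm_apply contDiffAt_const).clm_apply contDiffAt_const)
      (hg.pos y hy e he).ne'
  have hμ' : ∀ y ∈ U, ∀ X, covDerivVec g L y X + A y X = μ y • X := by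
    intro y hy X
    refine tendsto_nhds_unique_of_frequently_eq (hAs y hy X).continuousAt
      (((hμs y hy).continuousAt.smul continuousAt_const :
        ContinuousAt (fun y => μ y • X) y)) ?_
    refine (mem_closure_iff_frequently.1 (hdense y hy)).mono ?_
    rintro z ⟨hz, hLz⟩
    obtain ⟨s, hs⟩ := hS z hz hLz
    have : μ z = s := by
      simp only [hμ, hs, map_smul, smul_apply, smul_eq_mul]
      exact mul_div_cancel_right₀ _ (hg.pos z hz e he).ne'
    rw [hs, Pi.smul_apply', this]
  have hcov : ∀ y ∈ U, ∀ X, covDerivVec g L y X = μ y • X + (-1 : ℝ) • A y X := by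
    intro y hy X
    rw [← hμ' y hy X]
    module
  have hμc : ContDiffOn ℝ ∞ μ U := fun y hy => (hμs y hy).contDiffWithinAt
  refine ⟨μ, hA, hμc, hcov, fun x hx X => ?_⟩
  have hd1 : ContinuousAt (fun y => fderiv ℝ μ y X) x :=
    (((hμs x hx).fderiv_right (m := ∞) (by simp)).clm_apply contDiffAt_const).continuousAt
  have hd2 : ContinuousAt (fun y => 2 * (-1) * g y (L y) X) x :=
    (contDiffAt_const.mul (((hg.contDiffAt hU hx).clm_apply (hA.contDiffAt_L hU hx)).clm_apply
      contDiffAt_const)).continuousAt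
  refine tendsto_nhds_unique_of_frequently_eq hd1 hd2 ?_
  refine (mem_closure_iff_frequently.1 (hdense x hx)).mono ?_
  rintro y ⟨hy, hLy⟩
  set α : V → ℝ := fun X => fderiv ℝ μ y X - 2 * (-1) * g y (L y) X with hαdef
  have hα : ∀ X, α X • L₀ y = α (L₀ y) • X := by
    intro X
    -- Since `L₀` is in the nullity, the model curvature terms cancel and only the defect `α` of the
    -- last equation remains.
    have h1 := curvature_eq_of_covDerivVec hK hU hA hμc hcov hy X (L₀ y)
    rw [hK.nullity hU hy (hnull y hy), right_eq_add, sub_eq_zero] at h1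
    exact h1
  have hα0 : α (L₀ y) = 0 := by
    -- Taking `X = J L₀` and pairing with `J L₀` uses that `L₀` and `J L₀` are orthogonal.
    have h1 := congrArg (fun Z => g y Z (J y (L₀ y))) (hα (J y (L₀ y)))
    simp only [map_smul, smul_apply, smul_eq_mul, hK.inner_self_J hy, hK.hermitian y hy,
      mul_zero] at h1
    exact (mul_eq_zero.1 h1.symm).resolve_right (hg.pos y hy _ hLy).ne'
  have h2 := hα X
  rw [hα0, zero_smul] at h2
  exact sub_eq_zero.1 ((smul_eq_zero.1 h2).resolve_right hLy)

end Extension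

/-! ### The cone metric and its Christoffel symbols -/

section Cone

variable {E : Type*} [NormedAddCommGroup E] [NormedSpace ℝ E]
  {U : Set E} {g : BilinField E} {J A : EndField E} {L : E → E} {μ : E → ℝ} {τ : E → E →L[ℝ] ℝ}

lemma metric_covDerivEnd {V : Type*} [NormedAddCommGroup V] [NormedSpace ℝ V]
    [FiniteDimensional ℝ V] {U : Set V} {g : BilinField V} {A : EndField V} {x : V}
    (hg : IsRiemannianOn U g) (hU : IsOpen U) (hx : x ∈ U)
    (hA : DifferentiableAt ℝ A x) (X Y Z : V) :
    g x (covDerivEnd g A x X Y) Z = fderiv ℝ (fun y => g y (A y Y) Z) x X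
      - g x (A x (christoffel g x X Y)) Z - g x (A x Y) (christoffel g x X Z) := by
  rw [fderiv_metric hg hU hx (hA.clm_apply (differentiableAt_const Y)) (differentiableAt_const Z),
    covDerivVec_end hA (differentiableAt_const Y), covDerivVec_const, covDerivVec_const]
  simp only [map_add, add_apply]
  ring

lemma conePhi_apply (p v : ℝ × ℝ × E) : conePhi τ p v = v.2.1 - τ p.2.2 v.2.2 := rfl

lemma coneMetric_apply (p v w : ℝ × ℝ × E) : coneMetric g τ p v w =
    v.1 * w.1 + p.1 ^ 2 * (conePhi τ p v * conePhi τ p w + g p.2.2 v.2.2 w.2.2) := by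
  rfl

lemma coneForm_apply (p v w : ℝ × ℝ × E) : coneForm g J τ A L μ p v w =
    μ p.2.2 * (v.1 * w.1) - p.1 * (v.1 * g p.2.2 (L p.2.2) w.2.2 + g p.2.2 (L p.2.2) v.2.2 * w.1)
      + p.1 ^ 2 * (μ p.2.2 * (conePhi τ p v * conePhi τ p w)
        + (conePhi τ p v * g p.2.2 (L p.2.2) (J p.2.2 w.2.2)
          + g p.2.2 (L p.2.2) (J p.2.2 v.2.2) * conePhi τ p w)
        + g p.2.2 (A p.2.2 v.2.2) w.2.2) := by
  rfl

lemma coneJ_apply (p v : ℝ × ℝ × E) : coneJ J τ p v =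
    (-(conePhi τ p v * p.1), v.1 * p.1⁻¹ + τ p.2.2 (J p.2.2 v.2.2), J p.2.2 v.2.2) := by
  simp [coneJ, horLift, projE, dr]

lemma isOpen_coneSet (hU : IsOpen U) : IsOpen (coneSet U) :=
  (isOpen_lt continuous_const continuous_fst).inter (hU.preimage (by fun_prop))

lemma contDiffOn_projE {F : Type*} [NormedAddCommGroup F] [NormedSpace ℝ F] {f : E → F}
    (hf : ContDiffOn ℝ ∞ f U) : ContDiffOn ℝ ∞ (fun p : ℝ × ℝ × E => f p.2.2) (coneSet U) :=
  hf.comp (by fun_prop) fun _ hp => hp.2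

lemma contDiffOn_conePhi (hτ : ContDiffOn ℝ ∞ τ U) (v : ℝ × ℝ × E) :
    ContDiffOn ℝ ∞ (fun p => conePhi τ p v) (coneSet U) := by
  simp only [conePhi_apply]
  exact contDiffOn_const.sub ((contDiffOn_projE hτ).clm_apply contDiffOn_const)

lemma hasFDerivAt_projE {f : E → ℝ} {p : ℝ × ℝ × E} (hf : DifferentiableAt ℝ f p.2.2) :
    HasFDerivAt (fun q : ℝ × ℝ × E => f q.2.2) ((fderiv ℝ f p.2.2).comp projE) p :=
  HasFDerivAt.comp (g := f) p hf.hasFDerivAt (projE (E := E)).hasFDerivAt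

variable [FiniteDimensional ℝ E]

lemma IsRiemannianOn.cone (hg : IsRiemannianOn U g) (hτ : ContDiffOn ℝ ∞ τ U) :
    IsRiemannianOn (coneSet U) (coneMetric g τ) where
  smooth := by
    rw [contDiffOn_clm_apply]
    intro v
    rw [contDiffOn_clm_apply]
    intro w
    simp only [coneMetric_apply]
    exact contDiffOn_const.add ((contDiff_fst.contDiffOn.pow 2).mul
      (((contDiffOn_conePhi hτ v).mul (contDiffOn_conePhi hτ w)).add
        (((contDiffOn_projE hg.smooth).clm_apply contDiffOn_const).clm_apply contDiffOn_const)))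
  symm p hp v w := by
    simp only [coneMetric_apply, hg.symm _ hp.2 v.2.2]
    ring
  pos p hp v hv := by
    rw [coneMetric_apply]
    have hr : 0 < p.1 ^ 2 := pow_pos hp.1 2
    by_cases h3 : v.2.2 = 0
    · have : 0 < v.1 * v.1 + p.1 ^ 2 * (v.2.1 * v.2.1) := by
        by_cases h1 : v.1 = 0
        · have h2 : v.2.1 ≠ 0 := fun h2 => hv (Prod.ext h1 (Prod.ext h2 h3))
          have := mul_pos hr (mul_self_pos.2 h2)
          nlinarith [mul_self_nonneg v.1]
        · have := mul_self_pos.2 h1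
          nlinarith [mul_nonneg hr.le (mul_self_nonneg v.2.1)]
      simpa [conePhi_apply, h3] using this
    · have h1 := mul_pos hr (hg.pos _ hp.2 _ h3)
      have h2 := mul_nonneg hr.le (mul_self_nonneg (conePhi τ p v))
      nlinarith [mul_self_nonneg v.1]

/-- The Christoffel symbols of the cone metric. -/
lemma christoffel_cone (hK : IsKahlerOn U g J) (hU : IsOpen U) (hτ : ContDiffOn ℝ ∞ τ U)
    (hdτ : ∀ x ∈ U, ∀ X Y, extDerivOne τ x X Y = -2 * kahlerForm g J x X Y)
    {p : ℝ × ℝ × E} (hp : p ∈ coneSet U) (X Y : ℝ × ℝ × E) :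
    ∃ γ : ℝ × ℝ × E, christoffel (coneMetric g τ) p X Y = γ ∧
      γ.1 = -(p.1 * (conePhi τ p X * conePhi τ p Y + g p.2.2 X.2.2 Y.2.2)) ∧
      conePhi τ p γ = (X.1 * conePhi τ p Y + Y.1 * conePhi τ p X) / p.1
        - (fderiv ℝ τ p.2.2 X.2.2 Y.2.2 + fderiv ℝ τ p.2.2 Y.2.2 X.2.2) / 2 ∧
      γ.2.2 = (X.1 / p.1) • Y.2.2 + (Y.1 / p.1) • X.2.2 + conePhi τ p Y • J p.2.2 X.2.2
        + conePhi τ p X • J p.2.2 Y.2.2 + christoffel g p.2.2 X.2.2 Y.2.2 := by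
  have hg := hK.riemannian
  have hgc := hg.cone hτ
  have hO := isOpen_coneSet hU
  have hr : p.1 ≠ 0 := hp.1.ne'
  have hx := hp.2
  have hτd : DifferentiableAt ℝ τ p.2.2 :=
    (hτ.contDiffAt (hU.mem_nhds hx)).differentiableAt (by simp)
  have hgd : DifferentiableAt ℝ g p.2.2 := (hg.contDiffAt hU hx).differentiableAt (by simp)
  have hφ : ∀ Y : ℝ × ℝ × E, HasFDerivAt (fun q => conePhi τ q Y)
      (-(fderiv ℝ (fun y => τ y Y.2.2) p.2.2).comp projE) p := fun Y =>
    (hasFDerivAt_projE (hτd.clm_apply (differentiableAt_const _))).const_sub Y.2.1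
  have hd : ∀ X Y Z, fderiv ℝ (coneMetric g τ) p X Y Z =
      2 * p.1 * X.1 * (conePhi τ p Y * conePhi τ p Z + g p.2.2 Y.2.2 Z.2.2)
      + p.1 ^ 2 * (-(fderiv ℝ τ p.2.2 X.2.2 Y.2.2 * conePhi τ p Z)
        - conePhi τ p Y * fderiv ℝ τ p.2.2 X.2.2 Z.2.2
        + (g p.2.2 (christoffel g p.2.2 X.2.2 Y.2.2) Z.2.2
          + g p.2.2 Y.2.2 (christoffel g p.2.2 X.2.2 Z.2.2))) := by
    intro X Y Z
    have hcd := (hgc.contDiffAt hO hp).differentiableAt (by simp)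
    have e1 : fderiv ℝ (fun q => coneMetric g τ q Y Z) p X = fderiv ℝ (coneMetric g τ) p X Y Z := by
      rw [fderiv_clm_apply (hcd.clm_apply (differentiableAt_const _)) (differentiableAt_const _),
        fderiv_clm_apply hcd (differentiableAt_const _)]
      simp
    have h1 := (((dr (E := E)).hasFDerivAt (x := p)).pow 2).mul (((hφ Y).mul (hφ Z)).add
      (hasFDerivAt_projE (f := fun y => g y Y.2.2 Z.2.2)
        ((hgd.clm_apply (differentiableAt_const _)).clm_apply (differentiableAt_const _))))
    have h2 := h1.const_add (Y.1 * Z.1)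
    have h3 : HasFDerivAt (fun q => coneMetric g τ q Y Z) _ p := h2
    rw [← e1, h3.fderiv]
    have hτ' : ∀ X Y, fderiv ℝ (fun y => τ y Y) p.2.2 X = fderiv ℝ τ p.2.2 X Y := by
      intro X Y
      rw [fderiv_clm_apply hτd (differentiableAt_const _)]
      simp
    have hg' := fderiv_metric hg hU hx (differentiableAt_const Y.2.2) (differentiableAt_const Z.2.2)
      X.2.2
    rw [covDerivVec_const, covDerivVec_const] at hg'
    simp [projE, dr, hτ', hg']
    ring
  -- The condition `dτ = -2ω` expresses the antisymmetric part of `Dτ` through `J`; this is the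
  -- source of the `J`-terms in the Christoffel symbols.
  have hω : ∀ X Y, fderiv ℝ τ p.2.2 X Y = fderiv ℝ τ p.2.2 Y X - 2 * g p.2.2 (J p.2.2 X) Y := by
    intro X Y
    have := hdτ _ hx X Y
    simp only [extDerivOne, kahlerForm] at this
    linarith
  set b : E := (X.1 / p.1) • Y.2.2 + (Y.1 / p.1) • X.2.2 + conePhi τ p Y • J p.2.2 X.2.2
        + conePhi τ p X • J p.2.2 Y.2.2 + christoffel g p.2.2 X.2.2 Y.2.2 with hb
  refine ⟨(-(p.1 * (conePhi τ p X * conePhi τ p Y + g p.2.2 X.2.2 Y.2.2)),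
    (X.1 * conePhi τ p Y + Y.1 * conePhi τ p X) / p.1
        - (fderiv ℝ τ p.2.2 X.2.2 Y.2.2 + fderiv ℝ τ p.2.2 Y.2.2 X.2.2) / 2 + τ p.2.2 b, b),
    ?_, rfl, by rw [conePhi_apply]; ring, rfl⟩
  -- The proposed vector is checked against the Koszul formula by pairing with an arbitrary `Z`.
  refine hgc.ext hp fun Z => ?_
  rw [hgc.apply_christoffel hp, hd, hd, hd, coneMetric_apply]
  have hφb : ∀ a s, conePhi τ p (a, s + τ p.2.2 b, b) = s := fun a s => by
    rw [conePhi_apply]; ring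
  rw [hφb]
  simp only [hb, map_add, add_apply, map_smul, smul_apply, smul_eq_mul,
    christoffel_comm hg hU hx Z.2.2, christoffel_comm hg hU hx Y.2.2 X.2.2,
    hω X.2.2 Z.2.2, hω Y.2.2 Z.2.2]
  rw [hg.symm _ hx (christoffel g p.2.2 X.2.2 Z.2.2) Y.2.2]
  field_simp
  ring

end Cone

/-! ### The parallel endomorphism of the cone -/

section ConeEnd

variable {E : Type*} [NormedAddCommGroup E] [NormedSpace ℝ E]
  {U : Set E} {g : BilinField E} {J A : EndField E} {L : E → E} {μ : E → ℝ} {τ : E → E →L[ℝ] ℝ}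

/-- The endomorphism field of the cone which corresponds to `(A, Λ, μ)`. -/
def coneEnd (g : BilinField E) (J : EndField E) (τ : E → E →L[ℝ] ℝ)
    (A : EndField E) (L : E → E) (μ : E → ℝ) : EndField (ℝ × ℝ × E) := fun p =>
  let b : (ℝ × ℝ × E) →L[ℝ] E := (A p.2.2).comp projE - (p.1⁻¹ • dr).smulRight (L p.2.2)
    - (conePhi τ p).smulRight (J p.2.2 (L p.2.2))
  (μ p.2.2 • dr - p.1 • (g p.2.2 (L p.2.2)).comp projE).prod
    -- The summand `τ ∘ b` converts the prescribed `φ`-component into the `t`-component, because `φ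
    -- = dt - τ`.
    ((μ p.2.2 • conePhi τ p + ((g p.2.2 (L p.2.2)).comp (J p.2.2)).comp projE
      + (τ p.2.2).comp b).prod b)

lemma coneEnd_fst (p v : ℝ × ℝ × E) : (coneEnd g J τ A L μ p v).1 =
    μ p.2.2 * v.1 - p.1 * g p.2.2 (L p.2.2) v.2.2 := rfl

lemma coneEnd_snd (p v : ℝ × ℝ × E) : (coneEnd g J τ A L μ p v).2.2 =
    A p.2.2 v.2.2 - (p.1⁻¹ * v.1) • L p.2.2 - conePhi τ p v • J p.2.2 (L p.2.2) := rfl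

lemma conePhi_coneEnd (p v : ℝ × ℝ × E) : conePhi τ p (coneEnd g J τ A L μ p v) =
    μ p.2.2 * conePhi τ p v + g p.2.2 (L p.2.2) (J p.2.2 v.2.2) := by
  have : (coneEnd g J τ A L μ p v).2.1 = μ p.2.2 * conePhi τ p v
      + g p.2.2 (L p.2.2) (J p.2.2 v.2.2) + τ p.2.2 (coneEnd g J τ A L μ p v).2.2 := rfl
  rw [conePhi_apply, this, add_sub_cancel_right]

/-- Vectors are compared through `dr`, `φ` and the projection rather than through product
coordinates, because the formulas for `coneEnd` and `coneJ` are free of `τ` in these components. -/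
lemma cone_ext {p v w : ℝ × ℝ × E} (h1 : v.1 = w.1) (h2 : conePhi τ p v = conePhi τ p w)
    (h3 : v.2.2 = w.2.2) : v = w := by
  refine Prod.ext h1 (Prod.ext ?_ h3)
  rw [conePhi_apply, conePhi_apply, h3] at h2
  linarith

lemma coneJ_fst (p v : ℝ × ℝ × E) : (coneJ J τ p v).1 = -(p.1 * conePhi τ p v) := by
  rw [coneJ_apply, mul_comm]

lemma coneJ_snd (p v : ℝ × ℝ × E) : (coneJ J τ p v).2.2 = J p.2.2 v.2.2 := by
  rw [coneJ_apply]

lemma conePhi_coneJ (p v : ℝ × ℝ × E) : conePhi τ p (coneJ J τ p v) = p.1⁻¹ * v.1 := by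
  rw [coneJ_apply, conePhi_apply]
  ring

variable [FiniteDimensional ℝ E]

lemma coneEnd_corresponds (hK : IsKahlerOn U g J) :
    ConeCorresponds U g J τ A L μ (coneEnd g J τ A L μ) := by
  intro p hp v w
  have hr : p.1 ≠ 0 := hp.1.ne'
  rw [coneMetric_apply, coneForm_apply, coneEnd_fst, coneEnd_snd, conePhi_coneEnd]
  simp only [map_sub, sub_apply, map_smul, smul_apply, smul_eq_mul, hK.inner_J_left hp.2]
  field_simp
  ring

lemma coneForm_symm (hK : IsKahlerOn U g J) (hA : IsSolOn U g J A L) {p : ℝ × ℝ × E}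
    (hp : p ∈ coneSet U) (v w : ℝ × ℝ × E) :
    coneForm g J τ A L μ p v w = coneForm g J τ A L μ p w v := by
  simp only [coneForm_apply]
  rw [hA.hermitian.symm _ hp.2, hK.riemannian.symm _ hp.2 v.2.2]
  ring

lemma coneEnd_hermitian (hK : IsKahlerOn U g J) (hτ : ContDiffOn ℝ ∞ τ U)
    (hA : IsSolOn U g J A L) (hμ : ContDiffOn ℝ ∞ μ U) :
    IsHermitianEndOn (coneSet U) (coneMetric g τ) (coneJ J τ) (coneEnd g J τ A L μ) where
  smooth := by
    rw [contDiffOn_clm_apply]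
    intro v
    have hL := contDiffOn_projE hA.smooth_L
    have hJ := contDiffOn_projE hK.smooth_J
    have hgL := (contDiffOn_projE hK.riemannian.smooth).clm_apply hL
    have hb : ContDiffOn ℝ ∞ (fun p : ℝ × ℝ × E => (coneEnd g J τ A L μ p v).2.2) (coneSet U) := by
      simp only [coneEnd_snd]
      exact (((contDiffOn_projE hA.hermitian.smooth).clm_apply contDiffOn_const).sub
        (((contDiff_fst.contDiffOn.inv fun p hp => hp.1.ne').mul contDiffOn_const).smul hL)).sub
        ((contDiffOn_conePhi hτ v).smul (hJ.clm_apply hL))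
    refine ContDiffOn.prodMk ?_ (ContDiffOn.prodMk ?_ hb)
    · exact ((contDiffOn_projE hμ).mul contDiffOn_const).sub
        (contDiff_fst.contDiffOn.mul (hgL.clm_apply contDiffOn_const))
    · exact (((contDiffOn_projE hμ).mul (contDiffOn_conePhi hτ v)).add
        (hgL.clm_apply (hJ.clm_apply contDiffOn_const))).add ((contDiffOn_projE hτ).clm_apply hb)
  symm p hp v w := by
    rw [(hK.riemannian.cone hτ).symm p hp v, coneEnd_corresponds hK p hp,
      coneEnd_corresponds hK p hp, coneForm_symm hK hA hp]
  comm p hp v := by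
    have hr : p.1 ≠ 0 := hp.1.ne'
    refine cone_ext (τ := τ) (p := p) ?_ ?_ ?_
    · simp only [coneEnd_fst, coneJ_fst, coneJ_snd, conePhi_coneEnd]
      ring
    · simp only [coneEnd_fst, coneJ_snd, conePhi_coneEnd, conePhi_coneJ, hK.J_sq _ hp.2, map_neg]
      field_simp
      ring
    · simp only [coneEnd_snd, coneJ_fst, coneJ_snd, conePhi_coneJ, hA.hermitian.comm _ hp.2,
        map_sub, map_smul, hK.J_sq _ hp.2]
      rw [mul_neg, ← mul_assoc, inv_mul_cancel₀ hr]
      module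

/-- The covariant derivative is paired with `Z`, so that it is the explicit form `coneForm`, not the
endomorphism, that gets differentiated. The three equations of the extended system then cancel the
terms coming from the Christoffel symbols. -/
lemma coneEnd_parallel (hK : IsKahlerOn U g J) (hU : IsOpen U) (hτ : ContDiffOn ℝ ∞ τ U)
    (hdτ : ∀ x ∈ U, ∀ X Y, extDerivOne τ x X Y = -2 * kahlerForm g J x X Y)
    (hE : IsExtSolOn U g J (-1) A L μ) :
    IsParallelOn (coneSet U) (coneMetric g τ) (coneEnd g J τ A L μ) := by
  intro p hp X Y
  have hg := hK.riemannian
  have hgc := hg.cone hτ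
  have hO := isOpen_coneSet hU
  have hr : p.1 ≠ 0 := hp.1.ne'
  have hx := hp.2
  have hAc := coneEnd_hermitian (μ := μ) hK hτ hE.sol hE.smooth_μ
  have hcor := coneEnd_corresponds (τ := τ) (A := A) (L := L) (μ := μ) hK
  have hτd : DifferentiableAt ℝ τ p.2.2 :=
    (hτ.contDiffAt (hU.mem_nhds hx)).differentiableAt (by simp)
  have hgd : DifferentiableAt ℝ g p.2.2 := (hg.contDiffAt hU hx).differentiableAt (by simp)
  have hμd : DifferentiableAt ℝ μ p.2.2 :=
    (hE.smooth_μ.contDiffAt (hU.mem_nhds hx)).differentiableAt (by simp)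
  have hAd : DifferentiableAt ℝ A p.2.2 :=
    (hE.sol.contDiffAt_A hU hx).differentiableAt (by simp)
  have hLd : DifferentiableAt ℝ L p.2.2 :=
    (hE.sol.contDiffAt_L hU hx).differentiableAt (by simp)
  have hJd : DifferentiableAt ℝ J p.2.2 := (hK.contDiffAt_J hU hx).differentiableAt (by simp)
  have hc : ∀ v : E, DifferentiableAt ℝ (fun _ : E => v) p.2.2 := fun v => differentiableAt_const v
  refine hgc.ext hp fun Z => ?_
  rw [map_zero, zero_apply, metric_covDerivEnd hgc hO hp
    ((hAc.smooth.contDiffAt (hO.mem_nhds hp)).differentiableAt (by simp)), hcor p hp, hcor p hp]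
  have hev : (fun q => coneMetric g τ q (coneEnd g J τ A L μ q Y) Z) =ᶠ[nhds p]
      fun q => coneForm g J τ A L μ q Y Z := by
    filter_upwards [hO.mem_nhds hp] with q hq using hcor q hq Y Z
  rw [hev.fderiv_eq]
  have hφ : ∀ Y : ℝ × ℝ × E, HasFDerivAt (fun q => conePhi τ q Y)
      (-(fderiv ℝ (fun y => τ y Y.2.2) p.2.2).comp projE) p := fun Y =>
    (hasFDerivAt_projE (hτd.clm_apply (differentiableAt_const _))).const_sub Y.2.1
  have hdr := (dr (E := E)).hasFDerivAt (x := p)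
  have hgL := fun v : E => hasFDerivAt_projE (p := p) (f := fun y => g y (L y) v)
    ((hgd.clm_apply hLd).clm_apply (hc v))
  have hgJ := fun v : E => hasFDerivAt_projE (p := p) (f := fun y => g y (L y) (J y v))
    ((hgd.clm_apply hLd).clm_apply (hJd.clm_apply (hc v)))
  have hgA := fun u v : E => hasFDerivAt_projE (p := p) (f := fun y => g y (A y u) v)
    ((hgd.clm_apply (hAd.clm_apply (hc u))).clm_apply (hc v))
  have hμ' := hasFDerivAt_projE (p := p) hμd
  have h0 := (((hμ'.mul_const (Y.1 * Z.1)).sub (hdr.mul (((hgL Z.2.2).const_mul Y.1).add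
      ((hgL Y.2.2).mul_const Z.1)))).add ((hdr.pow 2).mul
      (((hμ'.mul ((hφ Y).mul (hφ Z))).add (((hφ Y).mul (hgJ Z.2.2)).add
        ((hgJ Y.2.2).mul (hφ Z)))).add (hgA Y.2.2 Z.2.2))))
  have h1 : HasFDerivAt (fun q => coneForm g J τ A L μ q Y Z) _ p := h0
  obtain ⟨γ, hγ, hγ1, hγ2, hγ3⟩ := christoffel_cone hK hU hτ hdτ hp X Y
  obtain ⟨δ, hδ, hδ1, hδ2, hδ3⟩ := christoffel_cone hK hU hτ hdτ hp X Z
  have hτ' : ∀ X Y, fderiv ℝ (fun y => τ y Y) p.2.2 X = fderiv ℝ τ p.2.2 X Y := by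
    intro X Y
    rw [fderiv_clm_apply hτd (differentiableAt_const _)]
    simp
  have d1 : ∀ v, fderiv ℝ (fun y => g y (L y) v) p.2.2 X.2.2 = _ := fun v =>
    fderiv_metric hg hU hx hLd (hc v) X.2.2
  have d2 : ∀ v, fderiv ℝ (fun y => g y (L y) (J y v)) p.2.2 X.2.2 = _ := fun v =>
    fderiv_metric hg hU hx hLd (hJd.clm_apply (hc v)) X.2.2
  have d3 : ∀ u v, fderiv ℝ (fun y => g y (A y u) v) p.2.2 X.2.2 = _ := fun u v =>
    fderiv_metric hg hU hx (hAd.clm_apply (hc u)) (hc v) X.2.2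
  have d4 : ∀ v, covDerivVec g (fun y => J y v) p.2.2 X.2.2 =
      J p.2.2 (christoffel g p.2.2 X.2.2 v) := fun v => by
    rw [hK.covDerivVec_J hU hx (hc v), covDerivVec_const]
  have d5 : ∀ v, covDerivVec g (fun y => A y v) p.2.2 X.2.2 = _ := fun v =>
    covDerivVec_end hAd (hc v) X.2.2
  have hT : fderiv ℝ τ p.2.2 Y.2.2 X.2.2 = fderiv ℝ τ p.2.2 X.2.2 Y.2.2
      + 2 * g p.2.2 (J p.2.2 X.2.2) Y.2.2 := by
    have := hdτ _ hx X.2.2 Y.2.2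
    simp only [extDerivOne, kahlerForm] at this
    linarith
  have hT' : fderiv ℝ τ p.2.2 Z.2.2 X.2.2 = fderiv ℝ τ p.2.2 X.2.2 Z.2.2
      + 2 * g p.2.2 (J p.2.2 X.2.2) Z.2.2 := by
    have := hdτ _ hx X.2.2 Z.2.2
    simp only [extDerivOne, kahlerForm] at this
    linarith
  rw [h1.fderiv, hγ, hδ, coneForm_apply, coneForm_apply, hγ1, hγ2, hγ3, hδ1, hδ2, hδ3, hT, hT']
  simp only [d1, d2, d3, d4, d5, covDerivVec_const, hτ', projE, dr, add_apply, sub_apply, smul_apply,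
    neg_apply, ContinuousLinearMap.comp_apply, ContinuousLinearMap.coe_fst',
    ContinuousLinearMap.coe_snd', smul_eq_mul, hE.cov_L _ hx, hE.d_μ _ hx, hE.sol.main _ hx]
  -- Symmetries that bring every pairing to one standard order, after which the claim is a
  -- polynomial identity.
  have hsy : ∀ u v, g p.2.2 u v = g p.2.2 v u ∧ g p.2.2 u (J p.2.2 v) = -g p.2.2 v (J p.2.2 u) ∧
      g p.2.2 u (A p.2.2 v) = g p.2.2 v (A p.2.2 u) ∧
      g p.2.2 u (J p.2.2 (A p.2.2 v)) = -g p.2.2 v (J p.2.2 (A p.2.2 u)) := by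
    intro u v
    refine ⟨hg.symm _ hx u v, ?_, ?_, ?_⟩
    · rw [← hK.inner_J_left hx, hg.symm _ hx]
    · rw [← hE.sol.hermitian.symm _ hx, hg.symm _ hx]
    · rw [← hE.sol.hermitian.comm _ hx, ← hE.sol.hermitian.symm _ hx, ← hK.inner_J_left hx,
        hg.symm _ hx]
  simp only [Pi.mul_apply, Pi.add_apply, map_add, map_neg, map_smul, add_apply, smul_apply,
    smul_eq_mul, hK.inner_J_left hx, hE.sol.hermitian.symm _ hx, hE.sol.hermitian.comm _ hx,
    hK.J_sq _ hx, hsy Y.2.2 X.2.2, hsy (christoffel g p.2.2 X.2.2 Y.2.2)]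
  field_simp
  ring

end ConeEnd

/-! ### Derivatives of elementary symmetric functions -/

section SymmetricFunctions

variable {ℓ : ℕ}

lemma sigma_eq_sum (ξ : Fin ℓ → ℝ) (r : ℕ) :
    sigma ξ r = ∑ t ∈ Finset.univ.powersetCard r, ∏ i ∈ t, ξ i :=
  Finset.esymm_map_val _ _ _

lemma sigmaHat_eq_sum (ξ : Fin ℓ → ℝ) (j : Fin ℓ) (r : ℕ) :
    sigmaHat ξ j r = ∑ t ∈ (Finset.univ.erase j).powersetCard r, ∏ i ∈ t, ξ i :=
  Finset.esymm_map_val _ _ _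

/-- `∂σ_{r+1}/∂ξ_j = σ_r(ξ̂_j)`: subsets of size `r + 1` containing `j` correspond to subsets of
size `r` avoiding `j`. This is what turns `∑ dσ_r ∧ θ_r` into `∑ dξ_j ∧ ϑ_j`. -/
lemma hasFDerivAt_sigma {E : Type*} [NormedAddCommGroup E] [NormedSpace ℝ E]
    {ξ : Fin ℓ → E → ℝ} {ξ' : Fin ℓ → E →L[ℝ] ℝ} {x : E}
    (h : ∀ j, HasFDerivAt (ξ j) (ξ' j) x) (r : ℕ) :
    HasFDerivAt (fun y => sigma (fun j => ξ j y) (r + 1))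
      (∑ j, sigmaHat (fun j => ξ j x) j r • ξ' j) x := by
  simp only [sigma_eq_sum, sigmaHat_eq_sum]
  have h1 : HasFDerivAt (fun y => ∑ t ∈ (Finset.univ : Finset (Fin ℓ)).powersetCard (r + 1),
      ∏ i ∈ t, ξ i y) (∑ t ∈ (Finset.univ : Finset (Fin ℓ)).powersetCard (r + 1),
        ∑ i ∈ t, (∏ k ∈ t.erase i, ξ k x) • ξ' i) x :=
    HasFDerivAt.fun_sum fun t _ => HasFDerivAt.finsetProd fun i _ => h i
  convert h1 using 1
  rw [Finset.sum_comm' (t' := Finset.univ)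
    (s' := fun i => ((Finset.univ : Finset (Fin ℓ)).powersetCard (r + 1)).filter (i ∈ ·))
    (by simp)]
  refine Finset.sum_congr rfl fun j _ => ?_
  rw [← Finset.sum_smul]
  congr 1
  refine Finset.sum_bij' (fun s _ => insert j s) (fun t _ => t.erase j) ?_ ?_ ?_ ?_ ?_
  · intro s hs
    rw [Finset.mem_powersetCard] at hs
    have hj : j ∉ s := fun hj => by simpa using hs.1 hj
    simp [Finset.mem_powersetCard, hs.2, hj]
  · intro t ht
    simp only [Finset.mem_filter, Finset.mem_powersetCard] at ht
    rw [Finset.mem_powersetCard, Finset.card_erase_of_mem ht.2, ht.1.2]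
    exact ⟨Finset.erase_subset_erase _ ht.1.1, rfl⟩
  · intro s hs
    rw [Finset.mem_powersetCard] at hs
    exact Finset.erase_insert fun hj => by simpa using hs.1 hj
  · intro t ht
    simp only [Finset.mem_filter] at ht
    exact Finset.insert_erase ht.2
  · intro s hs
    rw [Finset.mem_powersetCard] at hs
    rw [Finset.erase_insert fun hj => by simpa using hs.1 hj]

lemma Delta_ne_zero {ξ : Fin ℓ → ℝ} (h : Function.Injective ξ) (j : Fin ℓ) : Delta ξ j ≠ 0 :=
  Finset.prod_ne_zero_iff.2 fun _ hk => sub_ne_zero.2 fun he => (Finset.mem_erase.1 hk).1 (h he).symm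

end SymmetricFunctions

/-! ### Linear algebra of the normal form: coframe, vertical vectors, gradients -/

namespace NormalFormData

variable {E : Type*} [NormedAddCommGroup E] [NormedSpace ℝ E] [FiniteDimensional ℝ E] {ℓ k : ℕ}
  {N : NormalFormData E ℓ k} {U : Set E} {g : BilinField E} {J A : EndField E} {x : E}

/-- The target of the adapted coframe. -/
abbrev Model (N : NormalFormData E ℓ k) : Type :=
  (Fin ℓ → ℝ) × (Fin ℓ → ℝ) × (∀ i : Fin k, EuclideanSpace ℝ (Fin (2 * N.mult i)))

/-- The adapted coframe `(dξ_j, ϑ_j, d pr_i)`. -/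
def coframe (N : NormalFormData E ℓ k) (x : E) : E →L[ℝ] N.Model :=
  (ContinuousLinearMap.pi fun j => fderiv ℝ (N.ξ j) x).prod
    ((ContinuousLinearMap.pi fun j => N.fibreForm j x).prod
      (ContinuousLinearMap.pi fun i => fderiv ℝ (N.pr i) x))

lemma coframe_apply (x X : E) : N.coframe x X =
    (fun j => fderiv ℝ (N.ξ j) x X, fun j => N.fibreForm j x X, fun i => fderiv ℝ (N.pr i) x X) :=
  rfl

lemma baseMetric_of_eq_zero {i : Fin k} {X Y : E} (h : fderiv ℝ (N.pr i) x X = 0) :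
    N.baseMetric i x X Y = 0 := by
  simp [baseMetric, h]

lemma baseForm_of_eq_zero {i : Fin k} {X Y : E} (h : fderiv ℝ (N.pr i) x X = 0) :
    N.baseForm i x X Y = 0 := by
  simp [baseForm, kahlerForm, h]

namespace IsNormalFormOn

variable (hN : N.IsNormalFormOn U g J A)
include hN

lemma contDiffAt_ξ (hU : IsOpen U) (hx : x ∈ U) (j : Fin ℓ) : ContDiffAt ℝ ∞ (N.ξ j) x :=
  (hN.smooth_ξ j).contDiffAt (hU.mem_nhds hx)

/-- Every summand of `g` in the normal form factors through the coframe, so a vector in its kernel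
has norm zero. -/
lemma coframe_injective (hg : IsRiemannianOn U g) (hx : x ∈ U) :
    Function.Injective (N.coframe x) := by
  rw [injective_iff_map_eq_zero]
  intro X h
  rw [coframe_apply, Prod.mk_eq_zero, Prod.mk_eq_zero] at h
  have h1 : ∀ j, fderiv ℝ (N.ξ j) x X = 0 := fun j => congrFun h.1 j
  have h2 : ∀ j, N.fibreForm j x X = 0 := fun j => congrFun h.2.1 j
  have h3 : ∀ i, fderiv ℝ (N.pr i) x X = 0 := fun i => congrFun h.2.2 i
  by_contra hX
  have := hg.pos x hx X hX
  rw [hN.metric_eq x hx] at this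
  simp [h1, h2, baseMetric_of_eq_zero (h3 _)] at this

lemma exists_coframe_equiv (hg : IsRiemannianOn U g) (hx : x ∈ U) :
    ∃ e : E ≃L[ℝ] N.Model, (e : E →L[ℝ] N.Model) = N.coframe x := by
  have hd : Module.finrank ℝ E = Module.finrank ℝ N.Model := by
    rw [hN.finrank_eq]
    simp [Model, Module.finrank_prod, Module.finrank_pi_fintype, ← Finset.mul_sum]
    ring
  refine ⟨(LinearEquiv.ofInjectiveOfFinrankEq (N.coframe x : E →ₗ[ℝ] N.Model)
    (hN.coframe_injective hg hx) hd).toContinuousLinearEquiv, ?_⟩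
  ext1 X
  rfl

lemma coframe_inverse (hg : IsRiemannianOn U g) (hx : x ∈ U) (w : N.Model) :
    N.coframe x ((N.coframe x).inverse w) = w := by
  obtain ⟨e, he⟩ := hN.exists_coframe_equiv hg hx
  rw [← he, ContinuousLinearMap.inverse_equiv]
  simp

lemma inverse_coframe (hg : IsRiemannianOn U g) (hx : x ∈ U) (X : E) :
    (N.coframe x).inverse (N.coframe x X) = X := by
  obtain ⟨e, he⟩ := hN.exists_coframe_equiv hg hx
  rw [← he, ContinuousLinearMap.inverse_equiv]
  simp

lemma contDiffAt_coframe (hU : IsOpen U) (hx : x ∈ U) : ContDiffAt ℝ ∞ N.coframe x := by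
  have hs : ∀ j r, ContDiffOn ℝ ∞ (fun y => sigmaHat (N.xi y) j r) U := by
    intro j r
    simp only [sigmaHat_eq_sum]
    exact ContDiffOn.sum fun t _ => contDiffOn_prod fun i _ => hN.smooth_ξ i
  have hf : ∀ j, ContDiffOn ℝ ∞ (N.fibreForm j) U := by
    intro j
    unfold fibreForm
    exact ContDiffOn.sum fun r _ => (hs j r).smul (hN.smooth_θ r)
  have h : ContDiffOn ℝ ∞ N.coframe U := by
    rw [contDiffOn_clm_apply]
    intro X
    exact (contDiffOn_pi.2 fun j => ((hN.smooth_ξ j).fderiv_of_isOpen hU (by simp)).clm_apply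
      contDiffOn_const).prodMk
      ((contDiffOn_pi.2 fun j => (hf j).clm_apply contDiffOn_const).prodMk
      (contDiffOn_pi.2 fun i => ((hN.smooth_pr i).fderiv_of_isOpen hU (by simp)).clm_apply
        contDiffOn_const))
  exact h.contDiffAt (hU.mem_nhds hx)

lemma contDiffAt_coframe_inverse (hg : IsRiemannianOn U g) (hU : IsOpen U) (hx : x ∈ U)
    (w : N.Model) : ContDiffAt ℝ ∞ (fun y => (N.coframe y).inverse w) x := by
  obtain ⟨e, he⟩ := hN.exists_coframe_equiv hg hx
  have h := contDiffAt_map_inverse (n := ∞) (𝕜 := ℝ) e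
  rw [he] at h
  exact (h.comp x (hN.contDiffAt_coframe hU hx)).clm_apply contDiffAt_const

lemma ratio_ne_zero (hx : x ∈ U) (j : Fin ℓ) : N.Θ j (N.ξ j x) / Delta (N.xi x) j ≠ 0 :=
  div_ne_zero (hN.Θ_ne_zero j x hx) (Delta_ne_zero (hN.ξ_injective x hx) j)

lemma fibreForm_J (hK : IsKahlerOn U g J) (hx : x ∈ U) (j : Fin ℓ) (X : E) :
    N.Θ j (N.ξ j x) / Delta (N.xi x) j * N.fibreForm j x (J x X) = fderiv ℝ (N.ξ j) x X := by
  rw [← hN.J_dξ x hx, hK.J_sq x hx, map_neg, neg_neg]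

lemma sum_wedge (hU : IsOpen U) (hx : x ∈ U) (X Y : E) :
    ∑ r : Fin ℓ, wedge (fderiv ℝ (fun y => sigma (N.xi y) (r + 1)) x) (N.θ r x) X Y =
      ∑ j, wedge (fderiv ℝ (N.ξ j) x) (N.fibreForm j x) X Y := by
  have h : ∀ r : ℕ, fderiv ℝ (fun y => sigma (N.xi y) (r + 1)) x =
      ∑ j, sigmaHat (N.xi x) j r • fderiv ℝ (N.ξ j) x := fun r =>
    (hasFDerivAt_sigma (fun j =>
      ((hN.contDiffAt_ξ hU hx j).differentiableAt (by simp)).hasFDerivAt) r).fderiv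
  simp only [h, wedge, fibreForm, sum_apply, smul_apply, smul_eq_mul, Finset.sum_mul,
    Finset.mul_sum, ← Finset.sum_sub_distrib]
  rw [Finset.sum_comm]
  exact Finset.sum_congr rfl fun _ _ => Finset.sum_congr rfl fun _ _ => by ring

end IsNormalFormOn

/-- The tangent vectors to the `i`th base. -/
structure Vertical (N : NormalFormData E ℓ k) (x : E) (i : Fin k) (X : E) : Prop where
  dξ : ∀ j, fderiv ℝ (N.ξ j) x X = 0
  fibre : ∀ j, N.fibreForm j x X = 0
  dpr : ∀ i', i' ≠ i → fderiv ℝ (N.pr i') x X = 0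

namespace IsNormalFormOn

variable (hN : N.IsNormalFormOn U g J A)
include hN

lemma metric_vertical (hx : x ∈ U) {i : Fin k} {X : E}
    (hX : N.Vertical x i X) (Y : E) : g x X Y = pnc (N.xi x) (N.η i) * N.baseMetric i x X Y := by
  rw [hN.metric_eq x hx, Finset.sum_eq_single i
    (fun i' _ hi' => by rw [baseMetric_of_eq_zero (hX.dpr i' hi'), mul_zero]) (by simp)]
  simp [hX.dξ, hX.fibre]

/-- Used to separate the constants `η_i` from the values `ξ_j x`. -/
lemma pnc_ne_zero (hg : IsRiemannianOn U g) (hx : x ∈ U) {i : Fin k} {X : E} (hX : N.Vertical x i X)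
    (h0 : X ≠ 0) : pnc (N.xi x) (N.η i) ≠ 0 := by
  have := (hg.pos x hx X h0).ne'
  rw [hN.metric_vertical hx hX] at this
  exact left_ne_zero_of_mul this

/-- On vertical vectors only the `i`th base summands of `φ` and `ω` survive, and there `φ = η_i ω`.
-/
lemma end_vertical (hK : IsKahlerOn U g J) (hU : IsOpen U) (hx : x ∈ U) {i : Fin k} {X : E}
    (hX : N.Vertical x i X) : A x X = N.η i • X := by
  have hz : ∀ (f : Fin k → ℝ) (Y : E), ∑ i', f i' * N.baseForm i' x X Y = f i * N.baseForm i x X Y :=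
    fun f Y => Finset.sum_eq_single i
      (fun i' _ hi' => by rw [baseForm_of_eq_zero (hX.dpr i' hi'), mul_zero]) (by simp)
  refine hK.riemannian.ext hx fun Y => ?_
  rw [hN.hamiltonian_eq x hx, map_smul, smul_apply, smul_eq_mul, ← hK.hermitian x hx X Y]
  have h := hN.kahlerForm_eq x hx X (J x Y)
  rw [kahlerForm, hN.sum_wedge hU hx] at h
  rw [h, hz (fun i => N.η i * pnc (N.xi x) (N.η i)), hz]
  simp [wedge, hX.dξ, hX.fibre]
  ring

lemma exists_vertical_section (hg : IsRiemannianOn U g) (hU : IsOpen U) (hx : x ∈ U) {i : Fin k}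
    {X : E} (hX : N.Vertical x i X) : ∃ Y : E → E, ContDiffAt ℝ ∞ Y x ∧ Y x = X ∧
      ∀ y ∈ U, N.Vertical y i (Y y) := by
  -- The extension with constant components in the coframe.
  refine ⟨fun y => (N.coframe y).inverse (N.coframe x X),
    hN.contDiffAt_coframe_inverse hg hU hx _, hN.inverse_coframe hg hx X, fun y hy => ?_⟩
  have h := hN.coframe_inverse hg hy (N.coframe x X)
  rw [coframe_apply, coframe_apply, Prod.mk.injEq, Prod.mk.injEq] at h
  exact ⟨fun j => (congrFun h.1 j).trans (hX.dξ j), fun j => (congrFun h.2.1 j).trans (hX.fibre j),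
    fun i' hi' => (congrFun h.2.2 i').trans (hX.dpr i' hi')⟩

lemma vertical_inverse (hg : IsRiemannianOn U g) (hx : x ∈ U) (i : Fin k)
    (u : EuclideanSpace ℝ (Fin (2 * N.mult i))) :
    N.Vertical x i ((N.coframe x).inverse (0, 0, Pi.single i u)) := by
  have h := hN.coframe_inverse hg hx (0, 0, Pi.single i u)
  rw [coframe_apply, Prod.mk.injEq, Prod.mk.injEq] at h
  exact ⟨fun j => congrFun h.1 j, fun j => congrFun h.2.1 j,
    fun i' hi' => (congrFun h.2.2 i').trans (by exact Pi.single_eq_of_ne hi' _)⟩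

lemma exists_vertical_ne_zero (hg : IsRiemannianOn U g) (hx : x ∈ U) (i : Fin k) :
    ∃ X, N.Vertical x i X ∧ X ≠ 0 := by
  have hm := hN.mult_pos i
  have : Nontrivial (EuclideanSpace ℝ (Fin (2 * N.mult i))) :=
    Module.nontrivial_of_finrank_pos (R := ℝ) (by simpa using hm)
  obtain ⟨u, hu⟩ := exists_ne (0 : EuclideanSpace ℝ (Fin (2 * N.mult i)))
  refine ⟨_, hN.vertical_inverse hg hx i u, fun h0 => hu ?_⟩
  have h := hN.coframe_inverse hg hx (0, 0, Pi.single i u)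
  rw [h0, map_zero, eq_comm, Prod.mk_eq_zero, Prod.mk_eq_zero] at h
  simpa using congrFun h.2.2 i

/-- Since `dξ_j ∘ J` is a nonzero multiple of `ϑ_j`, the first two conditions leave only base
components, so `Z` is a sum of vertical vectors and is orthogonal to itself. -/
lemma eq_zero_of_orthogonal (hK : IsKahlerOn U g J) (hx : x ∈ U) {Z : E}
    (h1 : ∀ j, fderiv ℝ (N.ξ j) x Z = 0) (h2 : ∀ j, fderiv ℝ (N.ξ j) x (J x Z) = 0)
    (h3 : ∀ i X, N.Vertical x i X → g x Z X = 0) : Z = 0 := by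
  have hg := hK.riemannian
  have h4 : ∀ j, N.fibreForm j x Z = 0 := fun j => by
    have := hN.J_dξ x hx j Z
    rw [h2, neg_zero, eq_comm] at this
    exact (mul_eq_zero.1 this).resolve_left (hN.ratio_ne_zero hx j)
  have h5 : Z = ∑ i, (N.coframe x).inverse (0, 0, Pi.single i (fderiv ℝ (N.pr i) x Z)) := by
    apply hN.coframe_injective hg hx
    simp only [map_sum, hN.coframe_inverse hg hx]
    rw [coframe_apply]
    refine Prod.ext ?_ (Prod.ext ?_ ?_)
    · ext j
      simp [Prod.fst_sum, h1]
    · ext j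
      simp [Prod.fst_sum, Prod.snd_sum, h4]
    · simp only [Prod.snd_sum]
      exact (Finset.univ_sum_single _).symm
  by_contra h0
  apply (hg.pos x hx Z h0).ne'
  nth_rw 2 [h5]
  rw [map_sum]
  exact Finset.sum_eq_zero fun i _ => h3 i _ (hN.vertical_inverse hg hx i _)

end IsNormalFormOn

/-- The gradient of `ξ_j`. -/
def grad (N : NormalFormData E ℓ k) (g : BilinField E) (j : Fin ℓ) (x : E) : E :=
  (g x).inverse (fderiv ℝ (N.ξ j) x)

namespace IsNormalFormOn

variable (hN : N.IsNormalFormOn U g J A)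
include hN

omit hN in
lemma metric_grad (hg : IsRiemannianOn U g) (hx : x ∈ U) (j : Fin ℓ) (X : E) :
    g x (N.grad g j x) X = fderiv ℝ (N.ξ j) x X := by
  rw [grad, hg.apply_inverse hx]

lemma contDiffAt_grad (hg : IsRiemannianOn U g) (hU : IsOpen U) (hx : x ∈ U) (j : Fin ℓ) :
    ContDiffAt ℝ ∞ (N.grad g j) x :=
  (hg.contDiffAt_inverse hU hx).clm_apply
    ((hN.contDiffAt_ξ hU hx j).fderiv_right (m := ∞) (by simp))

/-- The metric is diagonal in the `dξ_j`, with no cross terms with the rest of the coframe, so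
raising the index of `dξ_j` inverts the single coefficient `Δ_j / Θ_j`. -/
lemma coframe_grad (hg : IsRiemannianOn U g) (hx : x ∈ U) (j : Fin ℓ) :
    N.coframe x (N.grad g j x) =
      (Pi.single j (N.Θ j (N.ξ j x) / Delta (N.xi x) j), 0, 0) := by
  set w : N.Model := (Pi.single j (N.Θ j (N.ξ j x) / Delta (N.xi x) j), 0, 0) with hw
  have h := hN.coframe_inverse hg hx w
  have h' := h
  rw [coframe_apply, hw, Prod.mk.injEq, Prod.mk.injEq] at h'
  rw [← h]
  congr 1
  refine hg.ext hx fun Y => ?_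
  rw [metric_grad hg hx, hN.metric_eq x hx]
  have h1 : ∀ k, fderiv ℝ (N.ξ k) x ((N.coframe x).inverse w) = _ := fun k => congrFun h'.1 k
  have h2 : ∀ k, N.fibreForm k x ((N.coframe x).inverse w) = 0 := fun k => congrFun h'.2.1 k
  have h3 : ∀ i, fderiv ℝ (N.pr i) x ((N.coframe x).inverse w) = 0 := fun k => congrFun h'.2.2 k
  have hr := hN.ratio_ne_zero hx j
  simp only [h2, baseMetric_of_eq_zero (h3 _), h1]
  rw [Finset.sum_eq_single j (fun k _ hk => by rw [Pi.single_eq_of_ne hk]; ring) (by simp)]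
  have := div_ne_zero_iff.1 hr
  have h5 := this.1
  have h6 := this.2
  simp
  field_simp

lemma dξ_grad (hg : IsRiemannianOn U g) (hx : x ∈ U) (i j : Fin ℓ) :
    fderiv ℝ (N.ξ i) x (N.grad g j x) =
      if i = j then N.Θ j (N.ξ j x) / Delta (N.xi x) j else 0 := by
  have h := congrFun (congrArg Prod.fst (hN.coframe_grad hg hx j)) i
  exact h.trans (Pi.single_apply j _ i)

lemma fibreForm_grad (hg : IsRiemannianOn U g) (hx : x ∈ U) (i j : Fin ℓ) :
    N.fibreForm i x (N.grad g j x) = 0 :=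
  congrFun (congrArg (fun w => w.2.1) (hN.coframe_grad hg hx j)) i

lemma dpr_grad (hg : IsRiemannianOn U g) (hx : x ∈ U) (i : Fin k) (j : Fin ℓ) :
    fderiv ℝ (N.pr i) x (N.grad g j x) = 0 :=
  congrFun (congrArg (fun w => w.2.2) (hN.coframe_grad hg hx j)) i

lemma dξ_J_grad (hg : IsRiemannianOn U g) (hx : x ∈ U) (i j : Fin ℓ) :
    fderiv ℝ (N.ξ i) x (J x (N.grad g j x)) = 0 := by
  have := hN.J_dξ x hx i (N.grad g j x)
  rw [hN.fibreForm_grad hg hx, mul_zero] at this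
  linarith

lemma end_grad (hK : IsKahlerOn U g J) (hx : x ∈ U) (j : Fin ℓ) :
    A x (N.grad g j x) = N.ξ j x • N.grad g j x := by
  have hg := hK.riemannian
  refine hg.ext hx fun Y => ?_
  rw [hN.hamiltonian_eq x hx, map_smul, smul_apply, smul_eq_mul, metric_grad hg hx]
  simp only [baseForm_of_eq_zero (hN.dpr_grad hg hx _ j), wedge, hN.dξ_grad hg hx,
    hN.fibreForm_grad hg hx]
  rw [← hN.fibreForm_J hK hx j Y]
  simp

lemma grad_ne_zero (hg : IsRiemannianOn U g) (hx : x ∈ U) (j : Fin ℓ) : N.grad g j x ≠ 0 := by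
  intro h
  have := hN.dξ_grad hg hx j j
  rw [h, map_zero, if_pos rfl] at this
  exact hN.ratio_ne_zero hx j this.symm

end IsNormalFormOn

end NormalFormData

/-! ### Characteristic polynomials of bordered diagonal matrices -/

section ArrowPolynomial

open Polynomial

variable {K : Type*} [Field K] {ℓ : ℕ}

/-- The characteristic polynomial of the bordered diagonal matrix with diagonal `m, ξ_1, …, ξ_ℓ`,
in terms of the squares `a_j` of the off-diagonal entries. -/
def arrowPoly (m : K) (ξ a : Fin ℓ → K) : K[X] :=
  (X - C m) * ∏ i, (X - C (ξ i)) - ∑ j, C (a j) * ∏ i ∈ Finset.univ.erase j, (X - C (ξ i))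

lemma eval_arrowPoly (m : K) (ξ a : Fin ℓ → K) (c : K) : (arrowPoly m ξ a).eval c =
    (c - m) * ∏ i, (c - ξ i) - ∑ j, a j * ∏ i ∈ Finset.univ.erase j, (c - ξ i) := by
  simp [arrowPoly, eval_prod, eval_finsetSum]

lemma map_arrowPoly {K' : Type*} [Field K'] (f : K →+* K') (m : K) (ξ a : Fin ℓ → K) :
    (arrowPoly m ξ a).map f = arrowPoly (f m) (fun i => f (ξ i)) (fun i => f (a i)) := by
  simp [arrowPoly, Polynomial.map_prod, Polynomial.map_sum]

lemma eval_arrowPoly_of_ne (m : K) (ξ a : Fin ℓ → K) {c : K} (hc : ∀ i, c ≠ ξ i) :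
    (arrowPoly m ξ a).eval c = (c - m - ∑ j, a j / (c - ξ j)) * ∏ i, (c - ξ i) := by
  rw [eval_arrowPoly, sub_mul _ (∑ j, _), Finset.sum_mul]
  congr 1
  refine Finset.sum_congr rfl fun j _ => ?_
  rw [← Finset.mul_prod_erase _ _ (Finset.mem_univ j), ← mul_assoc,
    div_mul_cancel₀ _ (sub_ne_zero.2 (hc j))]

lemma arrowPoly_isRoot_iff (m : K) (ξ a : Fin ℓ → K) {c : K} (hc : ∀ i, c ≠ ξ i) :
    (arrowPoly m ξ a).eval c = 0 ↔ c - m - ∑ j, a j / (c - ξ j) = 0 := by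
  rw [eval_arrowPoly_of_ne m ξ a hc, mul_eq_zero, or_iff_left]
  exact Finset.prod_ne_zero_iff.2 fun i _ => sub_ne_zero.2 (hc i)

lemma eval_arrowPoly_self (m : K) (ξ a : Fin ℓ → K) (j : Fin ℓ) :
    (arrowPoly m ξ a).eval (ξ j) = -(a j * ∏ i ∈ Finset.univ.erase j, (ξ j - ξ i)) := by
  rw [eval_arrowPoly, Finset.prod_eq_zero (Finset.mem_univ j) (sub_self _), mul_zero, zero_sub,
    Finset.sum_eq_single j _ (by simp)]
  intro i _ hi
  rw [Finset.prod_eq_zero (Finset.mem_erase.2 ⟨hi.symm, Finset.mem_univ j⟩) (sub_self _), mul_zero]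

lemma arrowPoly_root_ne {m : K} {ξ a : Fin ℓ → K} (hξ : Function.Injective ξ) (ha : ∀ j, a j ≠ 0)
    {c : K} (hc : (arrowPoly m ξ a).eval c = 0) (j : Fin ℓ) : c ≠ ξ j := by
  rintro rfl
  rw [eval_arrowPoly_self, neg_eq_zero, mul_eq_zero] at hc
  refine hc.elim (ha j) (Finset.prod_ne_zero_iff.2 fun i hi => ?_)
  exact sub_ne_zero.2 fun h => (Finset.mem_erase.1 hi).1 (hξ h).symm

lemma arrowPoly_monic_natDegree (m : K) (ξ a : Fin ℓ → K) :
    (arrowPoly m ξ a).Monic ∧ (arrowPoly m ξ a).natDegree = ℓ + 1 := by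
  have h1 : ((X - C m) * ∏ i, (X - C (ξ i))).Monic :=
    (monic_X_sub_C m).mul (monic_prod_of_monic _ _ fun i _ => monic_X_sub_C _)
  have h2 : ((X - C m) * ∏ i, (X - C (ξ i))).natDegree = ℓ + 1 := by
    rw [(monic_X_sub_C m).natDegree_mul (monic_prod_of_monic _ _ fun i _ => monic_X_sub_C _),
      natDegree_X_sub_C, natDegree_prod_of_monic _ _ fun i _ => monic_X_sub_C _]
    simp [add_comm]
  have h3 : (∑ j, C (a j) * ∏ i ∈ Finset.univ.erase j, (X - C (ξ i))).degree <
      ((X - C m) * ∏ i, (X - C (ξ i))).degree := by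
    rw [degree_eq_natDegree h1.ne_zero, h2]
    refine (degree_sum_le _ _).trans_lt ((Finset.sup_lt_iff (WithBot.bot_lt_coe _)).2 fun j _ => ?_)
    have : degree (∏ i ∈ Finset.univ.erase j, (X - C (ξ i))) < (ℓ + 1 : ℕ) := ?_
    · rw [degree_mul]
      calc _ ≤ 0 + degree (∏ i ∈ Finset.univ.erase j, (X - C (ξ i))) := by gcongr; exact degree_C_le
        _ < _ := by rwa [zero_add]
    rw [degree_prod]
    simp only [degree_X_sub_C, Finset.sum_const, Finset.card_erase_of_mem (Finset.mem_univ j),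
      Finset.card_univ, Fintype.card_fin, nsmul_eq_mul, mul_one]
    exact_mod_cast (by omega : ℓ - 1 < ℓ + 1)
  exact ⟨h1.sub_of_left h3,
    (natDegree_eq_of_degree_eq (degree_sub_eq_left_of_degree_lt h3)).trans h2⟩

/-- Away from the `ξ_j` a root is a zero of `z - m - ∑ a_j / (z - ξ_j)`, whose imaginary part is `Im
z` times `1 + ∑ a_j / |z - ξ_j|² > 0`. -/
lemma arrowPoly_im_eq_zero (m : ℝ) {ξ a : Fin ℓ → ℝ} (hξ : Function.Injective ξ)
    (ha : ∀ j, 0 < a j) {z : ℂ}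
    (hz : (arrowPoly (m : ℂ) (fun i => (ξ i : ℂ)) (fun i => (a i : ℂ))).eval z = 0) :
    z.im = 0 := by
  have hne := arrowPoly_root_ne (fun i j h => hξ (Complex.ofReal_injective h))
    (fun j => Complex.ofReal_ne_zero.2 (ha j).ne') hz
  rw [arrowPoly_isRoot_iff _ _ _ hne] at hz
  have h1 := congrArg Complex.im hz
  have h2 : ∀ j, ((a j : ℂ) / (z - ξ j)).im = -(z.im * (a j / Complex.normSq (z - ξ j))) := by
    intro j
    rw [Complex.div_im]
    simp
    ring
  rw [Complex.sub_im, Complex.sub_im, Complex.im_sum] at h1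
  simp only [h2, Complex.ofReal_im, Complex.zero_im, Finset.sum_neg_distrib, ← Finset.mul_sum] at h1
  have h3 : 0 ≤ ∑ j, a j / Complex.normSq (z - ξ j) :=
    Finset.sum_nonneg fun j _ => div_nonneg (ha j).le (Complex.normSq_nonneg _)
  have h4 : z.im * (1 + ∑ j, a j / Complex.normSq (z - ξ j)) = 0 := by linarith
  exact (mul_eq_zero.1 h4).resolve_right (by positivity)

lemma arrowPoly_splits (m : ℝ) {ξ a : Fin ℓ → ℝ} (hξ : Function.Injective ξ)
    (ha : ∀ j, 0 < a j) : (arrowPoly m ξ a).Splits := by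
  refine Splits.of_splits_map Complex.ofRealHom (IsAlgClosed.splits _) fun z hz => ?_
  have h0 := (mem_roots'.1 hz).2
  rw [map_arrowPoly] at h0
  exact ⟨z.re, Complex.ext rfl (arrowPoly_im_eq_zero m hξ ha h0).symm⟩

/-- At a root the derivative is `∏ (c - ξ_i)` times that of `t - m - ∑ a_j / (t - ξ_j)`, and the
latter is `1 + ∑ a_j / (c - ξ_j)² > 0`. -/
lemma arrowPoly_derivative_ne_zero (m : ℝ) {ξ a : Fin ℓ → ℝ} (hξ : Function.Injective ξ)
    (ha : ∀ j, 0 < a j) {c : ℝ} (hc : (arrowPoly m ξ a).eval c = 0) :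
    (arrowPoly m ξ a).derivative.eval c ≠ 0 := by
  have hne := arrowPoly_root_ne hξ (fun j => (ha j).ne') hc
  have hev : (fun t => (arrowPoly m ξ a).eval t) =ᶠ[nhds c]
      fun t => (t - m - ∑ j, a j / (t - ξ j)) * ∏ i, (t - ξ i) := by
    have : ∀ᶠ t in nhds c, ∀ i, t ≠ ξ i :=
      Filter.eventually_all.2 fun i => eventually_ne_nhds (hne i)
    filter_upwards [this] with t ht using eval_arrowPoly_of_ne m ξ a ht
  have h1 : HasDerivAt (fun t => t - m - ∑ j, a j / (t - ξ j))
      (1 - ∑ j, -(a j / (c - ξ j) ^ 2)) c := by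
    refine ((hasDerivAt_id c).sub_const m).sub (HasDerivAt.fun_sum fun j _ => ?_)
    have := (hasDerivAt_const c (a j)).div ((hasDerivAt_id c).sub_const (ξ j))
      (sub_ne_zero.2 (hne j))
    refine this.congr_deriv ?_
    simp [neg_div]
  have hq : DifferentiableAt ℝ (fun t => ∏ i, (t - ξ i)) c := by fun_prop
  have h2 := ((h1.mul hq.hasDerivAt).congr_of_eventuallyEq hev).unique
    ((arrowPoly m ξ a).hasDerivAt c)
  rw [← h2, (arrowPoly_isRoot_iff m ξ a hne).1 hc, zero_mul, add_zero]
  refine mul_ne_zero ?_ (Finset.prod_ne_zero_iff.2 fun i _ => sub_ne_zero.2 (hne i))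
  rw [Finset.sum_neg_distrib, sub_neg_eq_add]
  have : 0 ≤ ∑ j, a j / (c - ξ j) ^ 2 :=
    Finset.sum_nonneg fun j _ => div_nonneg (ha j).le (sq_nonneg _)
  positivity

lemma exists_strictMono_roots_arrowPoly (m : ℝ) {ξ a : Fin ℓ → ℝ} (hξ : Function.Injective ξ)
    (ha : ∀ j, 0 < a j) : ∃ r : Fin (ℓ + 1) → ℝ, StrictMono r ∧
      (∀ c, (arrowPoly m ξ a).eval c = 0 ↔ ∃ i, r i = c) ∧
      ∀ t, (arrowPoly m ξ a).eval t = ∏ i, (t - r i) := by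
  set P := arrowPoly m ξ a with hP
  obtain ⟨hm, hd⟩ := arrowPoly_monic_natDegree m ξ a
  have hs := arrowPoly_splits m hξ ha
  have hnd : P.roots.Nodup := by
    rw [Multiset.nodup_iff_count_le_one]
    intro c
    rw [count_roots]
    by_contra! h
    obtain ⟨h1, h2⟩ := (one_lt_rootMultiplicity_iff_isRoot hm.ne_zero).1 h
    exact arrowPoly_derivative_ne_zero m hξ ha h1 h2
  have hcard : P.roots.toFinset.card = ℓ + 1 := by
    rw [Multiset.toFinset_card_of_nodup hnd, ← hd]
    exact hs.natDegree_eq_card_roots.symm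
  refine ⟨P.roots.toFinset.orderEmbOfFin hcard, (P.roots.toFinset.orderEmbOfFin hcard).strictMono,
    fun c => ?_, fun t => ?_⟩
  · have := Finset.range_orderEmbOfFin P.roots.toFinset hcard
    rw [← Set.mem_range, this]
    rw [Finset.mem_coe, Multiset.mem_toFinset, mem_roots hm.ne_zero, IsRoot]
  · have h2 : ∏ c ∈ P.roots.toFinset, (t - c) =
        ∏ i, (t - P.roots.toFinset.orderEmbOfFin hcard i) := by
      conv_lhs => rw [← Finset.image_orderEmbOfFin_univ P.roots.toFinset hcard]
      exact Finset.prod_image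
        fun i _ j _ h => (P.roots.toFinset.orderEmbOfFin hcard).injective h
    rw [← h2, hs.eval_eq_prod_roots_of_monic hm, Finset.prod, Multiset.toFinset_val, hnd.dedup]

end ArrowPolynomial

/-! ### Derivatives of eigenvalues of a solution -/

section Eigen

variable {V : Type*} [NormedAddCommGroup V] [NormedSpace ℝ V] [FiniteDimensional ℝ V]
  {U : Set V} {g : BilinField V} {J A : EndField V} {L : V → V} {x : V}

lemma covDerivEnd_of_eigenfield {c : V → ℝ} {Y : V → V} (hA : DifferentiableAt ℝ A x)
    (hc : DifferentiableAt ℝ c x) (hY : DifferentiableAt ℝ Y x)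
    (h : ∀ᶠ y in nhds x, A y (Y y) = c y • Y y) (X : V) :
    covDerivEnd g A x X (Y x) + A x (covDerivVec g Y x X) =
      fderiv ℝ c x X • Y x + c x • covDerivVec g Y x X := by
  rw [← covDerivVec_end hA hY, ← covDerivVec_smul hc hY]
  exact covDerivVec_congr h X

/-- The derivative of an eigenvalue of a solution. -/
lemma IsSolOn.fderiv_eigenvalue (hU : IsOpen U) (hA : IsSolOn U g J A L)
    (hx : x ∈ U) {c : V → ℝ} {Y : V → V} (hc : DifferentiableAt ℝ c x)
    (hY : DifferentiableAt ℝ Y x) (h : ∀ᶠ y in nhds x, A y (Y y) = c y • Y y) (X : V) :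
    fderiv ℝ c x X * g x (Y x) (Y x) = 2 * (g x X (Y x) * g x (L x) (Y x)
      + g x (J x X) (Y x) * g x (J x (L x)) (Y x)) := by
  -- Pairing with the eigenvector itself cancels the terms in `∇Y`, because `A` is symmetric.
  have h1 := congrArg (fun Z => g x Z (Y x)) (covDerivEnd_of_eigenfield (g := g)
    ((hA.contDiffAt_A hU hx).differentiableAt (by simp)) hc hY h X)
  simp only [hA.main x hx, map_add, add_apply, map_smul, smul_apply, smul_eq_mul,
    hA.hermitian.symm x hx, h.self_of_nhds] at h1
  linarith

end Eigen

/-! ### The vector field `Λ` and the constant polynomial `conePoly` -/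

namespace NormalFormData.IsNormalFormOn

variable {E : Type*} [NormedAddCommGroup E] [NormedSpace ℝ E] [FiniteDimensional ℝ E] {ℓ k : ℕ}
  {N : NormalFormData E ℓ k} {U : Set E} {g : BilinField E} {J A : EndField E} {L : E → E}
  {μ : E → ℝ} {x : E} (hN : N.IsNormalFormOn U g J A)
include hN

/-- The eigenvalue derivative formula for `grad ξ_j`, differentiated along `grad ξ_j` and along `J
grad ξ_j`. -/
lemma L_grad (hK : IsKahlerOn U g J) (hU : IsOpen U) (hA : IsSolOn U g J A L) (hx : x ∈ U)
    (j : Fin ℓ) : g x (L x) (N.grad g j x) = fderiv ℝ (N.ξ j) x (N.grad g j x) / 2 ∧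
      g x (J x (L x)) (N.grad g j x) = 0 := by
  have hg := hK.riemannian
  have key := hA.fderiv_eigenvalue hU hx
    ((hN.contDiffAt_ξ hU hx j).differentiableAt (by simp))
    ((hN.contDiffAt_grad hg hU hx j).differentiableAt (by simp))
    (by filter_upwards [hU.mem_nhds hx] with y hy using hN.end_grad hK hy j)
  have hpos := (hg.pos x hx _ (hN.grad_ne_zero hg hx j)).ne'
  rw [metric_grad hg hx] at hpos
  constructor
  · have := key (N.grad g j x)
    rw [hK.inner_J_self hx, metric_grad hg hx] at this
    have h2 : fderiv ℝ (N.ξ j) x (N.grad g j x) * (fderiv ℝ (N.ξ j) x (N.grad g j x)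
        - 2 * g x (L x) (N.grad g j x)) = 0 := by linarith
    have h3 := (mul_eq_zero.1 h2).resolve_left hpos
    linarith
  · have := key (J x (N.grad g j x))
    rw [hK.inner_J_self hx, hN.dξ_J_grad hg hx, hK.J_sq x hx, map_neg, neg_apply,
      metric_grad hg hx] at this
    have h2 : fderiv ℝ (N.ξ j) x (N.grad g j x) * g x (J x (L x)) (N.grad g j x) = 0 := by linarith
    exact (mul_eq_zero.1 h2).resolve_left hpos

/-- The eigenvalue `η_i` is constant, so the derivative formula leaves `|X|² g(Λ, X) = 0`. -/
lemma L_vertical (hK : IsKahlerOn U g J) (hU : IsOpen U) (hA : IsSolOn U g J A L) (hx : x ∈ U)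
    {i : Fin k} {X : E} (hX : N.Vertical x i X) : g x (L x) X = 0 := by
  have hg := hK.riemannian
  obtain ⟨Y, hY, rfl, hv⟩ := hN.exists_vertical_section hg hU hx hX
  have key := hA.fderiv_eigenvalue hU hx (differentiableAt_const (N.η i))
    (hY.differentiableAt (by simp))
    (by filter_upwards [hU.mem_nhds hx] with y hy using hN.end_vertical hK hU hy (hv y hy)) (Y x)
  rw [hK.inner_J_self hx] at key
  by_cases h0 : Y x = 0
  · rw [h0, map_zero]
  · have hpos := (hg.pos x hx _ h0).ne'
    simp only [fderiv_fun_const, Pi.zero_apply, zero_apply, zero_mul, add_zero] at key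
    have h2 : g x (Y x) (Y x) * g x (L x) (Y x) = 0 := by linarith
    exact (mul_eq_zero.1 h2).resolve_left hpos

lemma L_eq (hK : IsKahlerOn U g J) (hU : IsOpen U) (hA : IsSolOn U g J A L) (hx : x ∈ U) :
    L x = (1 / 2 : ℝ) • ∑ j, N.grad g j x := by
  have hg := hK.riemannian
  rw [← sub_eq_zero]
  refine hN.eq_zero_of_orthogonal hK hx (fun j => ?_) (fun j => ?_) (fun i X hX => ?_)
  · rw [map_sub, map_smul, map_sum]
    simp only [hN.dξ_grad hg hx j]
    rw [← metric_grad hg hx j, hg.symm x hx, (hN.L_grad hK hU hA hx j).1, hN.dξ_grad hg hx]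
    simp
    ring
  · rw [map_sub, map_smul, map_sum, map_sub, map_smul, map_sum]
    simp only [hN.dξ_J_grad hg hx j]
    rw [← metric_grad hg hx j, hg.symm x hx, (hN.L_grad hK hU hA hx j).2]
    simp
  · rw [map_sub, map_smul, map_sum]
    simp [sub_apply, sum_apply, hN.L_vertical hK hU hA hx hX, metric_grad hg hx, hX.dξ]

lemma metric_L (hK : IsKahlerOn U g J) (hU : IsOpen U) (hA : IsSolOn U g J A L) (hx : x ∈ U)
    (X : E) : g x (L x) X = (1 / 2) * ∑ j, fderiv ℝ (N.ξ j) x X := by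
  rw [hN.L_eq hK hU hA hx]
  simp [sum_apply, metric_grad hK.riemannian hx]

/-- `Λ` is the gradient of `½ ∑ ξ_j`, so `∇Λ` is a Hessian. -/
lemma covDeriv_L_symm (hK : IsKahlerOn U g J) (hU : IsOpen U) (hA : IsSolOn U g J A L) (hx : x ∈ U)
    (X Y : E) : g x (covDerivVec g L x X) Y = g x X (covDerivVec g L x Y) := by
  have hg := hK.riemannian
  set f : E → ℝ := fun y => (1 / 2) * ∑ j, N.ξ j y with hf
  have hfs : ∀ y ∈ U, ContDiffAt ℝ ∞ f y := fun y hy =>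
    contDiffAt_const.mul (ContDiffAt.sum fun j _ => hN.contDiffAt_ξ hU hy j)
  have hfd : ∀ y ∈ U, ∀ Y, fderiv ℝ f y Y = g y (L y) Y := by
    intro y hy Y
    have hd : ∀ j ∈ Finset.univ, DifferentiableAt ℝ (N.ξ j) y := fun j _ =>
      (hN.contDiffAt_ξ hU hy j).differentiableAt (by simp)
    rw [hN.metric_L hK hU hA hy, hf, fderiv_const_mul (DifferentiableAt.fun_sum hd),
      fderiv_fun_sum hd]
    simp [sum_apply]
  have hd2 : DifferentiableAt ℝ (fderiv ℝ f) x :=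
    ((hfs x hx).fderiv_right (m := ∞) (by simp)).differentiableAt (by simp)
  have key : ∀ X Y, fderiv ℝ (fderiv ℝ f) x X Y =
      g x (covDerivVec g L x X) Y + g x (L x) (christoffel g x X Y) := by
    intro X Y
    rw [← covDerivVec_const (g := g), ← fderiv_metric hg hU hx
      ((hA.contDiffAt_L hU hx).differentiableAt (by simp)) (differentiableAt_const Y)]
    have h1 : (fun y => g y (L y) Y) =ᶠ[nhds x] fun y => fderiv ℝ f y Y := by
      filter_upwards [hU.mem_nhds hx] with y hy using (hfd y hy Y).symm
    rw [h1.fderiv_eq, fderiv_clm_apply hd2 (differentiableAt_const _)]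
    simp
  have hs := ((hfs x hx).isSymmSndFDerivAt two_le_smooth).eq X Y
  rw [key, key, christoffel_comm hg hU hx Y X] at hs
  rw [hg.symm x hx X]
  linarith

omit hN in
/-- The squared norms of the components of `Λ` in the eigenspaces of the `ξ_j`. -/
def weight (N : NormalFormData E ℓ k) (g : BilinField E) (x : E) (j : Fin ℓ) : ℝ :=
  fderiv ℝ (N.ξ j) x (N.grad g j x) / 4

lemma weight_pos (hg : IsRiemannianOn U g) (hx : x ∈ U) (j : Fin ℓ) : 0 < weight N g x j := by
  have := hg.pos x hx _ (hN.grad_ne_zero hg hx j)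
  rw [metric_grad hg hx] at this
  unfold weight
  positivity

omit hN in
/-- The polynomial whose roots are the eigenvalues of the endomorphism of the cone. -/
def conePoly (N : NormalFormData E ℓ k) (g : BilinField E) (μ : E → ℝ) (x : E) : Polynomial ℝ :=
  arrowPoly (μ x) (N.xi x) (weight N g x)

lemma eval_conePoly_ξ (hg : IsRiemannianOn U g) (hx : x ∈ U) (j : Fin ℓ) :
    (conePoly N g μ x).eval (N.ξ j x) = -(N.Θ j (N.ξ j x) / 4) := by
  have h := eval_arrowPoly_self (μ x) (N.xi x) (weight N g x) j
  have hΔ := Delta_ne_zero (hN.ξ_injective x hx) j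
  change (arrowPoly (μ x) (N.xi x) (weight N g x)).eval (N.xi x j) = _
  rw [h, weight, hN.dξ_grad hg hx, if_pos rfl]
  change -(_ * Delta (N.xi x) j) = _
  field_simp

/-- The resolvent field `(c - A)⁻¹ Λ`. -/
def resolvent (N : NormalFormData E ℓ k) (g : BilinField E) (c : ℝ) (y : E) : E :=
  -- The factor 2 reflects `Λ = ½ ∑ grad ξ_j`.
  ∑ j, (2 * (c - N.ξ j y))⁻¹ • N.grad g j y

lemma resolvent_spec (hK : IsKahlerOn U g J) (hU : IsOpen U) (hA : IsSolOn U g J A L) (hx : x ∈ U)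
    {c : ℝ} (hc : ∀ j, c ≠ N.ξ j x) :
    c • resolvent N g c x - A x (resolvent N g c x) = L x := by
  rw [hN.L_eq hK hU hA hx, resolvent, map_sum, Finset.smul_sum, Finset.smul_sum,
    ← Finset.sum_sub_distrib]
  refine Finset.sum_congr rfl fun j _ => ?_
  rw [map_smul, hN.end_grad hK hx, smul_smul, smul_smul, ← sub_smul]
  congr 1
  have := sub_ne_zero.2 (hc j)
  field_simp

lemma metric_L_resolvent (hK : IsKahlerOn U g J) (hU : IsOpen U) (hA : IsSolOn U g J A L)
    (hx : x ∈ U) (c : ℝ) :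
    g x (L x) (resolvent N g c x) = ∑ j, weight N g x j / (c - N.ξ j x) := by
  rw [resolvent, map_sum]
  refine Finset.sum_congr rfl fun j _ => ?_
  rw [map_smul, (hN.L_grad hK hU hA hx j).1, weight, smul_eq_mul, mul_inv]
  ring

lemma metric_JL_resolvent (hK : IsKahlerOn U g J) (hU : IsOpen U) (hA : IsSolOn U g J A L)
    (hx : x ∈ U) (c : ℝ) : g x (J x (L x)) (resolvent N g c x) = 0 := by
  rw [resolvent, map_sum]
  refine Finset.sum_eq_zero fun j _ => ?_
  rw [map_smul, (hN.L_grad hK hU hA hx j).2, smul_zero]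

lemma eval_conePoly_of_ne (hK : IsKahlerOn U g J) (hU : IsOpen U) (hA : IsSolOn U g J A L)
    (hx : x ∈ U) {c : ℝ} (hc : ∀ j, c ≠ N.ξ j x) : (conePoly N g μ x).eval c =
      (c - μ x - g x (L x) (resolvent N g c x)) * ∏ j, (c - N.ξ j x) := by
  rw [hN.metric_L_resolvent hK hU hA hx]
  exact eval_arrowPoly_of_ne _ _ _ hc

/-- With `u = (c - A)⁻¹ Λ` and `F = c - μ - g(Λ, u)`, the polynomial at `c` is `F ∏ (c - ξ_j)`. The
extended system gives `dF = 2 F u♭`, while the logarithmic derivative of the product is `-2 u♭`; the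
two cancel. -/
lemma fderiv_conePoly_of_ne (hK : IsKahlerOn U g J) (hU : IsOpen U)
    (hE : IsExtSolOn U g J (-1) A L μ) (hx : x ∈ U) {c : ℝ} (hc : ∀ j, c ≠ N.ξ j x) :
    HasFDerivAt (fun y => (conePoly N g μ y).eval c) (0 : E →L[ℝ] ℝ) x := by
  have hg := hK.riemannian
  have hA := hE.sol
  have hξ := fun j => (hN.contDiffAt_ξ hU hx j).differentiableAt (by simp)
  have hev : ∀ᶠ y in nhds x, y ∈ U ∧ ∀ j, c ≠ N.ξ j y :=
    Filter.Eventually.and (hU.mem_nhds hx) (Filter.eventually_all.2 fun j =>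
      ((hξ j).continuousAt.eventually_ne (hc j).symm).mono fun _ h => h.symm)
  set u := resolvent N g c with hu
  have hud : DifferentiableAt ℝ u x := by
    rw [hu]
    unfold resolvent
    refine DifferentiableAt.fun_sum fun j _ => DifferentiableAt.fun_smul
      (DifferentiableAt.fun_inv (((differentiableAt_const c).sub (hξ j)).const_mul 2)
        (mul_ne_zero two_ne_zero (sub_ne_zero.2 (hc j))))
      ((hN.contDiffAt_grad hg hU hx j).differentiableAt (by simp))
  have hLd : DifferentiableAt ℝ L x := (hA.contDiffAt_L hU hx).differentiableAt (by simp)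
  have hAd : DifferentiableAt ℝ A x := (hA.contDiffAt_A hU hx).differentiableAt (by simp)
  have hgd : DifferentiableAt ℝ g x := (hg.contDiffAt hU hx).differentiableAt (by simp)
  have hμd : DifferentiableAt ℝ μ x :=
    (hE.smooth_μ.contDiffAt (hU.mem_nhds hx)).differentiableAt (by simp)
  have hfd : DifferentiableAt ℝ (fun y => g y (L y) (u y)) x := (hgd.clm_apply hLd).clm_apply hud
  have hF : (fun y => (conePoly N g μ y).eval c) =ᶠ[nhds x]
      fun y => (c - μ y - g y (L y) (u y)) * ∏ j, (c - N.ξ j y) := by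
    filter_upwards [hev] with y hy using hN.eval_conePoly_of_ne hK hU hA hy.1 hy.2
  have hres : (fun y => c • u y - A y (u y)) =ᶠ[nhds x] L := by
    filter_upwards [hev] with y hy using hN.resolvent_spec hK hU hA hy.1 hy.2
  have hres_x := hres.self_of_nhds
  -- Differentiating `c u - A u = Λ` and pairing with `u`: by symmetry `c - A` moves onto `u` and
  -- turns it back into `Λ`.
  have hdu : ∀ X, g x (L x) (covDerivVec g u x X) =
      g x (u x) (covDerivVec g L x X) + g x (u x) (covDerivEnd g A x X (u x)) := by
    intro X
    have h1 := covDerivVec_congr (g := g) hres X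
    rw [covDerivVec_sub (hud.fun_const_smul c) (hAd.clm_apply hud),
      covDerivVec_smul (differentiableAt_const c) hud, covDerivVec_end hAd hud] at h1
    rw [← h1, ← hres_x]
    simp only [map_sub, sub_apply, map_add, map_smul, smul_apply, smul_eq_mul,
      hA.hermitian.symm x hx]
    simp
    ring
  have hdf : ∀ X, fderiv ℝ (fun y => g y (L y) (u y)) x X = 2 * g x (L x) X
      + 2 * (μ x - c + g x (L x) (u x)) * g x (u x) X := by
    intro X
    have h2 : g x (u x) (A x X) = c * g x (u x) X - g x (L x) X := by
      rw [← hA.hermitian.symm x hx, ← hres_x]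
      simp only [map_sub, sub_apply, map_smul, smul_apply, smul_eq_mul]
      ring
    rw [fderiv_metric hg hU hx hLd hud, hdu, hg.symm x hx (covDerivVec g L x X), hE.cov_L x hx,
      hA.main x hx]
    simp only [map_add, map_smul, smul_eq_mul, h2]
    rw [hg.symm x hx (u x) (J x (L x)), hu, hN.metric_JL_resolvent hK hU hA hx, ← hu,
      hg.symm x hx (u x) (L x), hg.symm x hx X (u x)]
    ring
  have h1 := ((hμd.hasFDerivAt.const_sub c).sub hfd.hasFDerivAt).mul
    (HasFDerivAt.finsetProd (u := Finset.univ) fun j _ => (hξ j).hasFDerivAt.const_sub c)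
  refine (h1.congr_of_eventuallyEq hF).congr_fderiv ?_
  ext X
  have hq : ∀ j, ∏ i ∈ Finset.univ.erase j, (c - N.ξ i x) = (∏ i, (c - N.ξ i x)) / (c - N.ξ j x) :=
    fun j => by
      rw [← Finset.mul_prod_erase _ _ (Finset.mem_univ j),
        mul_div_cancel_left₀ _ (sub_ne_zero.2 (hc j))]
  have hux : g x (u x) X = ∑ j, fderiv ℝ (N.ξ j) x X / (2 * (c - N.ξ j x)) := by
    simp only [hu, resolvent, map_sum, sum_apply, map_smul, smul_apply, metric_grad hg hx,
      smul_eq_mul]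
    exact Finset.sum_congr rfl fun j _ => by rw [div_eq_inv_mul]
  have hsum : ∑ j, (∏ i, (c - N.ξ i x)) / (c - N.ξ j x) * fderiv ℝ (N.ξ j) x X =
      2 * (∏ i, (c - N.ξ i x)) * g x (u x) X := by
    rw [hux, Finset.mul_sum]
    refine Finset.sum_congr rfl fun j _ => ?_
    have := sub_ne_zero.2 (hc j)
    field_simp
  simp only [Pi.sub_apply, add_apply, sub_apply, neg_apply, smul_apply, sum_apply, smul_eq_mul, hq, hdf,
    hE.d_μ x hx, zero_apply, mul_neg, Finset.sum_neg_distrib, hsum]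
  ring

/-- For `c` above all `ξ_j` near `x` the value at `c` is constant on a ball. Infinitely many such
`c` determine the polynomial, so the excluded values `c = ξ_j` cause no trouble. -/
lemma conePoly_eventually_eq (hK : IsKahlerOn U g J) (hU : IsOpen U)
    (hE : IsExtSolOn U g J (-1) A L μ) (hx : x ∈ U) :
    ∀ᶠ y in nhds x, conePoly N g μ y = conePoly N g μ x := by
  obtain ⟨M, hM⟩ : ∃ M : ℝ, ∀ j, N.ξ j x < M := by
    obtain ⟨M, hM⟩ := (Set.finite_range fun j => N.ξ j x).bddAbove
    exact ⟨M + 1, fun j => by linarith [hM ⟨j, rfl⟩]⟩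
  have hev : ∀ᶠ y in nhds x, y ∈ U ∧ ∀ j, N.ξ j y < M :=
    Filter.Eventually.and (hU.mem_nhds hx) (Filter.eventually_all.2 fun j =>
      (hN.contDiffAt_ξ hU hx j).continuousAt.eventually_lt_const (hM j))
  obtain ⟨ε, hε, hball⟩ := Metric.eventually_nhds_iff_ball.1 hev
  filter_upwards [Metric.ball_mem_nhds x hε] with y hy
  refine Polynomial.eq_of_infinite_eval_eq _ _ ((Set.Ioi_infinite M).mono fun c hc => ?_)
  have hd : ∀ z ∈ Metric.ball x ε, HasFDerivAt (fun y => (conePoly N g μ y).eval c) 0 z :=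
    fun z hz => hN.fderiv_conePoly_of_ne hK hU hE (hball z hz).1
      fun j => (((hball z hz).2 j).trans hc).ne'
  exact Metric.isOpen_ball.is_const_of_fderiv_eq_zero (convex_ball x ε).isPreconnected
    (fun z hz => (hd z hz).differentiableAt.differentiableWithinAt) (fun z hz => (hd z hz).fderiv)
    hy (Metric.mem_ball_self hε)

lemma conePoly_eq (hK : IsKahlerOn U g J) (hU : IsOpen U) (hUc : IsPreconnected U)
    (hE : IsExtSolOn U g J (-1) A L μ) {x y : E} (hx : x ∈ U) (hy : y ∈ U) :
    conePoly N g μ x = conePoly N g μ y := by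
  refine Polynomial.funext fun c => ?_
  have hd : ∀ z ∈ U, HasFDerivAt (fun y => (conePoly N g μ y).eval c) (0 : E →L[ℝ] ℝ) z :=
    fun z hz => (hasFDerivAt_const _ z).congr_of_eventuallyEq
      ((hN.conePoly_eventually_eq hK hU hE hz).mono fun y hy => congrArg (Polynomial.eval c) hy)
  exact hU.is_const_of_fderiv_eq_zero hUc
    (fun z hz => (hd z hz).differentiableAt.differentiableWithinAt) (fun z hz => (hd z hz).fderiv)
    hx hy

/-- The constants `η_i` are roots of the polynomial. -/
lemma eval_conePoly_η (hK : IsKahlerOn U g J) (hU : IsOpen U)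
    (hE : IsExtSolOn U g J (-1) A L μ) (hx : x ∈ U) (i : Fin k) :
    (conePoly N g μ x).eval (N.η i) = 0 := by
  have hg := hK.riemannian
  have hA := hE.sol
  obtain ⟨X, hX, hX0⟩ := hN.exists_vertical_ne_zero hg hx i
  have hne : ∀ j, N.η i ≠ N.ξ j x := by
    intro j h
    have := Finset.prod_ne_zero_iff.1 (hN.pnc_ne_zero hg hx hX hX0) j (Finset.mem_univ j)
    exact this (sub_eq_zero.2 h)
  obtain ⟨Y, hY, hYx, hv⟩ := hN.exists_vertical_section hg hU hx hX
  have hYd : DifferentiableAt ℝ Y x := hY.differentiableAt (by simp)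
  -- `A Y = η Y` is differentiated along `Y` itself, for a vertical field `Y`. Its components along
  -- `grad ξ_j` give `dξ_j(∇_Y Y)`; inserting them into the derivative of `g(Λ, Y) = 0` yields the
  -- root equation.
  have h1 := covDerivEnd_of_eigenfield (g := g) (c := fun _ => N.η i)
    ((hA.contDiffAt_A hU hx).differentiableAt (by simp)) (differentiableAt_const _) hYd
    (by filter_upwards [hU.mem_nhds hx] with y hy using hN.end_vertical hK hU hy (hv y hy)) X
  rw [hYx, hA.main x hx, hN.L_vertical hK hU hA hx hX, hK.inner_J_self hx] at h1
  set D := covDerivVec g Y x X with hD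
  have hn := hg.pos x hx X hX0
  have h2 : ∀ j, fderiv ℝ (N.ξ j) x D = g x X X * (2 * weight N g x j / (N.η i - N.ξ j x)) := by
    intro j
    have h3 := congrArg (fun Z => g x Z (N.grad g j x)) h1
    have h4 : g x (J x X) (N.grad g j x) = 0 := by
      have h5 := hN.J_dξ x hx j X
      rw [hX.fibre, mul_zero] at h5
      rw [hg.symm x hx, metric_grad hg hx]
      linarith
    simp only [map_add, add_apply, map_smul, smul_apply, smul_eq_mul, h4,
      hA.hermitian.symm x hx D, hN.end_grad hK hx, (hN.L_grad hK hU hA hx j).1,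
      hg.symm x hx D, metric_grad hg hx, fderiv_fun_const, Pi.zero_apply, zero_apply] at h3
    have := sub_ne_zero.2 (hne j)
    unfold weight
    field_simp
    linarith
  have h3 : g x (covDerivVec g L x X) X + g x (L x) D = 0 := by
    have h4 := fderiv_metric hg hU hx ((hA.contDiffAt_L hU hx).differentiableAt (by simp)) hYd X
    have h5 : (fun y => g y (L y) (Y y)) =ᶠ[nhds x] fun _ => (0 : ℝ) := by
      filter_upwards [hU.mem_nhds hx] with y hy using hN.L_vertical hK hU hA hy (hv y hy)
    rw [h5.fderiv_eq, hYx] at h4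
    simpa using h4.symm
  rw [hE.cov_L x hx, hN.end_vertical hK hU hx hX, hN.metric_L hK hU hA hx D] at h3
  simp only [h2, ← Finset.mul_sum, map_add, add_apply, map_smul, smul_apply, smul_eq_mul] at h3
  refine (arrowPoly_isRoot_iff _ _ _ hne).2 ?_
  have h6 : ∑ j, 2 * weight N g x j / (N.η i - N.ξ j x) =
      2 * ∑ j, weight N g x j / (N.η i - N.xi x j) := by
    rw [Finset.mul_sum]
    exact Finset.sum_congr rfl fun j _ => mul_div_assoc _ _ _
  rw [h6] at h3
  have h7 : g x X X * (N.η i - μ x - ∑ j, weight N g x j / (N.η i - N.xi x j)) = 0 := by linarith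
  exact (mul_eq_zero.1 h7).resolve_left hn.ne'

end NormalFormData.IsNormalFormOn

/-! ### The eigenvalues of the endomorphism of the cone -/

namespace NormalFormData.IsNormalFormOn

variable {E : Type*} [NormedAddCommGroup E] [NormedSpace ℝ E] [FiniteDimensional ℝ E] {ℓ k : ℕ}
  {N : NormalFormData E ℓ k} {U : Set E} {g : BilinField E} {J A : EndField E} {L : E → E}
  {μ : E → ℝ} {τ : E → E →L[ℝ] ℝ} (hN : N.IsNormalFormOn U g J A)
include hN

lemma hasEigenvalue_of_eval_conePoly (hK : IsKahlerOn U g J) (hU : IsOpen U)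
    (hA : IsSolOn U g J A L) {p : ℝ × ℝ × E} (hp : p ∈ coneSet U) {c : ℝ}
    (hc : (conePoly N g μ p.2.2).eval c = 0) :
    Module.End.HasEigenvalue
      (coneEnd g J τ A L μ p : (ℝ × ℝ × E) →ₗ[ℝ] (ℝ × ℝ × E)) c := by
  have hx := hp.2
  have hr : p.1 ≠ 0 := hp.1.ne'
  have hne := arrowPoly_root_ne (hN.ξ_injective _ hx)
    (fun j => (hN.weight_pos hK.riemannian hx j).ne') hc
  have h0 := (arrowPoly_isRoot_iff _ _ _ hne).1 hc
  -- The horizontal components of the eigen-equation force `(c - A) y = -Λ / r` when the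
  -- `∂_r`-component is 1 and the `φ`-component is 0; the `∂_r`-component of the equation is then
  -- `P(c) = 0`.
  set y : E := -(p.1⁻¹ • resolvent N g c p.2.2) with hy
  set v : ℝ × ℝ × E := (1, τ p.2.2 y, y) with hv
  have hφ : conePhi τ p v = 0 := sub_self _
  refine Module.End.hasEigenvalue_of_hasEigenvector (x := v)
    ⟨Module.End.mem_eigenspace_iff.2 ?_, fun h => one_ne_zero (congrArg Prod.fst h)⟩
  have hLu := hN.metric_L_resolvent hK hU hA hx c
  have hJu := hN.metric_JL_resolvent hK hU hA hx c
  have hres := hN.resolvent_spec hK hU hA hx hne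
  refine cone_ext (p := p) (τ := τ) ?_ ?_ ?_
  · change (coneEnd g J τ A L μ p v).1 = c * 1
    rw [coneEnd_fst]
    change μ p.2.2 * 1 - p.1 * g p.2.2 (L p.2.2) y = c * 1
    rw [hy, map_neg, map_smul, hLu, smul_eq_mul, mul_neg, mul_inv_cancel_left₀ hr]
    change c - μ p.2.2 - ∑ j, weight N g p.2.2 j / (c - N.ξ j p.2.2) = 0 at h0
    linarith
  · change conePhi τ p (coneEnd g J τ A L μ p v) = _
    rw [conePhi_coneEnd, hφ, map_smul, hφ]
    change μ p.2.2 * 0 + g p.2.2 (L p.2.2) (J p.2.2 y) = _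
    rw [hK.inner_J_left hx, neg_eq_zero] at hJu
    rw [hy, map_neg, map_smul, map_neg, map_smul, hJu]
    simp
  · change (coneEnd g J τ A L μ p v).2.2 = c • y
    rw [coneEnd_snd, hφ]
    change A p.2.2 y - (p.1⁻¹ * 1) • L p.2.2 - (0 : ℝ) • _ = c • y
    rw [← hres, hy, map_neg, map_smul]
    module

/-- If `P(c) ≠ 0`, then `c` differs from every `η_i`. The eigen-equation splits into two copies of
the arrow system, whose only solution is zero; what is left of the eigenvector is orthogonal to all
vertical vectors, so it vanishes. -/
lemma eval_conePoly_of_hasEigenvalue (hK : IsKahlerOn U g J) (hU : IsOpen U)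
    (hE : IsExtSolOn U g J (-1) A L μ) {p : ℝ × ℝ × E} (hp : p ∈ coneSet U) {c : ℝ}
    (hc : Module.End.HasEigenvalue
      (coneEnd g J τ A L μ p : (ℝ × ℝ × E) →ₗ[ℝ] (ℝ × ℝ × E)) c) :
    (conePoly N g μ p.2.2).eval c = 0 := by
  have hg := hK.riemannian
  have hA := hE.sol
  have hx := hp.2
  have hr : p.1 ≠ 0 := hp.1.ne'
  obtain ⟨v, hv⟩ := hc.exists_hasEigenvector
  have hv0 := hv.2
  have hv1 : coneEnd g J τ A L μ p v = c • v := hv.apply_eq_smul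
  by_contra hP
  have e1 := congrArg Prod.fst hv1
  have e2 := congrArg (conePhi τ p) hv1
  have e3 := congrArg (fun w : ℝ × ℝ × E => w.2.2) hv1
  simp only [coneEnd_fst, conePhi_coneEnd, coneEnd_snd, map_smul, smul_eq_mul, Prod.smul_fst,
    Prod.smul_snd] at e1 e2 e3
  set y := v.2.2 with hy
  set x := p.2.2 with hxdef
  set s := conePhi τ p v with hs
  have hw := hN.weight_pos hg hx
  have hG : ∀ j Z, g x Z (N.grad g j x) = fderiv ℝ (N.ξ j) x Z := fun j Z => by
    rw [hg.symm x hx, metric_grad hg hx]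
  have hLG : ∀ j, g x (L x) (N.grad g j x) = 2 * weight N g x j := fun j => by
    rw [(hN.L_grad hK hU hA hx j).1, weight]
    ring
  -- the two arrow systems, for `y` and for `J y`
  have key : ∀ (α : ℝ) (d : Fin ℓ → ℝ), (c - μ x) * α = (∑ j, d j) / 2 →
      (∀ j, (c - N.ξ j x) * d j = α * (2 * weight N g x j)) → α = 0 ∧ ∀ j, d j = 0 := by
    intro α d h1 h2
    have hα : α = 0 := by
      by_cases hne : ∀ j, c ≠ N.ξ j x
      · have h3 : ∀ j, d j = 2 * (α * (weight N g x j / (c - N.ξ j x))) := fun j => by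
          have h4 := sub_ne_zero.2 (hne j)
          have h5 := h2 j
          field_simp
          linarith
        simp only [h3, ← Finset.mul_sum] at h1
        have h4 : (c - μ x - ∑ j, weight N g x j / (c - N.xi x j)) * α = 0 := by
          change (c - μ x - ∑ j, weight N g x j / (c - N.ξ j x)) * α = 0
          linarith
        exact (mul_eq_zero.1 h4).resolve_left
          fun h => hP ((arrowPoly_isRoot_iff _ _ _ hne).2 h)
      -- When `c` equals some `ξ_j`, the `j`th equation forces `α = 0` because its weight is
      -- positive; `d j = 0` then comes from the border equation.
      · push Not at hne
        obtain ⟨j, rfl⟩ := hne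
        have := h2 j
        rw [sub_self, zero_mul, eq_comm] at this
        exact (mul_eq_zero.1 this).resolve_right (mul_ne_zero two_ne_zero (hw j).ne')
    refine ⟨hα, fun j => ?_⟩
    subst hα
    have h3 : ∀ i, c ≠ N.ξ i x → d i = 0 := fun i hi => by
      have := h2 i
      rw [zero_mul] at this
      exact (mul_eq_zero.1 this).resolve_left (sub_ne_zero.2 hi)
    by_cases hj : c = N.ξ j x
    · rw [mul_zero, Finset.sum_eq_single j (fun i _ hi => h3 i fun h => hi
        (hN.ξ_injective x hx (h.symm.trans hj))) (by simp)] at h1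
      linarith
    · exact h3 j hj
  have hLy : ∀ Z, g x (L x) Z = (∑ j, fderiv ℝ (N.ξ j) x Z) / 2 := fun Z => by
    rw [hN.metric_L hK hU hA hx]
    ring
  have hAd : ∀ j, fderiv ℝ (N.ξ j) x (A x y) = N.ξ j x * fderiv ℝ (N.ξ j) x y := fun j => by
    rw [← hG, hA.hermitian.symm x hx, hN.end_grad hK hx, map_smul, hG, smul_eq_mul]
  have hAJ : ∀ j, fderiv ℝ (N.ξ j) x (J x (A x y)) = N.ξ j x * fderiv ℝ (N.ξ j) x (J x y) :=
    fun j => by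
    rw [← hG, ← hA.hermitian.comm x hx, hA.hermitian.symm x hx, hN.end_grad hK hx, map_smul, hG,
      smul_eq_mul]
  obtain ⟨ha, hd⟩ := key (v.1 * p.1⁻¹) (fun j => -fderiv ℝ (N.ξ j) x y)
    (by
      rw [Finset.sum_neg_distrib, neg_div, ← hLy]
      field_simp
      linarith)
    (fun j => by
      have h1 := congrArg (fun Z => g x Z (N.grad g j x)) e3
      simp only [map_sub, sub_apply, map_smul, smul_apply, smul_eq_mul, hLG,
        (hN.L_grad hK hU hA hx j).2, hG, hAd] at h1
      linarith)
  obtain ⟨hs0, hd'⟩ := key s (fun j => fderiv ℝ (N.ξ j) x (J x y))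
    (by
      rw [← hLy]
      linarith)
    (fun j => by
      have h1 := congrArg (fun Z => g x (J x Z) (N.grad g j x)) e3
      simp only [map_sub, sub_apply, map_smul, smul_apply, smul_eq_mul, hK.J_sq x hx, map_neg,
        neg_apply, hLG, (hN.L_grad hK hU hA hx j).2, hG, hAJ] at h1
      linarith)
  have hv1' : v.1 = 0 := (mul_eq_zero.1 ha).resolve_right (inv_ne_zero hr)
  rw [hv1', hs0, mul_zero, zero_smul, zero_smul, sub_zero, sub_zero] at e3
  have hη : ∀ i, c ≠ N.η i := by
    rintro i rfl
    exact hP (hN.eval_conePoly_η hK hU hE hx i)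
  have hy0 : y = 0 := by
    refine hN.eq_zero_of_orthogonal hK hx (fun j => neg_eq_zero.1 (hd j)) hd' fun i X hX => ?_
    have h1 := hA.hermitian.symm x hx y X
    rw [e3, hN.end_vertical hK hU hx hX, map_smul, map_smul, smul_apply, smul_eq_mul,
      smul_eq_mul] at h1
    have h2 : (c - N.η i) * g x y X = 0 := by linarith
    exact (mul_eq_zero.1 h2).resolve_left (sub_ne_zero.2 (hη i))
  refine hv0 (cone_ext (p := p) (τ := τ) hv1' ?_ hy0)
  rw [map_zero]
  exact hs0

end NormalFormData.IsNormalFormOn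

end CProj

end

/-! ### Assembly of the theorem -/

theorem propositionA5 {E : Type*} [NormedAddCommGroup E] [NormedSpace ℝ E] [FiniteDimensional ℝ E]
    (m : ℕ) (hm : 2 ≤ m) (hdim : Module.finrank ℝ E = 2 * m)
    -- a Kähler structure on a connected open set
    (U : Set E) (hUo : IsOpen U) (hUc : IsConnected U)
    (g : CProj.BilinField E) (J : CProj.EndField E) (hK : CProj.IsKahlerOn U g J)
    -- which is `C_ℂ(-1)`
    (hCC : CProj.IsCC U g J (-1))
    -- an element of `Sol(g, J)`, and the normal form relative to it
    (A : CProj.EndField E) (L : E → E) (hA : CProj.IsSolOn U g J A L)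
    (ℓ k : ℕ) (N : CProj.NormalFormData E ℓ k) (hN : N.IsNormalFormOn U g J A)
    -- the `1`-form which defines the cone: `φ = dt - τ` satisfies `dφ = 2 ω`
    (τ : E → E →L[ℝ] ℝ) (hτ : ContDiffOn ℝ ∞ τ U)
    (hdτ : ∀ x ∈ U, ∀ X Y, CProj.extDerivOne τ x X Y = -2 * CProj.kahlerForm g J x X Y) :
    ∃ (μ : E → ℝ) (Ahat : CProj.EndField (ℝ × ℝ × E)),
      -- `Ahat` is the parallel hermitian endomorphism of the cone which corresponds to `A`
      CProj.IsExtSolOn U g J (-1) A L μ ∧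
      CProj.ConeCorresponds U g J τ A L μ Ahat ∧
      CProj.IsHermitianEndOn (CProj.coneSet U) (CProj.coneMetric g τ) (CProj.coneJ J τ) Ahat ∧
      CProj.IsParallelOn (CProj.coneSet U) (CProj.coneMetric g τ) Ahat ∧
      -- its distinct eigenvalues are `C_0 < ⋯ < C_ℓ`, and they determine the functions `Θ_j`
      ∃ C : Fin (ℓ + 1) → ℝ, StrictMono C ∧
        (∀ p ∈ CProj.coneSet U, ∀ c : ℝ,
          Module.End.HasEigenvalue (Ahat p : (ℝ × ℝ × E) →ₗ[ℝ] (ℝ × ℝ × E)) c ↔ ∃ I, C I = c) ∧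
        ∀ j : Fin ℓ, ∀ t ∈ N.ξ j '' U, N.Θ j t = -4 * ∏ I, (t - C I) := by

  have hdim' : 2 < Module.finrank ℝ E := by omega
  obtain ⟨μ, hE⟩ := hA.exists_isExtSolOn hK hUo hUc.isPreconnected hdim' hCC
    fun x hx => hN.covDeriv_L_symm hK hUo hA hx
  have hg := hK.riemannian
  obtain ⟨x₀, hx₀⟩ := hUc.nonempty
  -- The `C_I` are the roots of the polynomial at one base point; constancy on `U` carries them to
  -- every point of the cone.
  obtain ⟨C, hC, hroots, hprod⟩ := CProj.exists_strictMono_roots_arrowPoly (μ x₀)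
    (hN.ξ_injective x₀ hx₀) (hN.weight_pos hg hx₀)
  have hP : ∀ x ∈ U, CProj.NormalFormData.IsNormalFormOn.conePoly N g μ x =
      CProj.NormalFormData.IsNormalFormOn.conePoly N g μ x₀ :=
    fun x hx => hN.conePoly_eq hK hUo hUc.isPreconnected hE hx hx₀
  refine ⟨μ, CProj.coneEnd g J τ A L μ, hE, CProj.coneEnd_corresponds hK,
    CProj.coneEnd_hermitian hK hτ hA hE.smooth_μ, CProj.coneEnd_parallel hK hUo hτ hdτ hE,
    C, hC, fun p hp c => ?_, ?_⟩
  · rw [← hroots]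
    change _ ↔ (CProj.NormalFormData.IsNormalFormOn.conePoly N g μ x₀).eval c = 0
    rw [← hP _ hp.2]
    exact ⟨hN.eval_conePoly_of_hasEigenvalue hK hUo hE hp,
      hN.hasEigenvalue_of_eval_conePoly hK hUo hA hp⟩
  · rintro j _ ⟨x, hx, rfl⟩
    rw [← hprod]
    change _ = -4 * (CProj.NormalFormData.IsNormalFormOn.conePoly N g μ x₀).eval _
    rw [← hP x hx, hN.eval_conePoly_ξ hg hx]
    ring
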